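/- Let $V$ be a complete discrete valuation ring with uniformiser $\pi$, residue field $\mathbb F$ and fraction field $F$ of characteristic $0$. Algebras are associative and need not be unital. **Conventions.** A bornological $V$-module is a $V$-module with a bornology in which the submodule generated by a bounded subset is bounded; a bornological algebra has, in addition, a bounded multiplication. A bornological module $M$ is *torsionfree* if multiplication by $\pi$ is a bornological embedding, *complete* if each bounded submodule is contained in a bounded $\pi$-adically complete (Hausdorff) submodule, and *fine mod $\pi$* if the quotient bornology on $M/\pi M$ is the fine one (bounded means contained in a finitely generated submodule). A bornological algebra is *semi-dagger* if $S^\diamond=\sum_{j\ge0}\pi^jS^{j+1}$ is bounded for each bounded submodule $S$, and a *dagger algebra* if it is complete, torsionfree and semi-dagger. $R^{\mathrm{lg}}$ is $R$ with the linear growth bornology (bounded means contained in some $S^\diamond$ with $S$ a bounded submodule of $R$). $\overline{R}$ is the completion of $R$, the separated quotient of the inductive limit of the $\pi$-adic completions of the bounded submodules. For an ideal $I$ in a torsionfree bornological algebra $R$ and $l\ge1$, the tube algebra is $\mathcal U(R,I^l)=\sum_{j\ge0}\pi^{-j}I^{lj}\subseteq R\otimes F$ (with $I^0=R$), with the subspace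 bornology; $\mathcal U(R,I^\infty)$ is the projective system $(\mathcal U(R,I^l))_{l\ge1}$. By $\mathcal U(I,I^\infty)$ we mean the same construction for the bornological algebra $I$ (with the subspace bornology) and its ideal $I$. An *extension of pro-algebras* is a diagram of pro-homomorphisms isomorphic to a projective system of extensions $K\rightarrowtail E\twoheadrightarrow Q$ of bornological algebras (a bornological embedding onto the kernel of a bornological quotient map). A projective system is *pro-dagger* (*fine mod $\pi$*) if all its entries are dagger algebras (fine mod $\pi$). A projective system $(N_n)$ is *analytically nilpotent* if it is isomorphic to a pro-dagger algebra and for each $n$ there are $m\ge n$ and $k\ge1$ such that $N_m\to N_n$ maps $N_m^k$ into $\pi N_n$. **Theorem.** Let $A$ be an $\mathbb F$-algebra, viewed as a constant projective system of bornological $V$-algebras with the fine bornology. 1. Let $W$ be a torsionfree complete bornological $V$-module that is fine mod $\pi$, and let $\varrho\colon W\to A$ be a surjective $V$-linear map. Let $\mathsf TW=\bigoplus_{n\ge1}W^{\otimes n}$ be the non-unital tensor algebra, in which a subset is bounded if and only if it is contained in the image of $\sum_{n=1}^aB^{\otimes n}$ for some $a\in\mathbb N$ and some bounded submodule $B\subseteq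 W$. Let $\varrho^\#\colon\mathsf TW\to A$ be the homomorphism that extends $\varrho$, and let $I=\ker\varrho^\#$. Then there is an extension of pro-algebras $$\overline{\mathcal U(I,I^\infty)^{\mathrm{lg}}}\rightarrowtail\overline{\mathcal U(\mathsf TW,I^\infty)^{\mathrm{lg}}}\twoheadrightarrow A,$$ where the first map is induced by the inclusion $I\subseteq\mathsf TW$ and the second map restricts to $\varrho^\#$ on $\mathsf TW$. Here $\overline{\mathcal U(\mathsf TW,I^\infty)^{\mathrm{lg}}}$ is a pro-dagger algebra that is fine mod $\pi$, and $\overline{\mathcal U(I,I^\infty)^{\mathrm{lg}}}$ is analytically nilpotent. 2. Consequently, for every $\mathbb F$-algebra $A$ there is an extension of pro-algebras $N\rightarrowtail D\twoheadrightarrow A$ where $D$ is a pro-dagger algebra that is fine mod $\pi$ and $N$ is analytically nilpotent. -/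

import Mathlib

open scoped TensorProduct Pointwise

universe u v v₁ v₂ v₃ w

/-! Bornological modules and algebras over a commutative ring `V` with a distinguished element `π`
(in the theorem: a complete discrete valuation ring and a uniformiser), projective systems of
them, tensor algebras, tube algebras, linear growth bornologies and completions.
Algebras are associative and need not be unital or commutative. -/

namespace DaggerLift

/-! ### Bornological modules -/

/-- A module bornology: a bornology such that the `V`-submodule generated by a bounded subset is
again bounded. -/
structure VBornology (V : Type u) [CommRing V] (M : Type v) [AddCommGroup M] [Module V M]
    extends Bornology M where
  isBounded_span : ∀ s : Set M, Bornology.IsBounded s →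
    Bornology.IsBounded (Submodule.span V s : Set M)

namespace VBornology

section
variable {V : Type u} [CommRing V] {M : Type v} [AddCommGroup M] [Module V M]

/-- Bounded subsets. -/
def Bdd (b : VBornology V M) (s : Set M) : Prop := @Bornology.IsBounded M b.toBornology s

theorem Bdd.subset {b : VBornology V M} {s t : Set M} (ht : b.Bdd t) (h : s ⊆ t) : b.Bdd s :=
  @Bornology.IsBounded.subset M b.toBornology _ _ ht h

theorem Bdd.union {b : VBornology V M} {s t : Set M} (hs : b.Bdd s) (ht : b.Bdd t) :
    b.Bdd (s ∪ t) :=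
  @Bornology.IsBounded.union M b.toBornology _ _ hs ht

theorem Bdd.span {b : VBornology V M} {s : Set M} (hs : b.Bdd s) :
    b.Bdd (Submodule.span V s : Set M) := b.isBounded_span s hs

theorem bdd_singleton (b : VBornology V M) (x : M) : b.Bdd {x} :=
  @Bornology.isBounded_singleton M b.toBornology x

theorem Bdd.sup {b : VBornology V M} {S T : Submodule V M} (hS : b.Bdd (S : Set M))
    (hT : b.Bdd (T : Set M)) : b.Bdd ((S ⊔ T : Submodule V M) : Set M) :=
  (hS.union hT).span.subset (by
    have : S ⊔ T ≤ Submodule.span V ((S : Set M) ∪ T) := by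
      rw [Submodule.span_union, Submodule.span_eq, Submodule.span_eq]
    exact this)

/-- The bornology in which a set is bounded if and only if it is contained in a member of a given
directed covering family `P` of submodules. -/
def ofSubmodules (P : Submodule V M → Prop) (hmem : ∀ x : M, ∃ S, P S ∧ x ∈ S)
    (hsup : ∀ S T, P S → P T → ∃ U, P U ∧ S ≤ U ∧ T ≤ U) : VBornology V M where
  toBornology := Bornology.ofBounded {s | ∃ S, P S ∧ s ⊆ (S : Set M)}
    (by obtain ⟨S, hS, -⟩ := hmem 0; exact ⟨S, hS, Set.empty_subset _⟩)
    (by rintro s ⟨S, hS, h⟩ t hts; exact ⟨S, hS, hts.trans h⟩)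
    (by
      rintro s ⟨S, hS, h⟩ t ⟨T, hT, h'⟩
      obtain ⟨U, hU, h1, h2⟩ := hsup S T hS hT
      exact ⟨U, hU, Set.union_subset (h.trans h1) (h'.trans h2)⟩)
    (by intro x; obtain ⟨S, hS, h⟩ := hmem x; exact ⟨S, hS, Set.singleton_subset_iff.2 h⟩)
  isBounded_span := by
    intro s hs
    rw [Bornology.isBounded_ofBounded_iff] at hs ⊢
    obtain ⟨S, hS, h⟩ := hs
    exact ⟨S, hS, Submodule.span_le.2 h⟩

theorem bdd_ofSubmodules {P : Submodule V M → Prop} {hmem : ∀ x : M, ∃ S, P S ∧ x ∈ S}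
    {hsup : ∀ S T, P S → P T → ∃ U, P U ∧ S ≤ U ∧ T ≤ U} {s : Set M} :
    (ofSubmodules P hmem hsup).Bdd s ↔ ∃ S, P S ∧ s ⊆ (S : Set M) := by
  unfold Bdd ofSubmodules
  exact Bornology.isBounded_ofBounded_iff (sUnion_univ := by
    intro x; obtain ⟨S, hS, h⟩ := hmem x; exact ⟨S, hS, Set.singleton_subset_iff.2 h⟩) _

variable (V M) in
/-- The fine bornology: a subset is bounded if and only if it is contained in a finitely
generated submodule. -/
def fine : VBornology V M :=
  ofSubmodules (fun S => S.FG)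
    (fun x => ⟨Submodule.span V {x}, Submodule.fg_span_singleton x,
      Submodule.mem_span_singleton_self x⟩)
    (fun S T hS hT => ⟨S ⊔ T, hS.sup hT, le_sup_left, le_sup_right⟩)

/-- The subspace bornology, pulled back along a linear map: `s` is bounded if and only if its
image is bounded. -/
def induced {N : Type w} [AddCommGroup N] [Module V N] (b : VBornology V N) (f : M →ₗ[V] N) :
    VBornology V M :=
  ofSubmodules (fun S => b.Bdd (S.map f : Set N))
    (fun x => ⟨Submodule.span V {x}, by
      rw [Submodule.map_span]; exact (by simpa using b.bdd_singleton (f x) : b.Bdd (f '' {x})).span,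
      Submodule.mem_span_singleton_self x⟩)
    (fun S T hS hT => ⟨S ⊔ T, by
      show b.Bdd _
      rw [Submodule.map_sup]; exact hS.sup hT, le_sup_left, le_sup_right⟩)

theorem bdd_induced {N : Type w} [AddCommGroup N] [Module V N] {b : VBornology V N}
    {f : M →ₗ[V] N} {s : Set M} : (b.induced f).Bdd s ↔ b.Bdd (f '' s) := by
  refine bdd_ofSubmodules.trans ⟨?_, fun h => ⟨Submodule.span V s, ?_, Submodule.subset_span⟩⟩
  · rintro ⟨S, hS, h⟩
    exact hS.subset (Set.image_mono h)
  · show b.Bdd _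
    rw [Submodule.map_span]; exact h.span

/-- The quotient bornology: a subset of `M ⧸ N` is bounded if and only if it is contained in the
image of a bounded submodule. -/
def quotient (b : VBornology V M) (N : Submodule V M) : VBornology V (M ⧸ N) :=
  ofSubmodules (fun T => ∃ S : Submodule V M, b.Bdd (S : Set M) ∧ T = S.map N.mkQ)
    (fun x => by
      obtain ⟨y, rfl⟩ := N.mkQ_surjective x
      exact ⟨_, ⟨Submodule.span V {y}, (b.bdd_singleton y).span, rfl⟩,
        Submodule.mem_map_of_mem (Submodule.mem_span_singleton_self y)⟩)
    (by
      rintro _ _ ⟨S, hS, rfl⟩ ⟨T, hT, rfl⟩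
      exact ⟨_, ⟨S ⊔ T, hS.sup hT, rfl⟩, Submodule.map_mono le_sup_left,
        Submodule.map_mono le_sup_right⟩)

theorem bdd_quotient {b : VBornology V M} {N : Submodule V M} {s : Set (M ⧸ N)} :
    (b.quotient N).Bdd s ↔
      ∃ S : Submodule V M, b.Bdd (S : Set M) ∧ s ⊆ (S.map N.mkQ : Set (M ⧸ N)) := by
  refine bdd_ofSubmodules.trans ⟨?_, ?_⟩
  · rintro ⟨_, ⟨S, hS, rfl⟩, h⟩; exact ⟨S, hS, h⟩
  · rintro ⟨S, hS, h⟩; exact ⟨_, ⟨S, hS, rfl⟩, h⟩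

/-- Bornologically torsionfree: multiplication by `π` is a bornological embedding. -/
def IsTorsionfree (b : VBornology V M) (π : V) : Prop :=
  (∀ x : M, π • x = 0 → x = 0) ∧ ∀ s : Set M, b.Bdd ((fun x => π • x) '' s) → b.Bdd s

/-- Complete: every bounded submodule is contained in a `π`-adically complete (and Hausdorff)
bounded submodule. -/
def IsComplete (b : VBornology V M) (π : V) : Prop :=
  ∀ S : Submodule V M, b.Bdd (S : Set M) → ∃ T : Submodule V M, b.Bdd (T : Set M) ∧ S ≤ T ∧
    IsAdicComplete (Ideal.span {π}) T

/-- Fine mod `π`: the quotient bornology on `M / π M` is the fine one. -/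
def IsFineMod (b : VBornology V M) (π : V) : Prop :=
  b.quotient (π • (⊤ : Submodule V M)) = fine V (M ⧸ (π • (⊤ : Submodule V M)))

end

end VBornology

/-! ### Bornological algebras -/

/-- A bornological `V`-algebra: an associative, possibly non-unital `V`-algebra with a module
bornology such that the multiplication is bounded. -/
structure BornAlg (V : Type u) [CommRing V] where
  carrier : Type v
  [ring : NonUnitalRing carrier]
  [module : Module V carrier]
  [tower : IsScalarTower V carrier carrier]
  [comm : SMulCommClass V carrier carrier]
  born : VBornology V carrier
  bdd_mul : ∀ s t : Set carrier, born.Bdd s → born.Bdd t →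
    born.Bdd (Set.image2 (fun x y => x * y) s t)

attribute [instance] BornAlg.ring BornAlg.module BornAlg.tower BornAlg.comm

instance (V : Type u) [CommRing V] : CoeSort (BornAlg.{u, v} V) (Type v) := ⟨BornAlg.carrier⟩

/-- Bounded algebra homomorphisms. -/
structure BHom {V : Type u} [CommRing V] (A : BornAlg.{u, v₁} V) (B : BornAlg.{u, v₂} V) where
  toHom : A →ₙₐ[V] B
  bdd : ∀ s : Set A, A.born.Bdd s → B.born.Bdd (toHom '' s)

namespace BHom

variable {V : Type u} [CommRing V] {A : BornAlg.{u, v₁} V} {B : BornAlg.{u, v₂} V}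
  {C : BornAlg.{u, v₃} V}

instance : CoeFun (BHom A B) (fun _ => A → B) := ⟨fun f => f.toHom⟩

@[ext]
theorem ext {f g : BHom A B} (h : ∀ x, f x = g x) : f = g := by
  cases f; cases g
  congr
  exact NonUnitalAlgHom.ext h

/-- The identity. -/
def id (A : BornAlg.{u, v₁} V) : BHom A A where
  toHom := NonUnitalAlgHom.id V A
  bdd := by intro s hs; simpa using hs

/-- Composition. -/
def comp (g : BHom B C) (f : BHom A B) : BHom A C where
  toHom := g.toHom.comp f.toHom
  bdd := by
    intro s hs
    have := g.bdd _ (f.bdd s hs)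
    rw [Set.image_image] at this
    exact this

@[simp] theorem id_apply (x : A) : (BHom.id A) x = x := rfl
@[simp] theorem comp_apply (g : BHom B C) (f : BHom A B) (x : A) : (g.comp f) x = g (f x) := rfl

end BHom

/-- An extension of bornological algebras `K ↣ E ↠ Q`: `i` is a bornological embedding onto the
kernel of `p`, and `p` is a bornological quotient map (surjective, and every bounded set lifts to
a bounded set). -/
structure IsExtension {V : Type u} [CommRing V] {K : BornAlg.{u, v₁} V} {E : BornAlg.{u, v₂} V}
    {Q : BornAlg.{u, v₃} V} (i : BHom K E) (p : BHom E Q) : Prop where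
  injective : Function.Injective i
  bdd_of_image : ∀ s : Set K, E.born.Bdd (i '' s) → K.born.Bdd s
  exact : ∀ x : E, p x = 0 ↔ ∃ y : K, i y = x
  surjective : Function.Surjective p
  exists_bdd_lift : ∀ t : Set Q, Q.born.Bdd t → ∃ s : Set E, E.born.Bdd s ∧ p '' s = t

/-! ### Projective systems and pro-homomorphisms -/

/-- A projective system of bornological algebras, indexed by the positive integers. -/
structure ProSys (V : Type u) [CommRing V] where
  obj : ℕ+ → BornAlg.{u, v} V
  map : ∀ {m n : ℕ+}, n ≤ m → BHom (obj m) (obj n)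
  map_id : ∀ n, map (le_refl n) = BHom.id (obj n)
  map_comp : ∀ {l m n : ℕ+} (h : m ≤ l) (h' : n ≤ m), (map h').comp (map h) = map (h'.trans h)

/-- A morphism of diagrams between projective systems. -/
structure SysHom {V : Type u} [CommRing V] (B : ProSys.{u, v₁} V) (C : ProSys.{u, v₂} V) where
  app : ∀ n, BHom (B.obj n) (C.obj n)
  naturality : ∀ {m n : ℕ+} (h : n ≤ m), (app n).comp (B.map h) = (C.map h).comp (app m)

/-- A representative of a pro-homomorphism, that is, of an element of
`lim_n colim_m Hom(B_m, C_n)`. Two representatives are the same pro-homomorphism if they are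
related by `ProHom.Equiv`. -/
structure ProHom {V : Type u} [CommRing V] (B : ProSys.{u, v₁} V) (C : ProSys.{u, v₂} V) where
  idx : ℕ+ → ℕ+
  hom : ∀ n, BHom (B.obj (idx n)) (C.obj n)
  compat : ∀ {m n : ℕ+} (h : n ≤ m), ∃ (k : ℕ+) (h₁ : idx n ≤ k) (h₂ : idx m ≤ k),
    (hom n).comp (B.map h₁) = (C.map h).comp ((hom m).comp (B.map h₂))

namespace ProSys

variable {V : Type u} [CommRing V]

/-- The constant projective system. -/
def const (A : BornAlg.{u, v} V) : ProSys.{u, v} V where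
  obj _ := A
  map _ := BHom.id A
  map_id _ := rfl
  map_comp _ _ := rfl

theorem map_map_apply (B : ProSys.{u, v} V) {l m n : ℕ+} (h : m ≤ l) (h' : n ≤ m)
    (x : B.obj l) : B.map h' (B.map h x) = B.map (h'.trans h) x := by
  rw [← B.map_comp h h']; rfl

end ProSys

namespace ProHom

variable {V : Type u} [CommRing V] {B : ProSys.{u, v₁} V} {C : ProSys.{u, v₂} V}
  {D : ProSys.{u, v₃} V}

/-- Equality of pro-homomorphisms in terms of representatives. -/
def Equiv (f g : ProHom B C) : Prop :=
  ∀ n, ∃ (k : ℕ+) (h₁ : f.idx n ≤ k) (h₂ : g.idx n ≤ k),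
    (f.hom n).comp (B.map h₁) = (g.hom n).comp (B.map h₂)

/-- The identity pro-homomorphism. -/
def id (B : ProSys.{u, v₁} V) : ProHom B B where
  idx n := n
  hom n := BHom.id _
  compat {m n} h := ⟨m, h, le_refl m, by ext x; simp [B.map_id]⟩

/-- Composition of pro-homomorphisms. -/
def comp (g : ProHom C D) (f : ProHom B C) : ProHom B D where
  idx n := f.idx (g.idx n)
  hom n := (g.hom n).comp (f.hom (g.idx n))
  compat {m n} h := by
    obtain ⟨k, h₁, h₂, e⟩ := g.compat h
    obtain ⟨k₁, a₁, a₂, e₁⟩ := f.compat h₁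
    obtain ⟨k₂, b₁, b₂, e₂⟩ := f.compat h₂
    refine ⟨k₁ ⊔ k₂, a₁.trans le_sup_left, b₁.trans le_sup_right, ?_⟩
    ext x
    have E := fun y => congrArg (fun F : BHom _ _ => F y) e
    have E₁ := fun y => congrArg (fun F : BHom _ _ => F y) e₁
    have E₂ := fun y => congrArg (fun F : BHom _ _ => F y) e₂
    simp only [BHom.comp_apply] at E E₁ E₂ ⊢
    have F₁ := E₁ (B.map le_sup_left x)
    have F₂ := E₂ (B.map le_sup_right x)
    simp only [ProSys.map_map_apply] at F₁ F₂
    rw [F₁, F₂, E]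

end ProHom

/-- A morphism of diagrams represents a pro-homomorphism. -/
def SysHom.toProHom {V : Type u} [CommRing V] {B : ProSys.{u, v₁} V} {C : ProSys.{u, v₂} V}
    (f : SysHom B C) : ProHom B C where
  idx n := n
  hom := f.app
  compat {m n} h := ⟨m, h, le_refl m, by rw [f.naturality h, B.map_id]; rfl⟩

/-- An isomorphism of projective systems (in the category of pro-algebras). -/
structure ProIso {V : Type u} [CommRing V] (B : ProSys.{u, v₁} V) (C : ProSys.{u, v₂} V) where
  hom : ProHom B C
  inv : ProHom C B
  hom_inv : (inv.comp hom).Equiv (ProHom.id B)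
  inv_hom : (hom.comp inv).Equiv (ProHom.id C)

/-- An extension of pro-algebras: a diagram `K → E → Q` of pro-homomorphisms that is isomorphic
to a projective system of extensions of bornological algebras. -/
def IsProExtension {V : Type u} [CommRing V] {K : ProSys.{u, v₁} V} {E : ProSys.{u, v₂} V}
    {Q : ProSys.{u, v₃} V} (i : ProHom K E) (p : ProHom E Q) : Prop :=
  ∃ (K' : ProSys.{u, v₁} V) (E' : ProSys.{u, v₂} V) (Q' : ProSys.{u, v₃} V)
    (i' : SysHom K' E') (p' : SysHom E' Q') (a : ProIso K K') (b : ProIso E E')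
    (c : ProIso Q Q'),
    (∀ n, IsExtension (i'.app n) (p'.app n)) ∧
    (b.hom.comp i).Equiv (i'.toProHom.comp a.hom) ∧
    (c.hom.comp p).Equiv (p'.toProHom.comp b.hom)

/-! ### Powers, linear growth, dagger algebras -/

section Powers

variable {V : Type u} [CommRing V] {R : Type v} [NonUnitalRing R] [Module V R]
  [IsScalarTower V R R] [SMulCommClass V R R]

/-- The linear span of all products `x * y` with `x ∈ P`, `y ∈ Q`. -/
def mulS (P Q : Submodule V R) : Submodule V R := Submodule.map₂ (LinearMap.mul V R) P Q

theorem mul_mem_mulS {P Q : Submodule V R} {x y : R} (hx : x ∈ P) (hy : y ∈ Q) :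
    x * y ∈ mulS P Q := Submodule.apply_mem_map₂ (LinearMap.mul V R) hx hy

theorem mulS_le {P Q T : Submodule V R} : mulS P Q ≤ T ↔ ∀ x ∈ P, ∀ y ∈ Q, x * y ∈ T :=
  Submodule.map₂_le

theorem mulS_mono {P P' Q Q' : Submodule V R} (h : P ≤ P') (h' : Q ≤ Q') :
    mulS P Q ≤ mulS P' Q' := Submodule.map₂_le_map₂ h h'

theorem mulS_assoc (P Q T : Submodule V R) : mulS (mulS P Q) T = mulS P (mulS Q T) := by
  apply le_antisymm
  · rw [mulS_le]
    intro z hz t ht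
    have : mulS P Q ≤ (mulS P (mulS Q T)).comap (LinearMap.mulRight V t) := by
      rw [mulS_le]
      intro x hx y hy
      show (x * y) * t ∈ mulS P (mulS Q T)
      rw [mul_assoc]
      exact mul_mem_mulS hx (mul_mem_mulS hy ht)
    exact this hz
  · rw [mulS_le]
    intro x hx z hz
    have : mulS Q T ≤ (mulS (mulS P Q) T).comap (LinearMap.mulLeft V x) := by
      rw [mulS_le]
      intro y hy t ht
      show x * (y * t) ∈ mulS (mulS P Q) T
      rw [← mul_assoc]
      exact mul_mem_mulS (mul_mem_mulS hx hy) ht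
    exact this hz

/-- `powS P n` is `P ^ (n + 1)`, the linear span of the products of `n + 1` elements of `P`. -/
def powS (P : Submodule V R) : ℕ → Submodule V R
  | 0 => P
  | n + 1 => mulS (powS P n) P

theorem mulS_powS (P : Submodule V R) (a b : ℕ) :
    mulS (powS P a) (powS P b) = powS P (a + b + 1) := by
  induction b with
  | zero => rfl
  | succ b ih =>
    show mulS (powS P a) (mulS (powS P b) P) = mulS (powS P (a + b + 1)) P
    rw [← mulS_assoc, ih]

theorem powS_mono {P Q : Submodule V R} (h : P ≤ Q) (n : ℕ) : powS P n ≤ powS Q n := by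
  induction n with
  | zero => exact h
  | succ n ih => exact mulS_mono ih h

/-- `diamond π P` is the sum over all `j ≥ 0` of `π ^ j • P ^ (j + 1)`. -/
def diamond (π : V) (P : Submodule V R) : Submodule V R := ⨆ j : ℕ, π ^ j • powS P j

theorem le_diamond (π : V) (P : Submodule V R) : P ≤ diamond π P := by
  have h : powS P 0 = π ^ 0 • powS P 0 := by rw [pow_zero, one_smul]
  exact h.le.trans (le_iSup (fun j : ℕ => π ^ j • powS P j) 0)

theorem diamond_mono (π : V) {P Q : Submodule V R} (h : P ≤ Q) : diamond π P ≤ diamond π Q :=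
  iSup_mono fun j => Submodule.map_mono (powS_mono h j)

theorem powS_mul_le (P : Submodule V R) (a b : ℕ) :
    powS P (a + b + 1) ≤ powS (P ⊔ mulS P P) (a + b) := by
  induction b generalizing a with
  | zero =>
    induction a with
    | zero => exact le_sup_right
    | succ a ih =>
      show mulS (powS P (a + 0 + 1)) P ≤ mulS (powS (P ⊔ mulS P P) (a + 0)) (P ⊔ mulS P P)
      exact mulS_mono ih le_sup_left
  | succ b ih =>
    have := ih (a + 1)
    rwa [show a + 1 + b = a + (b + 1) by ring] at this

theorem mulS_diamond_le (π : V) (P : Submodule V R) :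
    mulS (diamond π P) (diamond π P) ≤ diamond π (P ⊔ mulS P P) := by
  unfold mulS diamond
  rw [Submodule.map₂_iSup_left]
  refine iSup_le fun i => ?_
  rw [Submodule.map₂_iSup_right]
  refine iSup_le fun j => ?_
  refine Submodule.map₂_le.2 fun x hx y hy => ?_
  obtain ⟨x, hx', rfl⟩ := (Submodule.mem_smul_pointwise_iff_exists _ _ _).1 hx
  obtain ⟨y, hy', rfl⟩ := (Submodule.mem_smul_pointwise_iff_exists _ _ _).1 hy
  refine Submodule.mem_iSup_of_mem (i + j) ?_
  rw [LinearMap.mul_apply', smul_mul_smul_comm, ← pow_add]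
  refine Submodule.smul_mem_pointwise_smul _ _ _ (powS_mul_le P i j ?_)
  rw [← mulS_powS]
  exact mul_mem_mulS hx' hy'

theorem map_powS {R' : Type w} [NonUnitalRing R'] [Module V R'] [IsScalarTower V R' R']
    [SMulCommClass V R' R'] (f : R →ₙₐ[V] R') (P : Submodule V R) (n : ℕ) :
    (powS P n).map (f : R →ₗ[V] R') = powS (P.map (f : R →ₗ[V] R')) n := by
  induction n with
  | zero => rfl
  | succ n ih =>
    show (mulS (powS P n) P).map _ = mulS (powS _ n) _
    rw [← ih]
    apply le_antisymm
    · rw [Submodule.map_le_iff_le_comap, mulS_le]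
      intro x hx y hy
      rw [Submodule.mem_comap, show (f : R →ₗ[V] R') (x * y) = f x * f y from map_mul f x y]
      exact mul_mem_mulS ⟨x, hx, rfl⟩ ⟨y, hy, rfl⟩
    · rw [mulS_le]
      rintro _ ⟨x, hx, rfl⟩ _ ⟨y, hy, rfl⟩
      exact ⟨x * y, mul_mem_mulS hx hy, map_mul f x y⟩

theorem map_diamond {R' : Type w} [NonUnitalRing R'] [Module V R'] [IsScalarTower V R' R']
    [SMulCommClass V R' R'] (f : R →ₙₐ[V] R') (π : V) (P : Submodule V R) :
    (diamond π P).map (f : R →ₗ[V] R') = diamond π (P.map (f : R →ₗ[V] R')) := by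
  unfold diamond
  rw [Submodule.map_iSup]
  congr 1
  funext j
  rw [← map_powS]
  apply le_antisymm
  · rintro _ ⟨x, hx, rfl⟩
    obtain ⟨x, hx', rfl⟩ := (Submodule.mem_smul_pointwise_iff_exists _ _ _).1 hx
    rw [map_smul]
    exact Submodule.smul_mem_pointwise_smul _ _ _ (Submodule.mem_map_of_mem hx')
  · rintro z hz
    obtain ⟨_, ⟨x, hx, rfl⟩, rfl⟩ := (Submodule.mem_smul_pointwise_iff_exists _ _ _).1 hz
    exact ⟨_, Submodule.smul_mem_pointwise_smul _ _ _ hx, map_smul _ _ _⟩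

end Powers

namespace BornAlg

variable {V : Type u} [CommRing V]

theorem bdd_mulS (R : BornAlg.{u, v} V) {P Q : Submodule V R} (hP : R.born.Bdd (P : Set R))
    (hQ : R.born.Bdd (Q : Set R)) : R.born.Bdd (mulS P Q : Set R) := by
  refine (R.bdd_mul _ _ hP hQ).span.subset ?_
  have : mulS P Q ≤ Submodule.span V (Set.image2 (fun x y => x * y) (P : Set R) Q) :=
    mulS_le.2 fun x hx y hy => Submodule.subset_span ⟨x, hx, y, hy, rfl⟩
  exact this

/-- Semi-dagger: `diamond π S` is bounded for every bounded submodule `S`. -/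
def IsSemidagger (R : BornAlg.{u, v} V) (π : V) : Prop :=
  ∀ S : Submodule V R, R.born.Bdd (S : Set R) → R.born.Bdd (diamond π S : Set R)

/-- Dagger algebras: complete, bornologically torsionfree, semi-dagger. -/
structure IsDagger (R : BornAlg.{u, v} V) (π : V) : Prop where
  complete : R.born.IsComplete π
  torsionfree : R.born.IsTorsionfree π
  semidagger : R.IsSemidagger π

/-- The algebra `R` with the linear growth bornology: a subset is bounded if and only if it is
contained in `diamond π S` for a bounded submodule `S` of `R`. -/
@[reducible] def ling (R : BornAlg.{u, v} V) (π : V) : BornAlg.{u, v} V where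
  carrier := R
  born := VBornology.ofSubmodules
    (fun T => ∃ S : Submodule V R, R.born.Bdd (S : Set R) ∧ T = diamond π S)
    (fun x => ⟨_, ⟨Submodule.span V {x}, (R.born.bdd_singleton x).span, rfl⟩,
      le_diamond π _ (Submodule.mem_span_singleton_self x)⟩)
    (by
      rintro _ _ ⟨S, hS, rfl⟩ ⟨T, hT, rfl⟩
      exact ⟨_, ⟨S ⊔ T, hS.sup hT, rfl⟩, diamond_mono π le_sup_left, diamond_mono π le_sup_right⟩)
  bdd_mul := by
    intro s t hs ht
    obtain ⟨_, ⟨S, hS, rfl⟩, hs⟩ := VBornology.bdd_ofSubmodules.1 hs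
    obtain ⟨_, ⟨T, hT, rfl⟩, ht⟩ := VBornology.bdd_ofSubmodules.1 ht
    have hU := hS.sup hT
    refine VBornology.bdd_ofSubmodules.2 ⟨_, ⟨(S ⊔ T) ⊔ mulS (S ⊔ T) (S ⊔ T),
      hU.sup (R.bdd_mulS hU hU), rfl⟩, ?_⟩
    rintro _ ⟨x, hx, y, hy, rfl⟩
    exact mulS_diamond_le π (S ⊔ T)
      (mul_mem_mulS (diamond_mono π le_sup_left (hs hx)) (diamond_mono π le_sup_right (ht hy)))

theorem bdd_ling {R : BornAlg.{u, v} V} {π : V} {s : Set R} :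
    (R.ling π).born.Bdd s ↔
      ∃ S : Submodule V R, R.born.Bdd (S : Set R) ∧ s ⊆ (diamond π S : Set R) := by
  unfold ling
  rw [VBornology.bdd_ofSubmodules]
  constructor
  · rintro ⟨_, ⟨S, hS, rfl⟩, h⟩; exact ⟨S, hS, h⟩
  · rintro ⟨S, hS, h⟩; exact ⟨_, ⟨S, hS, rfl⟩, h⟩

/-- Functoriality of the linear growth bornology. -/
def lingMap {R : BornAlg.{u, v₁} V} {R' : BornAlg.{u, v₂} V} (π : V) (f : BHom R R') :
    BHom (R.ling π) (R'.ling π) where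
  toHom := f.toHom
  bdd := by
    intro s hs
    obtain ⟨S, hS, h⟩ := bdd_ling.1 hs
    refine bdd_ling.2 ⟨S.map (f.toHom : R →ₗ[V] R'), f.bdd _ hS, ?_⟩
    rw [← map_diamond]
    exact Set.image_mono h

/-- The identity map from `R` to `R` with the linear growth bornology. -/
def toLing (R : BornAlg.{u, v} V) (π : V) : BHom R (R.ling π) where
  toHom := NonUnitalAlgHom.id V R
  bdd := by
    intro s hs
    refine bdd_ling.2 ⟨Submodule.span V s, hs.span, ?_⟩
    rintro _ ⟨x, hx, rfl⟩
    exact le_diamond π _ (Submodule.subset_span hx)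

/-- A subalgebra with the subspace bornology. -/
@[reducible] def sub (R : BornAlg.{u, v} V) (S : NonUnitalSubalgebra V R) : BornAlg.{u, v} V where
  carrier := S
  born := R.born.induced S.toSubmodule.subtype
  bdd_mul := by
    intro s t hs ht
    rw [VBornology.bdd_induced] at hs ht ⊢
    refine (R.bdd_mul _ _ hs ht).subset ?_
    rintro _ ⟨_, ⟨x, hx, y, hy, rfl⟩, rfl⟩
    exact ⟨_, ⟨x, hx, rfl⟩, _, ⟨y, hy, rfl⟩, rfl⟩

theorem bdd_sub {R : BornAlg.{u, v} V} {S : NonUnitalSubalgebra V R} {s : Set S} :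
    (R.sub S).born.Bdd s ↔ R.born.Bdd (Subtype.val '' s) := VBornology.bdd_induced

/-! ### Ideals and quotients -/

/-- Two-sided ideals of a `V`-algebra. -/
structure AlgIdeal (R : BornAlg.{u, v} V) extends Submodule V R where
  mul_mem_left : ∀ (r : R) {x : R}, x ∈ toSubmodule → r * x ∈ toSubmodule
  mul_mem_right : ∀ (r : R) {x : R}, x ∈ toSubmodule → x * r ∈ toSubmodule

/-- The ideal `R` of `R`. -/
def AlgIdeal.top (R : BornAlg.{u, v} V) : AlgIdeal R where
  toSubmodule := ⊤
  mul_mem_left _ _ _ := trivial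
  mul_mem_right _ _ _ := trivial

/-- An ideal as a subalgebra. -/
def AlgIdeal.toSubalgebra {R : BornAlg.{u, v} V} (I : AlgIdeal R) : NonUnitalSubalgebra V R where
  toNonUnitalSubsemiring := {
    I.toSubmodule.toAddSubmonoid with
    mul_mem' := fun {a _} _ hb => I.mul_mem_left a hb }
  smul_mem' c _ hx := I.toSubmodule.smul_mem c hx

/-- An ideal as a bornological algebra in its own right, with the subspace bornology. -/
@[reducible] def AlgIdeal.toAlg {R : BornAlg.{u, v} V} (I : AlgIdeal R) : BornAlg.{u, v} V :=
  R.sub I.toSubalgebra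

/-- The inclusion of an ideal. -/
def AlgIdeal.incl {R : BornAlg.{u, v} V} (I : AlgIdeal R) : BHom I.toAlg R where
  toHom := NonUnitalSubalgebraClass.subtype I.toSubalgebra
  bdd _ hs := bdd_sub.1 hs

/-- The kernel of an algebra homomorphism. -/
def kerIdeal (R : BornAlg.{u, v} V) {A : Type w} [NonUnitalRing A] [Module V A]
    (f : R →ₙₐ[V] A) : AlgIdeal R where
  toSubmodule := LinearMap.ker (f : R →ₗ[V] A)
  mul_mem_left r x hx := by
    have hx : f x = 0 := hx
    show f (r * x) = 0
    rw [map_mul, hx, mul_zero]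
  mul_mem_right r x hx := by
    have hx : f x = 0 := hx
    show f (x * r) = 0
    rw [map_mul, hx, zero_mul]

/-- The multiplication on the quotient by an ideal. -/
def AlgIdeal.quotMul {R : BornAlg.{u, v} V} (I : AlgIdeal R) :
    (R ⧸ I.toSubmodule) → (R ⧸ I.toSubmodule) → (R ⧸ I.toSubmodule) :=
  Quotient.map₂ (fun x y => x * y) (by
    intro a a' h b b' h'
    replace h := (Submodule.quotientRel_def I.toSubmodule).1 h
    replace h' := (Submodule.quotientRel_def I.toSubmodule).1 h'
    refine (Submodule.quotientRel_def I.toSubmodule).2 ?_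
    have : a * b - a' * b' = (a - a') * b + a' * (b - b') := by
      rw [sub_mul, mul_sub]; abel
    rw [this]
    exact I.toSubmodule.add_mem (I.mul_mem_right b h) (I.mul_mem_left a' h'))

/-- The ring structure on the quotient by an ideal. -/
@[reducible] def AlgIdeal.quotRing {R : BornAlg.{u, v} V} (I : AlgIdeal R) :
    NonUnitalRing (R ⧸ I.toSubmodule) :=
  { (inferInstance : AddCommGroup (R ⧸ I.toSubmodule)) with
    mul := I.quotMul
    left_distrib := by
      rintro ⟨a⟩ ⟨b⟩ ⟨c⟩
      exact congrArg I.toSubmodule.mkQ (mul_add a b c)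
    right_distrib := by
      rintro ⟨a⟩ ⟨b⟩ ⟨c⟩
      exact congrArg I.toSubmodule.mkQ (add_mul a b c)
    zero_mul := by
      rintro ⟨a⟩
      exact congrArg I.toSubmodule.mkQ (zero_mul a)
    mul_zero := by
      rintro ⟨a⟩
      exact congrArg I.toSubmodule.mkQ (mul_zero a)
    mul_assoc := by
      rintro ⟨a⟩ ⟨b⟩ ⟨c⟩
      exact congrArg I.toSubmodule.mkQ (mul_assoc a b c) }

/-- The quotient by an ideal, with the quotient bornology. -/
def quot (R : BornAlg.{u, v} V) (I : AlgIdeal R) : BornAlg.{u, v} V :=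
  letI := I.quotRing
  { carrier := R ⧸ I.toSubmodule
    ring := I.quotRing
    module := Submodule.Quotient.module I.toSubmodule
    tower := ⟨by
      rintro c ⟨a⟩ ⟨b⟩
      exact congrArg I.toSubmodule.mkQ (smul_mul_assoc c a b)⟩
    comm := ⟨by
      rintro c ⟨a⟩ ⟨b⟩
      exact congrArg I.toSubmodule.mkQ (mul_smul_comm c a b).symm⟩
    born := R.born.quotient I.toSubmodule
    bdd_mul := by
      intro s t hs ht
      obtain ⟨S, hS, hs⟩ := VBornology.bdd_quotient.1 hs
      obtain ⟨T, hT, ht⟩ := VBornology.bdd_quotient.1 ht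
      refine VBornology.bdd_quotient.2 ⟨mulS S T, R.bdd_mulS hS hT, ?_⟩
      rintro _ ⟨x, hx, y, hy, rfl⟩
      obtain ⟨x, hx', rfl⟩ := hs hx
      obtain ⟨y, hy', rfl⟩ := ht hy
      exact ⟨x * y, mul_mem_mulS hx' hy', rfl⟩ }

/-- The quotient map. -/
def quotMk (R : BornAlg.{u, v} V) (I : AlgIdeal R) : BHom R (R.quot I) where
  toHom := {
    toFun := I.toSubmodule.mkQ
    map_smul' := fun _ _ => rfl
    map_zero' := rfl
    map_add' := fun _ _ => rfl
    map_mul' := fun _ _ => rfl }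
  bdd := by
    intro s hs
    exact VBornology.bdd_quotient.2 ⟨_, hs.span, Set.image_mono Submodule.subset_span⟩

/-- Functoriality of quotients. -/
def quotMap {R : BornAlg.{u, v₁} V} {R' : BornAlg.{u, v₂} V} {I : AlgIdeal R} {I' : AlgIdeal R'}
    (f : BHom R R') (h : ∀ x ∈ I.toSubmodule, f x ∈ I'.toSubmodule) :
    BHom (R.quot I) (R'.quot I') where
  toHom := {
    toFun := I.toSubmodule.mapQ I'.toSubmodule (f.toHom : R →ₗ[V] R') h
    map_smul' := fun c x => map_smul (I.toSubmodule.mapQ I'.toSubmodule (f.toHom : R →ₗ[V] R') h) c x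
    map_zero' := map_zero (I.toSubmodule.mapQ I'.toSubmodule (f.toHom : R →ₗ[V] R') h)
    map_add' := fun x y => map_add (I.toSubmodule.mapQ I'.toSubmodule (f.toHom : R →ₗ[V] R') h) x y
    map_mul' := by
      rintro ⟨a⟩ ⟨b⟩
      exact congrArg I'.toSubmodule.mkQ (map_mul f.toHom a b) }
  bdd := by
    intro s hs
    obtain ⟨S, hS, hs⟩ := VBornology.bdd_quotient.1 hs
    refine VBornology.bdd_quotient.2 ⟨S.map (f.toHom : R →ₗ[V] R'), f.bdd _ hS, ?_⟩
    rintro _ ⟨x, hx, rfl⟩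
    obtain ⟨x, hx', rfl⟩ := hs hx
    exact ⟨f x, ⟨x, hx', rfl⟩, rfl⟩

/-! ### Tensor product with the fraction field -/

/-- `F ⊗ R` for the fraction field `F` of `V`. A subset is bounded if and only if it is contained
in `e⁻¹ ⊗ S` for some nonzero `e` in `V` and a bounded submodule `S` of `R`; the set `e⁻¹ ⊗ S` is
written as the set of all `x` with `e • x ∈ 1 ⊗ S`. -/
@[reducible] noncomputable def frac [IsDomain V] (R : BornAlg.{u, v} V) :
    BornAlg.{u, max u v} V where
  carrier := FractionRing V ⊗[V] R
  born := VBornology.ofSubmodules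
    (fun T => ∃ e : V, e ≠ 0 ∧ ∃ S : Submodule V R, R.born.Bdd (S : Set R) ∧
      T = (S.map (TensorProduct.mk V (FractionRing V) R 1)).comap (LinearMap.lsmul V _ e))
    (fun x => by
      obtain ⟨⟨r, e⟩, h⟩ := IsLocalizedModule.surj (nonZeroDivisors V)
        (TensorProduct.mk V (FractionRing V) R 1) x
      exact ⟨_, ⟨e, nonZeroDivisors.ne_zero e.2, Submodule.span V {r},
        (R.born.bdd_singleton r).span, rfl⟩,
        ⟨r, Submodule.mem_span_singleton_self r, h.symm⟩⟩)
    (by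
      rintro _ _ ⟨e, he, S, hS, rfl⟩ ⟨e', he', S', hS', rfl⟩
      refine ⟨_, ⟨e * e', mul_ne_zero he he', S ⊔ S', hS.sup hS', rfl⟩, ?_, ?_⟩
      · intro x hx
        rw [Submodule.mem_comap, LinearMap.lsmul_apply, mul_comm, mul_smul]
        exact Submodule.smul_mem _ _ (Submodule.map_mono le_sup_left hx)
      · intro x hx
        rw [Submodule.mem_comap, LinearMap.lsmul_apply, mul_smul]
        exact Submodule.smul_mem _ _ (Submodule.map_mono le_sup_right hx))
  bdd_mul := by
    intro s t hs ht
    obtain ⟨_, ⟨e, he, S, hS, rfl⟩, hs⟩ := VBornology.bdd_ofSubmodules.1 hs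
    obtain ⟨_, ⟨e', he', S', hS', rfl⟩, ht⟩ := VBornology.bdd_ofSubmodules.1 ht
    refine VBornology.bdd_ofSubmodules.2
      ⟨_, ⟨e * e', mul_ne_zero he he', mulS S S', R.bdd_mulS hS hS', rfl⟩, ?_⟩
    rintro _ ⟨x, hx, y, hy, rfl⟩
    obtain ⟨a, ha, hxa⟩ := hs hx
    obtain ⟨b, hb, hyb⟩ := ht hy
    refine ⟨a * b, mul_mem_mulS ha hb, ?_⟩
    rw [LinearMap.lsmul_apply] at hxa hyb ⊢
    rw [← smul_mul_smul_comm, ← hxa, ← hyb]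
    simp [Algebra.TensorProduct.tmul_mul_tmul]

theorem bdd_frac [IsDomain V] {R : BornAlg.{u, v} V} {s : Set (FractionRing V ⊗[V] R)} :
    R.frac.born.Bdd s ↔ ∃ e : V, e ≠ 0 ∧ ∃ S : Submodule V R, R.born.Bdd (S : Set R) ∧
      ∀ x ∈ s, ∃ r ∈ S, (1 : FractionRing V) ⊗ₜ[V] r = e • x := by
  unfold frac
  rw [VBornology.bdd_ofSubmodules]
  constructor
  · rintro ⟨_, ⟨e, he, S, hS, rfl⟩, hs⟩
    exact ⟨e, he, S, hS, fun x hx => hs hx⟩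
  · rintro ⟨e, he, S, hS, hs⟩
    exact ⟨_, ⟨e, he, S, hS, rfl⟩, fun x hx => hs x hx⟩

/-- Functoriality of `F ⊗ R`. -/
noncomputable def fracMap [IsDomain V] {R : BornAlg.{u, v₁} V} {R' : BornAlg.{u, v₂} V}
    (f : BHom R R') : BHom R.frac R'.frac where
  toHom := {
    toFun := LinearMap.lTensor (FractionRing V) (f.toHom : R →ₗ[V] R')
    map_smul' := fun c x => map_smul (LinearMap.lTensor (FractionRing V) _) c x
    map_zero' := map_zero (LinearMap.lTensor (FractionRing V) _)
    map_add' := fun x y => map_add (LinearMap.lTensor (FractionRing V) _) x y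
    map_mul' := by
      intro (x : FractionRing V ⊗[V] R) (y : FractionRing V ⊗[V] R)
      induction x with
      | zero => simp only [zero_mul, map_zero]
      | add x x' hx hx' => simp only [add_mul, map_add, hx, hx']
      | tmul a r =>
        induction y with
        | zero => simp only [mul_zero, map_zero]
        | add y y' hy hy' => simp only [mul_add, map_add, hy, hy']
        | tmul b r' =>
          simp only [Algebra.TensorProduct.tmul_mul_tmul, LinearMap.lTensor_tmul]
          exact congrArg _ (map_mul f.toHom r r') }
  bdd := by
    intro s hs
    obtain ⟨e, he, S, hS, hs⟩ := bdd_frac.1 hs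
    refine bdd_frac.2 ⟨e, he, S.map (f.toHom : R →ₗ[V] R'), f.bdd _ hS, ?_⟩
    rintro _ ⟨x, hx, rfl⟩
    obtain ⟨r, hr, h⟩ := hs x hx
    refine ⟨f r, ⟨r, hr, rfl⟩, ?_⟩
    have := congrArg (LinearMap.lTensor (FractionRing V) (f.toHom : R →ₗ[V] R')) h
    rw [map_smul, LinearMap.lTensor_tmul] at this
    exact this

theorem fracMap_tmul [IsDomain V] {R : BornAlg.{u, v₁} V} {R' : BornAlg.{u, v₂} V}
    (f : BHom R R') (a : FractionRing V) (r : R) :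
    fracMap f (a ⊗ₜ[V] r) = a ⊗ₜ[V] f r := rfl

/-! ### Tube algebras -/

/-- `I ^ n` is the linear span of the products of `n` elements of `I`, with `I ^ 0 = R`. -/
def AlgIdeal.pow {R : BornAlg.{u, v} V} (I : AlgIdeal R) : ℕ → Submodule V R
  | 0 => ⊤
  | n + 1 => powS I.toSubmodule n

theorem AlgIdeal.mul_mem_powS_left {R : BornAlg.{u, v} V} (I : AlgIdeal R) (n : ℕ) (r : R) {x : R}
    (hx : x ∈ powS I.toSubmodule n) : r * x ∈ powS I.toSubmodule n := by
  induction n generalizing x with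
  | zero => exact I.mul_mem_left r hx
  | succ n ih =>
    have : mulS (powS I.toSubmodule n) I.toSubmodule ≤
        (powS I.toSubmodule (n + 1)).comap (LinearMap.mulLeft V r) := by
      rw [mulS_le]
      intro a ha b hb
      show r * (a * b) ∈ powS I.toSubmodule (n + 1)
      rw [← mul_assoc]
      exact mul_mem_mulS (ih ha) hb
    exact this hx

theorem AlgIdeal.mul_mem_powS_right {R : BornAlg.{u, v} V} (I : AlgIdeal R) (n : ℕ) (r : R)
    {x : R} (hx : x ∈ powS I.toSubmodule n) : x * r ∈ powS I.toSubmodule n := by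
  cases n with
  | zero => exact I.mul_mem_right r hx
  | succ n =>
    have : mulS (powS I.toSubmodule n) I.toSubmodule ≤
        (powS I.toSubmodule (n + 1)).comap (LinearMap.mulRight V r) := by
      rw [mulS_le]
      intro a ha b hb
      show (a * b) * r ∈ powS I.toSubmodule (n + 1)
      rw [mul_assoc]
      exact mul_mem_mulS ha (I.mul_mem_right r hb)
    exact this hx

theorem AlgIdeal.mul_mem_pow {R : BornAlg.{u, v} V} (I : AlgIdeal R) {a b : ℕ} {x y : R}
    (hx : x ∈ I.pow a) (hy : y ∈ I.pow b) : x * y ∈ I.pow (a + b) := by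
  cases a with
  | zero =>
    cases b with
    | zero => trivial
    | succ b =>
      rw [zero_add]
      exact I.mul_mem_powS_left b x hy
  | succ a =>
    cases b with
    | zero => exact I.mul_mem_powS_right a y hx
    | succ b =>
      have h := mul_mem_mulS hx hy
      rw [AlgIdeal.pow, AlgIdeal.pow, mulS_powS] at h
      rw [show a + 1 + (b + 1) = (a + b + 1) + 1 by ring]
      exact h

theorem AlgIdeal.pow_succ_le {R : BornAlg.{u, v} V} (I : AlgIdeal R) (n : ℕ) :
    I.pow (n + 1) ≤ I.pow n := by
  cases n with
  | zero => exact le_top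
  | succ n => exact mulS_le.2 fun a ha b _ => I.mul_mem_powS_right n b ha

theorem AlgIdeal.pow_antitone {R : BornAlg.{u, v} V} (I : AlgIdeal R) : Antitone I.pow :=
  antitone_nat_of_succ_le I.pow_succ_le

theorem AlgIdeal.map_pow {R : BornAlg.{u, v₁} V} {R' : BornAlg.{u, v₂} V} {I : AlgIdeal R}
    {I' : AlgIdeal R'} (f : BHom R R') (h : ∀ x ∈ I.toSubmodule, f x ∈ I'.toSubmodule) (n : ℕ)
    {x : R} (hx : x ∈ I.pow n) : f x ∈ I'.pow n := by
  cases n with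
  | zero => trivial
  | succ n =>
    have h1 : f x ∈ (powS I.toSubmodule n).map (f.toHom : R →ₗ[V] R') := ⟨x, hx, rfl⟩
    rw [map_powS] at h1
    exact powS_mono (Submodule.map_le_iff_le_comap.2 h) n h1

section Tube

variable [IsDomain V]

/-- The submodule `∑ j, π ^ (-j) I ^ (l j)` of `F ⊗ R`. -/
noncomputable def tubeSubmodule (R : BornAlg.{u, v} V) (I : AlgIdeal R) (π : V) (l : ℕ+) :
    Submodule V R.frac :=
  ⨆ j : ℕ, (I.pow ((l : ℕ) * j)).map
    (TensorProduct.mk V (FractionRing V) R ((algebraMap V (FractionRing V) π)⁻¹ ^ j))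

/-- The tube algebra as a subalgebra of `F ⊗ R`. -/
noncomputable def tubeSub (R : BornAlg.{u, v} V) (I : AlgIdeal R) (π : V) (l : ℕ+) :
    NonUnitalSubalgebra V R.frac where
  carrier := tubeSubmodule R I π l
  add_mem' := (tubeSubmodule R I π l).add_mem
  zero_mem' := (tubeSubmodule R I π l).zero_mem
  smul_mem' c _ := (tubeSubmodule R I π l).smul_mem c
  mul_mem' := by
    intro x y hx hy
    have key : mulS (tubeSubmodule R I π l) (tubeSubmodule R I π l) ≤ tubeSubmodule R I π l := by
      unfold mulS
      nth_rewrite 1 2 [tubeSubmodule]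
      rw [Submodule.map₂_iSup_left]
      refine iSup_le fun i => ?_
      rw [Submodule.map₂_iSup_right]
      refine iSup_le fun j => ?_
      refine Submodule.map₂_le.2 ?_
      rintro _ ⟨a, ha, rfl⟩ _ ⟨b, hb, rfl⟩
      refine Submodule.mem_iSup_of_mem (i + j) ⟨a * b, ?_, ?_⟩
      · rw [mul_add]
        exact I.mul_mem_pow ha hb
      · rw [LinearMap.mul_apply', TensorProduct.mk_apply, TensorProduct.mk_apply,
          TensorProduct.mk_apply, Algebra.TensorProduct.tmul_mul_tmul, pow_add]
    exact key (mul_mem_mulS hx hy)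

/-- The tube algebra of `I ^ l` in `R`, with the subspace bornology from `F ⊗ R`. -/
@[reducible] noncomputable def tube (R : BornAlg.{u, v} V) (I : AlgIdeal R) (π : V) (l : ℕ+) :
    BornAlg.{u, max u v} V :=
  R.frac.sub (tubeSub R I π l)

/-- Functoriality of tube algebras: for `f : R → R'` with `f(I) ⊆ I'` and `l' ≤ l`, the map
`F ⊗ f` restricts to the tube algebras of `I ^ l` and `I' ^ l'`. -/
noncomputable def tubeMap {R : BornAlg.{u, v₁} V} {R' : BornAlg.{u, v₂} V} {I : AlgIdeal R}
    {I' : AlgIdeal R'} (π : V) (f : BHom R R')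
    (h : ∀ x ∈ I.toSubmodule, f x ∈ I'.toSubmodule) {l l' : ℕ+} (hl : l' ≤ l) :
    BHom (tube R I π l) (tube R' I' π l') where
  toHom := NonUnitalAlgHom.codRestrict
    ((fracMap f).toHom.comp (NonUnitalSubalgebraClass.subtype (tubeSub R I π l))) (tubeSub R' I' π l') (by
      rintro ⟨x, hx⟩
      have key : tubeSubmodule R I π l ≤ (tubeSubmodule R' I' π l').comap
          ((fracMap f).toHom : R.frac →ₗ[V] R'.frac) := by
        refine iSup_le fun j => ?_
        rintro _ ⟨a, ha, rfl⟩
        refine Submodule.mem_iSup_of_mem j ⟨f a, ?_, rfl⟩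
        exact I'.pow_antitone (Nat.mul_le_mul_right j hl) (AlgIdeal.map_pow f h _ ha)
      exact key hx)
  bdd := by
    intro s hs
    rw [bdd_sub] at hs ⊢
    have := (fracMap f).bdd _ hs
    rw [Set.image_image] at this ⊢
    exact this

/-- The canonical map from `R` to its tube algebras. -/
noncomputable def toTube (R : BornAlg.{u, v} V) (I : AlgIdeal R) (π : V) (l : ℕ+) :
    BHom R (tube R I π l) where
  toHom := {
    toFun := fun r => ⟨1 ⊗ₜ[V] r, Submodule.mem_iSup_of_mem 0 ⟨r, trivial, by simp⟩⟩
    map_smul' := fun c r => Subtype.ext (TensorProduct.tmul_smul c 1 r)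
    map_zero' := Subtype.ext (TensorProduct.tmul_zero _ _)
    map_add' := fun r r' => Subtype.ext (TensorProduct.tmul_add _ _ _)
    map_mul' := fun r r' => Subtype.ext (by
      show (1 : FractionRing V) ⊗ₜ[V] (r * r') = (1 ⊗ₜ[V] r) * (1 ⊗ₜ[V] r')
      rw [Algebra.TensorProduct.tmul_mul_tmul, mul_one]) }
  bdd := by
    intro s hs
    rw [bdd_sub]
    refine bdd_frac.2 ⟨1, one_ne_zero, Submodule.span V s, hs.span, ?_⟩
    rintro _ ⟨_, ⟨r, hr, rfl⟩, rfl⟩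
    exact ⟨r, Submodule.subset_span hr, (one_smul _ _).symm⟩

end Tube

/-! ### Completion

The completion of `R` is the separated quotient of the inductive limit of the `π`-adic completions
of the bounded submodules of `R`. The inductive limit is realised as the algebra of
bornological Cauchy sequences modulo the bornological null sequences. -/

/-- The sequences in `S` that are Cauchy in the `π`-adic topology of `S`. -/
def cauchySubmodule {R : BornAlg.{u, v} V} (π : V) (S : Submodule V R) : Submodule V (ℕ → R) where
  carrier := {x | (∀ n, x n ∈ S) ∧ ∀ k : ℕ, ∃ N : ℕ, ∀ m ≥ N, ∀ n ≥ N, x m - x n ∈ π ^ k • S}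
  zero_mem' := ⟨fun _ => S.zero_mem, fun k => ⟨0, fun m _ n _ => by
    simp⟩⟩
  add_mem' := by
    rintro x y ⟨hx, hx'⟩ ⟨hy, hy'⟩
    refine ⟨fun n => S.add_mem (hx n) (hy n), fun k => ?_⟩
    obtain ⟨N, hN⟩ := hx' k
    obtain ⟨M, hM⟩ := hy' k
    refine ⟨N ⊔ M, fun m hm n hn => ?_⟩
    rw [Pi.add_apply, Pi.add_apply, add_sub_add_comm]
    exact Submodule.add_mem _ (hN m (le_sup_left.trans hm) n (le_sup_left.trans hn))
      (hM m (le_sup_right.trans hm) n (le_sup_right.trans hn))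
  smul_mem' := by
    rintro c x ⟨hx, hx'⟩
    refine ⟨fun n => S.smul_mem c (hx n), fun k => ?_⟩
    obtain ⟨N, hN⟩ := hx' k
    refine ⟨N, fun m hm n hn => ?_⟩
    rw [Pi.smul_apply, Pi.smul_apply, ← smul_sub]
    exact Submodule.smul_mem _ c (hN m hm n hn)

/-- The sequences in `S` that converge to `0` in the `π`-adic topology of `S`. -/
def nullSubmodule {R : BornAlg.{u, v} V} (π : V) (S : Submodule V R) : Submodule V (ℕ → R) where
  carrier := {x | (∀ n, x n ∈ S) ∧ ∀ k : ℕ, ∃ N : ℕ, ∀ n ≥ N, x n ∈ π ^ k • S}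
  zero_mem' := ⟨fun _ => S.zero_mem, fun k => ⟨0, fun _ _ => (π ^ k • S).zero_mem⟩⟩
  add_mem' := by
    rintro x y ⟨hx, hx'⟩ ⟨hy, hy'⟩
    refine ⟨fun n => S.add_mem (hx n) (hy n), fun k => ?_⟩
    obtain ⟨N, hN⟩ := hx' k
    obtain ⟨M, hM⟩ := hy' k
    exact ⟨N ⊔ M, fun n hn => Submodule.add_mem _ (hN n (le_sup_left.trans hn))
      (hM n (le_sup_right.trans hn))⟩
  smul_mem' := by
    rintro c x ⟨hx, hx'⟩
    refine ⟨fun n => S.smul_mem c (hx n), fun k => ?_⟩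
    obtain ⟨N, hN⟩ := hx' k
    exact ⟨N, fun n hn => Submodule.smul_mem _ c (hN n hn)⟩

section Cauchy

variable {R : BornAlg.{u, v} V} {π : V}

theorem cauchySubmodule_mono {S T : Submodule V R} (h : S ≤ T) :
    cauchySubmodule π S ≤ cauchySubmodule π T := by
  rintro x ⟨hx, hx'⟩
  refine ⟨fun n => h (hx n), fun k => ?_⟩
  obtain ⟨N, hN⟩ := hx' k
  exact ⟨N, fun m hm n hn => Submodule.map_mono h (hN m hm n hn)⟩

theorem nullSubmodule_mono {S T : Submodule V R} (h : S ≤ T) :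
    nullSubmodule π S ≤ nullSubmodule π T := by
  rintro x ⟨hx, hx'⟩
  refine ⟨fun n => h (hx n), fun k => ?_⟩
  obtain ⟨N, hN⟩ := hx' k
  exact ⟨N, fun n hn => Submodule.map_mono h (hN n hn)⟩

theorem smul_mul_mem {S T : Submodule V R} {c : V} {x y : R} (hx : x ∈ c • S) (hy : y ∈ T) :
    x * y ∈ c • mulS S T := by
  obtain ⟨x, hx', rfl⟩ := (Submodule.mem_smul_pointwise_iff_exists _ _ _).1 hx
  rw [smul_mul_assoc]
  exact Submodule.smul_mem_pointwise_smul _ _ _ (mul_mem_mulS hx' hy)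

theorem mul_smul_mem {S T : Submodule V R} {c : V} {x y : R} (hx : x ∈ S) (hy : y ∈ c • T) :
    x * y ∈ c • mulS S T := by
  obtain ⟨y, hy', rfl⟩ := (Submodule.mem_smul_pointwise_iff_exists _ _ _).1 hy
  rw [mul_smul_comm]
  exact Submodule.smul_mem_pointwise_smul _ _ _ (mul_mem_mulS hx hy')

theorem mul_mem_cauchySubmodule {S T : Submodule V R} {x y : ℕ → R}
    (hx : x ∈ cauchySubmodule π S) (hy : y ∈ cauchySubmodule π T) :
    x * y ∈ cauchySubmodule π (mulS S T) := by
  refine ⟨fun n => mul_mem_mulS (hx.1 n) (hy.1 n), fun k => ?_⟩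
  obtain ⟨N, hN⟩ := hx.2 k
  obtain ⟨M, hM⟩ := hy.2 k
  refine ⟨N ⊔ M, fun m hm n hn => ?_⟩
  have : (x * y) m - (x * y) n = (x m - x n) * y m + x n * (y m - y n) := by
    rw [Pi.mul_apply, Pi.mul_apply, sub_mul, mul_sub]; abel
  rw [this]
  exact Submodule.add_mem _
    (smul_mul_mem (hN m (le_sup_left.trans hm) n (le_sup_left.trans hn)) (hy.1 m))
    (mul_smul_mem (hx.1 n) (hM m (le_sup_right.trans hm) n (le_sup_right.trans hn)))

theorem const_mem_cauchySubmodule {S : Submodule V R} {x : R} (hx : x ∈ S) :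
    (fun _ => x) ∈ cauchySubmodule π S :=
  ⟨fun _ => hx, fun k => ⟨0, fun _ _ _ _ => by
    rw [sub_self]; exact (π ^ k • S).zero_mem⟩⟩

theorem map_smul_mem {R' : BornAlg.{u, w} V} (f : BHom R R') {S : Submodule V R} {c : V} {x : R}
    (hx : x ∈ c • S) : f x ∈ c • S.map (f.toHom : R →ₗ[V] R') := by
  obtain ⟨y, hy, rfl⟩ := (Submodule.mem_smul_pointwise_iff_exists _ _ _).1 hx
  exact (Submodule.mem_smul_pointwise_iff_exists _ _ _).2
    ⟨f y, ⟨y, hy, rfl⟩, (map_smul f.toHom c y).symm⟩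

theorem map_mem_cauchySubmodule {R' : BornAlg.{u, w} V} (f : BHom R R') {S : Submodule V R}
    {x : ℕ → R} (hx : x ∈ cauchySubmodule π S) :
    (fun n => f (x n)) ∈ cauchySubmodule π (S.map (f.toHom : R →ₗ[V] R')) := by
  refine ⟨fun n => ⟨x n, hx.1 n, rfl⟩, fun k => ?_⟩
  obtain ⟨N, hN⟩ := hx.2 k
  refine ⟨N, fun m hm n hn => ?_⟩
  rw [← show f (x m - x n) = f (x m) - f (x n) from map_sub f.toHom _ _]
  exact map_smul_mem f (hN m hm n hn)

theorem map_mem_nullSubmodule {R' : BornAlg.{u, w} V} (f : BHom R R') {S : Submodule V R}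
    {x : ℕ → R} (hx : x ∈ nullSubmodule π S) :
    (fun n => f (x n)) ∈ nullSubmodule π (S.map (f.toHom : R →ₗ[V] R')) := by
  refine ⟨fun n => ⟨x n, hx.1 n, rfl⟩, fun k => ?_⟩
  obtain ⟨N, hN⟩ := hx.2 k
  exact ⟨N, fun n hn => map_smul_mem f (hN n hn)⟩

end Cauchy

/-- The bornological Cauchy sequences: those that are Cauchy in some bounded submodule. -/
def cauchySub (R : BornAlg.{u, v} V) (π : V) : NonUnitalSubalgebra V (ℕ → R) where
  carrier := {x | ∃ S : Submodule V R, R.born.Bdd (S : Set R) ∧ x ∈ cauchySubmodule π S}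
  zero_mem' := ⟨⊥, R.born.bdd_singleton 0, Submodule.zero_mem _⟩
  add_mem' := by
    rintro x y ⟨S, hS, hx⟩ ⟨T, hT, hy⟩
    exact ⟨S ⊔ T, hS.sup hT, Submodule.add_mem _ (cauchySubmodule_mono le_sup_left hx)
      (cauchySubmodule_mono le_sup_right hy)⟩
  smul_mem' := by
    rintro c x ⟨S, hS, hx⟩
    exact ⟨S, hS, Submodule.smul_mem _ c hx⟩
  mul_mem' := by
    rintro x y ⟨S, hS, hx⟩ ⟨T, hT, hy⟩
    exact ⟨mulS S T, R.bdd_mulS hS hT, mul_mem_cauchySubmodule hx hy⟩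

/-- The algebra of bornological Cauchy sequences; a set of sequences is bounded if and only if
all its members are Cauchy in one and the same bounded submodule. -/
@[reducible] def cauchyAlg (R : BornAlg.{u, v} V) (π : V) : BornAlg.{u, v} V where
  carrier := cauchySub R π
  born := VBornology.ofSubmodules
    (fun T => ∃ S : Submodule V R, R.born.Bdd (S : Set R) ∧
      T = (cauchySubmodule π S).comap (cauchySub R π).toSubmodule.subtype)
    (by
      rintro ⟨x, S, hS, hx⟩
      exact ⟨_, ⟨S, hS, rfl⟩, hx⟩)
    (by
      rintro _ _ ⟨S, hS, rfl⟩ ⟨T, hT, rfl⟩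
      exact ⟨_, ⟨S ⊔ T, hS.sup hT, rfl⟩, Submodule.comap_mono (cauchySubmodule_mono le_sup_left),
        Submodule.comap_mono (cauchySubmodule_mono le_sup_right)⟩)
  bdd_mul := by
    intro s t hs ht
    obtain ⟨_, ⟨S, hS, rfl⟩, hs⟩ := VBornology.bdd_ofSubmodules.1 hs
    obtain ⟨_, ⟨T, hT, rfl⟩, ht⟩ := VBornology.bdd_ofSubmodules.1 ht
    refine VBornology.bdd_ofSubmodules.2 ⟨_, ⟨mulS S T, R.bdd_mulS hS hT, rfl⟩, ?_⟩
    rintro _ ⟨x, hx, y, hy, rfl⟩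
    exact mul_mem_cauchySubmodule (hs hx) (ht hy)

theorem bdd_cauchyAlg {R : BornAlg.{u, v} V} {π : V} {s : Set (cauchySub R π)} :
    (R.cauchyAlg π).born.Bdd s ↔ ∃ S : Submodule V R, R.born.Bdd (S : Set R) ∧
      ∀ x ∈ s, x.1 ∈ cauchySubmodule π S := by
  unfold cauchyAlg
  rw [VBornology.bdd_ofSubmodules]
  constructor
  · rintro ⟨_, ⟨S, hS, rfl⟩, hs⟩
    exact ⟨S, hS, fun x hx => hs hx⟩
  · rintro ⟨S, hS, hs⟩
    exact ⟨_, ⟨S, hS, rfl⟩, fun x hx => hs x hx⟩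

/-- The ideal of bornological null sequences. -/
def nullIdeal (R : BornAlg.{u, v} V) (π : V) : AlgIdeal (R.cauchyAlg π) where
  carrier := {x | ∃ S : Submodule V R, R.born.Bdd (S : Set R) ∧ x.1 ∈ nullSubmodule π S}
  zero_mem' := ⟨⊥, R.born.bdd_singleton 0, Submodule.zero_mem _⟩
  add_mem' := by
    rintro x y ⟨S, hS, hx⟩ ⟨T, hT, hy⟩
    exact ⟨S ⊔ T, hS.sup hT, Submodule.add_mem _ (nullSubmodule_mono le_sup_left hx)
      (nullSubmodule_mono le_sup_right hy)⟩
  smul_mem' := by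
    rintro c x ⟨S, hS, hx⟩
    exact ⟨S, hS, Submodule.smul_mem _ c hx⟩
  mul_mem_left := by
    rintro ⟨r, S, hS, hr⟩ x ⟨T, hT, hx⟩
    refine ⟨mulS S T, R.bdd_mulS hS hT, fun n => mul_mem_mulS (hr.1 n) (hx.1 n), fun k => ?_⟩
    obtain ⟨N, hN⟩ := hx.2 k
    exact ⟨N, fun n hn => mul_smul_mem (hr.1 n) (hN n hn)⟩
  mul_mem_right := by
    rintro ⟨r, S, hS, hr⟩ x ⟨T, hT, hx⟩
    refine ⟨mulS T S, R.bdd_mulS hT hS, fun n => mul_mem_mulS (hx.1 n) (hr.1 n), fun k => ?_⟩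
    obtain ⟨N, hN⟩ := hx.2 k
    exact ⟨N, fun n hn => smul_mul_mem (hN n hn) (hr.1 n)⟩

/-- The inductive limit of the `π`-adic completions of the bounded submodules of `R`. -/
def limCompl (R : BornAlg.{u, v} V) (π : V) : BornAlg.{u, v} V :=
  (R.cauchyAlg π).quot (R.nullIdeal π)

/-- Bornologically closed submodules: `x` belongs to `Z` if it is the limit of a sequence in `Z`
that converges in the `π`-adic topology of some bounded submodule. -/
def IsBornClosed (R : BornAlg.{u, v} V) (π : V) (Z : Submodule V R) : Prop :=
  ∀ x : R, (∃ S : Submodule V R, R.born.Bdd (S : Set R) ∧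
    ∀ k : ℕ, ∃ z ∈ Z, x - z ∈ π ^ k • S) → x ∈ Z

theorem IsBornClosed.comap {R : BornAlg.{u, v₁} V} {R' : BornAlg.{u, v₂} V} {π : V}
    {Z : Submodule V R'} (hZ : R'.IsBornClosed π Z) (f : R →ₗ[V] R')
    (hf : ∀ S : Submodule V R, R.born.Bdd (S : Set R) → R'.born.Bdd (S.map f : Set R')) :
    R.IsBornClosed π (Z.comap f) := by
  rintro x ⟨S, hS, h⟩
  refine hZ _ ⟨S.map f, hf S hS, fun k => ?_⟩
  obtain ⟨z, hz, hxz⟩ := h k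
  refine ⟨f z, hz, ?_⟩
  obtain ⟨y, hy, e⟩ := (Submodule.mem_smul_pointwise_iff_exists _ _ _).1 hxz
  exact (Submodule.mem_smul_pointwise_iff_exists _ _ _).2
    ⟨f y, ⟨y, hy, rfl⟩, by rw [← map_smul, e, map_sub]⟩

/-- The bornological closure of `{0}`, that is, the smallest bornologically closed submodule. -/
def closureZero (R : BornAlg.{u, v} V) (π : V) : AlgIdeal R where
  toSubmodule := sInf {Z | R.IsBornClosed π Z}
  mul_mem_left r x hx := by
    rw [Submodule.mem_sInf] at hx ⊢
    intro Z hZ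
    refine hx _ (IsBornClosed.comap hZ (LinearMap.mulLeft V r) fun S hS => ?_)
    refine (R.bdd_mul _ _ (R.born.bdd_singleton r) hS).subset ?_
    rintro _ ⟨y, hy, rfl⟩
    exact ⟨r, rfl, y, hy, rfl⟩
  mul_mem_right r x hx := by
    rw [Submodule.mem_sInf] at hx ⊢
    intro Z hZ
    refine hx _ (IsBornClosed.comap hZ (LinearMap.mulRight V r) fun S hS => ?_)
    refine (R.bdd_mul _ _ hS (R.born.bdd_singleton r)).subset ?_
    rintro _ ⟨y, hy, rfl⟩
    exact ⟨y, hy, r, rfl, rfl⟩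

/-- The completion. -/
def completion (R : BornAlg.{u, v} V) (π : V) : BornAlg.{u, v} V :=
  (R.limCompl π).quot ((R.limCompl π).closureZero π)

/-- The canonical map to the completion. -/
def toCompletion (R : BornAlg.{u, v} V) (π : V) : BHom R (R.completion π) :=
  ((R.limCompl π).quotMk _).comp (((R.cauchyAlg π).quotMk _).comp
    { toHom := {
        toFun := fun x => ⟨fun _ => x, Submodule.span V {x}, (R.born.bdd_singleton x).span,
          const_mem_cauchySubmodule (Submodule.mem_span_singleton_self x)⟩
        map_smul' := fun _ _ => rfl
        map_zero' := rfl
        map_add' := fun _ _ => rfl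
        map_mul' := fun _ _ => rfl }
      bdd := by
        intro s hs
        refine bdd_cauchyAlg.2 ⟨Submodule.span V s, hs.span, ?_⟩
        rintro _ ⟨x, hx, rfl⟩
        exact const_mem_cauchySubmodule (Submodule.subset_span hx) })

/-- A bounded homomorphism acts on Cauchy sequences. -/
def cauchyMap {R : BornAlg.{u, v₁} V} {R' : BornAlg.{u, v₂} V} (π : V) (f : BHom R R') :
    BHom (R.cauchyAlg π) (R'.cauchyAlg π) where
  toHom := {
    toFun := fun x => ⟨fun n => f (x.1 n), by
      obtain ⟨S, hS, hx⟩ := x.2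
      exact ⟨S.map (f.toHom : R →ₗ[V] R'), f.bdd _ hS, map_mem_cauchySubmodule f hx⟩⟩
    map_smul' := fun c x => Subtype.ext (funext fun n => map_smul f.toHom c (x.1 n))
    map_zero' := Subtype.ext (funext fun _ => map_zero f.toHom)
    map_add' := fun x y => Subtype.ext (funext fun n => map_add f.toHom (x.1 n) (y.1 n))
    map_mul' := fun x y => Subtype.ext (funext fun n => map_mul f.toHom (x.1 n) (y.1 n)) }
  bdd := by
    intro s hs
    obtain ⟨S, hS, h⟩ := bdd_cauchyAlg.1 hs
    refine bdd_cauchyAlg.2 ⟨S.map (f.toHom : R →ₗ[V] R'), f.bdd _ hS, ?_⟩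
    rintro _ ⟨x, hx, rfl⟩
    exact map_mem_cauchySubmodule f (h x hx)

/-- A bounded homomorphism acts on the inductive limits of the `π`-adic completions. -/
def limComplMap {R : BornAlg.{u, v₁} V} {R' : BornAlg.{u, v₂} V} (π : V) (f : BHom R R') :
    BHom (R.limCompl π) (R'.limCompl π) :=
  quotMap (cauchyMap π f) (by
    rintro x ⟨S, hS, hx⟩
    exact ⟨S.map (f.toHom : R →ₗ[V] R'), f.bdd _ hS, map_mem_nullSubmodule f hx⟩)

/-- Functoriality of the completion. -/
def completionMap {R : BornAlg.{u, v₁} V} {R' : BornAlg.{u, v₂} V} (π : V) (f : BHom R R') :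
    BHom (R.completion π) (R'.completion π) :=
  quotMap (limComplMap π f) (by
    intro x hx
    refine (Submodule.mem_sInf).2 fun Z hZ => ?_
    exact (Submodule.mem_sInf).1 hx _ (IsBornClosed.comap hZ
      ((limComplMap π f).toHom : R.limCompl π →ₗ[V] R'.limCompl π)
      fun S hS => (limComplMap π f).bdd _ hS))

theorem completionMap_id (R : BornAlg.{u, v} V) (π : V) :
    completionMap π (BHom.id R) = BHom.id (R.completion π) := by
  ext x
  obtain ⟨y, rfl⟩ := ((R.limCompl π).closureZero π).toSubmodule.mkQ_surjective x
  obtain ⟨z, rfl⟩ := (R.nullIdeal π).toSubmodule.mkQ_surjective y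
  rfl

theorem completionMap_comp {R : BornAlg.{u, v₁} V} {R' : BornAlg.{u, v₂} V}
    {R'' : BornAlg.{u, v₃} V} (π : V) (g : BHom R' R'') (f : BHom R R') :
    completionMap π (g.comp f) = (completionMap π g).comp (completionMap π f) := by
  ext x
  obtain ⟨y, rfl⟩ := ((R.limCompl π).closureZero π).toSubmodule.mkQ_surjective x
  obtain ⟨z, rfl⟩ := (R.nullIdeal π).toSubmodule.mkQ_surjective y
  rfl

end BornAlg

/-! ### Dagger completed tube algebras -/

section DaggerTube

variable {V : Type u} [CommRing V] [IsDomain V]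

open BornAlg

/-- The projective system of the completions of the tube algebras of `I ^ l` in `R` with the
linear growth bornology, for positive integers `l`. -/
noncomputable def daggerTube (R : BornAlg.{u, v} V) (I : AlgIdeal R) (π : V) :
    ProSys.{u, max u v} V where
  obj l := ((tube R I π l).ling π).completion π
  map h := completionMap π (lingMap π (tubeMap π (BHom.id R) (fun _ hx => hx) h))
  map_id l := by
    have : lingMap π (tubeMap π (BHom.id R) (I := I) (I' := I) (fun _ hx => hx) (le_refl l)) =
        BHom.id ((tube R I π l).ling π) := by
      ext x
      exact LinearMap.congr_fun (LinearMap.lTensor_id (FractionRing V) R) x.1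
    rw [this, completionMap_id]
  map_comp h h' := by
    rw [← completionMap_comp]
    congr 1
    ext x
    exact LinearMap.congr_fun (LinearMap.lTensor_id (FractionRing V) R) _

/-- The canonical maps from `R` to the dagger completed tube algebras. -/
noncomputable def toDaggerTube (R : BornAlg.{u, v} V) (I : AlgIdeal R) (π : V) (l : ℕ+) :
    BHom R ((daggerTube R I π).obj l) :=
  (toCompletion _ π).comp ((toLing _ π).comp (toTube R I π l))

/-- The projective system built from the ideal `I` itself, that is, from the tube algebras of
`I ^ l` in the bornological algebra `I`. -/
noncomputable def daggerTubeIdeal (R : BornAlg.{u, v} V) (I : AlgIdeal R) (π : V) :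
    ProSys.{u, max u v} V :=
  daggerTube I.toAlg (AlgIdeal.top I.toAlg) π

/-- The morphism induced by the inclusion of `I` into `R`. -/
noncomputable def daggerTubeIncl (R : BornAlg.{u, v} V) (I : AlgIdeal R) (π : V) :
    SysHom (daggerTubeIdeal R I π) (daggerTube R I π) where
  app l := completionMap π (lingMap π (tubeMap π I.incl (fun x _ => x.2) (le_refl l)))
  naturality h := by
    unfold daggerTubeIdeal daggerTube
    dsimp only
    rw [← completionMap_comp, ← completionMap_comp]
    congr 1
    ext x
    show (fracMap I.incl) ((fracMap (BHom.id _)) x.1) = (fracMap (BHom.id _)) ((fracMap I.incl) x.1)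
    have h1 : ∀ (B : BornAlg V) (y : B.frac), (fracMap (BHom.id B)) y = y :=
      fun B y => LinearMap.congr_fun (LinearMap.lTensor_id (FractionRing V) B) y
    rw [h1, h1]

end DaggerTube

/-! ### Tensor algebras -/

section Tensor

variable {V : Type u} [CommRing V] {W : Type w} [AddCommGroup W] [Module V W]

variable (V W) in
/-- The non-unital tensor algebra, the direct sum of the `W ^ (⊗ n)` for `n ≥ 1`, as the
non-unital subalgebra of Mathlib's unital tensor algebra that is generated by `W`. -/
def tensorSub : NonUnitalSubalgebra V (TensorAlgebra V W) :=
  NonUnitalAlgebra.adjoin V (Set.range (TensorAlgebra.ι V : W →ₗ[V] TensorAlgebra V W))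

/-- The submodule `∑_{n = 1}^a B ^ (⊗ n)` of the tensor algebra. -/
def tensorPart (B : Submodule V W) (a : ℕ) : Submodule V (TensorAlgebra V W) :=
  ⨆ n ∈ Finset.Icc 1 a, (B.map (TensorAlgebra.ι V)) ^ n

theorem tensorPart_mono {B C : Submodule V W} (h : B ≤ C) {a b : ℕ} (hab : a ≤ b) :
    tensorPart B a ≤ tensorPart C b := by
  refine iSup₂_le fun n hn => ?_
  rw [Finset.mem_Icc] at hn
  exact (pow_le_pow_left' (Submodule.map_mono h) n).trans
    (le_iSup₂_of_le n (Finset.mem_Icc.2 ⟨hn.1, hn.2.trans hab⟩) le_rfl)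

theorem tensorPart_mul (B : Submodule V W) (a b : ℕ) :
    tensorPart B a * tensorPart B b ≤ tensorPart B (a + b) := by
  unfold tensorPart
  simp only [Submodule.iSup_mul, Submodule.mul_iSup]
  refine iSup₂_le fun n hn => iSup₂_le fun m hm => ?_
  rw [Finset.mem_Icc] at hn hm
  rw [← pow_add]
  exact le_iSup₂_of_le (m + n) (Finset.mem_Icc.2 (by omega)) le_rfl

/-- The tensor algebra of a bornological module: a subset is bounded if and only if it is
contained in `∑_{n = 1}^a B ^ (⊗ n)` for some `a` and a bounded submodule `B`. -/
@[reducible] def tensorAlg (b : VBornology V W) : BornAlg.{u, max u w} V where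
  carrier := tensorSub V W
  born := VBornology.ofSubmodules
    (fun T => ∃ (a : ℕ) (B : Submodule V W), b.Bdd (B : Set W) ∧
      T = (tensorPart B a).comap (tensorSub V W).toSubmodule.subtype)
    (by
      rintro ⟨x, hx⟩
      have key : ∃ (a : ℕ) (B : Submodule V W), b.Bdd (B : Set W) ∧ x ∈ tensorPart B a := by
        induction hx using NonUnitalAlgebra.adjoin_induction with
        | mem x hx =>
          obtain ⟨y, rfl⟩ := hx
          refine ⟨1, Submodule.span V {y}, (b.bdd_singleton y).span, ?_⟩
          have : (Submodule.span V {y}).map (TensorAlgebra.ι V) ≤ tensorPart _ 1 :=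
            le_iSup₂_of_le 1 (Finset.mem_Icc.2 ⟨le_rfl, le_rfl⟩) (pow_one _).ge
          exact this ⟨y, Submodule.mem_span_singleton_self y, rfl⟩
        | add x y _ _ hx hy =>
          obtain ⟨a, B, hB, hx⟩ := hx
          obtain ⟨c, C, hC, hy⟩ := hy
          exact ⟨a + c, B ⊔ C, hB.sup hC, Submodule.add_mem _
            (tensorPart_mono le_sup_left (Nat.le_add_right _ _) hx)
            (tensorPart_mono le_sup_right (Nat.le_add_left _ _) hy)⟩
        | zero => exact ⟨0, ⊥, b.bdd_singleton 0, Submodule.zero_mem _⟩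
        | mul x y _ _ hx hy =>
          obtain ⟨a, B, hB, hx⟩ := hx
          obtain ⟨c, C, hC, hy⟩ := hy
          exact ⟨a + c, B ⊔ C, hB.sup hC, tensorPart_mul _ _ _ (Submodule.mul_mem_mul
            (tensorPart_mono le_sup_left le_rfl hx) (tensorPart_mono le_sup_right le_rfl hy))⟩
        | smul r x _ hx =>
          obtain ⟨a, B, hB, hx⟩ := hx
          exact ⟨a, B, hB, Submodule.smul_mem _ r hx⟩
      obtain ⟨a, B, hB, h⟩ := key
      exact ⟨_, ⟨a, B, hB, rfl⟩, h⟩)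
    (by
      rintro _ _ ⟨a, B, hB, rfl⟩ ⟨c, C, hC, rfl⟩
      exact ⟨_, ⟨a + c, B ⊔ C, hB.sup hC, rfl⟩,
        Submodule.comap_mono (tensorPart_mono le_sup_left (Nat.le_add_right _ _)),
        Submodule.comap_mono (tensorPart_mono le_sup_right (Nat.le_add_left _ _))⟩)
  bdd_mul := by
    intro s t hs ht
    obtain ⟨_, ⟨a, B, hB, rfl⟩, hs⟩ := VBornology.bdd_ofSubmodules.1 hs
    obtain ⟨_, ⟨c, C, hC, rfl⟩, ht⟩ := VBornology.bdd_ofSubmodules.1 ht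
    refine VBornology.bdd_ofSubmodules.2 ⟨_, ⟨a + c, B ⊔ C, hB.sup hC, rfl⟩, ?_⟩
    rintro _ ⟨x, hx, y, hy, rfl⟩
    exact tensorPart_mul _ _ _ (Submodule.mul_mem_mul
      (tensorPart_mono le_sup_left le_rfl (hs hx)) (tensorPart_mono le_sup_right le_rfl (ht hy)))

/-- The inclusion of `W` into its tensor algebra. -/
def tensorIncl (b : VBornology V W) (x : W) : tensorAlg b :=
  ⟨TensorAlgebra.ι V x, NonUnitalAlgebra.subset_adjoin V ⟨x, rfl⟩⟩

variable {A : Type v} [NonUnitalRing A] [Module V A] [IsScalarTower V A A] [SMulCommClass V A A]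

/-- The unital extension of a linear map `f : W → A` to the tensor algebra, with values in the
unitization of `A`. -/
def liftUnitization (f : W →ₗ[V] A) : TensorAlgebra V W →ₐ[V] Unitization V A :=
  TensorAlgebra.lift V ((Unitization.inrHom V V A).comp f)

theorem fst_liftUnitization (f : W →ₗ[V] A) {x : TensorAlgebra V W} (hx : x ∈ tensorSub V W) :
    (liftUnitization f x).fst = 0 := by
  induction hx using NonUnitalAlgebra.adjoin_induction with
  | mem x hx =>
    obtain ⟨y, rfl⟩ := hx
    simp [liftUnitization]
  | add x y _ _ hx hy => rw [map_add, Unitization.fst_add, hx, hy, add_zero]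
  | zero => rw [map_zero, Unitization.fst_zero]
  | mul x y _ _ hx hy => rw [map_mul, Unitization.fst_mul, hx, zero_mul]
  | smul r x _ hx => rw [map_smul, Unitization.fst_smul, hx, smul_zero]

/-- The algebra homomorphism from the non-unital tensor algebra of `W` to `A` that extends a linear
map `f : W → A`. -/
def tensorLift (b : VBornology V W) (f : W →ₗ[V] A) : tensorAlg b →ₙₐ[V] A where
  toFun x := (liftUnitization f x.1).snd
  map_smul' c x := by
    show (liftUnitization f (c • x.1)).snd = _
    rw [map_smul, Unitization.snd_smul]; rfl
  map_zero' := by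
    show (liftUnitization f 0).snd = 0
    rw [map_zero, Unitization.snd_zero]
  map_add' x y := by
    show (liftUnitization f (x.1 + y.1)).snd = _
    rw [map_add, Unitization.snd_add]
  map_mul' x y := by
    show (liftUnitization f (x.1 * y.1)).snd = _
    rw [map_mul, Unitization.snd_mul, fst_liftUnitization f x.2, fst_liftUnitization f y.2]
    simp

theorem tensorLift_incl (b : VBornology V W) (f : W →ₗ[V] A) (x : W) :
    tensorLift b f (tensorIncl b x) = f x := by
  show (liftUnitization f (TensorAlgebra.ι V x)).snd = f x
  simp [liftUnitization]

end Tensor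

/-! ### Algebras over the residue field -/

section Residue

variable (V : Type u) [CommRing V] (A : Type v) [NonUnitalRing A] [Module V A]

/-- An algebra with the fine bornology. -/
def fineAlg [IsScalarTower V A A] [SMulCommClass V A A] : BornAlg.{u, v} V where
  carrier := A
  born := VBornology.fine V A
  bdd_mul := by
    intro s t hs ht
    obtain ⟨S, hS, hs⟩ := VBornology.bdd_ofSubmodules.1 hs
    obtain ⟨T, hT, ht⟩ := VBornology.bdd_ofSubmodules.1 ht
    refine VBornology.bdd_ofSubmodules.2 ⟨mulS S T, hS.map₂ _ hT, ?_⟩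
    rintro _ ⟨x, hx, y, hy, rfl⟩
    exact mul_mem_mulS (hs hx) (ht hy)

variable [IsLocalRing V] [Module (IsLocalRing.ResidueField V) A]
  [IsScalarTower V (IsLocalRing.ResidueField V) A]

instance residue_isScalarTower [IsScalarTower (IsLocalRing.ResidueField V) A A] :
    IsScalarTower V A A :=
  ⟨fun c x y => by
    rw [← algebraMap_smul (IsLocalRing.ResidueField V) c x,
      ← algebraMap_smul (IsLocalRing.ResidueField V) c (x • y), smul_assoc]⟩

instance residue_smulCommClass [SMulCommClass (IsLocalRing.ResidueField V) A A] :
    SMulCommClass V A A :=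
  ⟨fun c x y => by
    rw [← algebraMap_smul (IsLocalRing.ResidueField V) c y,
      ← algebraMap_smul (IsLocalRing.ResidueField V) c (x • y), smul_comm]⟩

end Residue

/-! ### Properties of projective systems -/

section ProProperties

variable {V : Type u} [CommRing V]

/-- A pro-dagger algebra: a projective system of dagger algebras. -/
def ProSys.IsProDagger (D : ProSys.{u, v} V) (π : V) : Prop := ∀ n, (D.obj n).IsDagger π

/-- Fine mod `π`, levelwise. -/
def ProSys.IsFineMod (D : ProSys.{u, v} V) (π : V) : Prop := ∀ n, (D.obj n).born.IsFineMod π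

/-- Nilpotent mod `π`: for each `n` there are `m ≥ n` and `l ≥ 1` such that the structure map
`N_m → N_n` maps `N_m ^ l` into `π • N_n`. Here `powS ⊤ k` is `N_m ^ (k + 1)`. -/
def ProSys.IsNilpotentMod (N : ProSys.{u, v} V) (π : V) : Prop :=
  ∀ n, ∃ (m : ℕ+) (h : n ≤ m) (k : ℕ),
    ∀ x ∈ powS (⊤ : Submodule V (N.obj m)) k, ∃ y : N.obj n, N.map h x = π • y

/-- Analytically nilpotent: nilpotent mod `π` and isomorphic to a projective system of dagger
algebras. -/
def ProSys.IsAnalyticallyNilpotent (N : ProSys.{u, v} V) (π : V) : Prop :=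
  N.IsNilpotentMod π ∧ ∃ D : ProSys.{u, v} V, D.IsProDagger π ∧ Nonempty (ProIso N D)

/-- A pro-dagger lifting of `A`: an extension of pro-algebras `N ↣ D ↠ A`, where `D` is pro-dagger
and fine mod `π` and `N` is analytically nilpotent. -/
structure IsProDaggerLifting (π : V) {N : ProSys.{u, v₁} V} {D : ProSys.{u, v₂} V}
    {A : BornAlg.{u, v₃} V} (i : ProHom N D) (p : ProHom D (ProSys.const A)) : Prop where
  extension : IsProExtension i p
  proDagger : D.IsProDagger π
  fineMod : D.IsFineMod π
  analyticallyNilpotent : N.IsAnalyticallyNilpotent π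

end ProProperties

end DaggerLift

/-!
The system of tubes of `I ^ l` in the tensor algebra `R` of `W` satisfies all claims for four
largely independent reasons.

*Dagger algebras.* The tube algebra is torsionfree because it is contained in `F ⊗ R`. The linear
growth bornology makes it semi-dagger and keeps it torsionfree (`ling_isSemidagger`,
`ling_isTorsionfree`), and the completion of a torsionfree semi-dagger algebra is a dagger algebra:
the closure of zero is divisible by `π`, so that dividing it out creates no torsion
(`closureZero_le_smul`).

*Extensions.* The tube of `I ^ l` in `I` is the ideal `J = I + ∑ j ≥ 1, π ^ (-j) I ^ (l j)` of the
tube `U = R + J` of `I ^ l` in `R`, so that `U / J` is `R / I = A` if `R ∩ J = I`. To prove the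
latter for `l ≥ 2`, let `C` be a free module over `V / π ^ (n + 1) V` that lifts the unitization of
`A` as a vector space. The algebra structure of `A` need not lift, but left multiplication by the
values of `ρ` lifts to a linear map from `W` to the endomorphisms of `C`, because `W` is
torsionfree, and thus to a representation of the tensor algebra `R` (`exists_representation`). It maps
`I` to multiples of `π`, and so `I ^ (l j)` to multiples of `π ^ (l j)` with `l j > j`. An element
of `R ∩ J` therefore acts on `C` by multiples of `π`, for `n` large enough, and is in `I`
(`eq_zero_of_mem_tubeKer`, `tensorLift_eq_zero_of_mem_tubeKer`). Linear growth bornologies and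
completions preserve extensions whose quotient is killed by `π` (`isExtension_ling`,
`isExtension_completion`): the difference between the kernel and the whole algebra disappears after
multiplication with `π`. Since `l = 1` is excluded, the system is shifted by one level, which
gives an isomorphic system.

*Fineness mod `π`.* Bounded subsets of `R` are finitely generated up to multiples of `π ^ k`
for each `k`, and this is inherited, with `k = 1`, by any algebra between `R` and `F ⊗ R`, and by
linear growth bornologies and completions (`daggerTube_isFineMod`).

*Nilpotence mod `π`.* A product of `n + 1` elements of the tube of `I ^ (2 n)` in `I` is a sum of
elements of `π ^ (-J) I ^ (2 n J + z)` with `J + z > n`. Then `2 n J + z ≥ n (J + 1)`, so that it is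
`π` times an element of the tube of `I ^ n` (`exists_smul_eq_tubeMap`).

The free module on the set `A` with the fine bornology is torsionfree and fine mod `π`, and maps
onto `A`. Hence every `A` has a pro-dagger lifting.
-/

universe t

namespace DaggerLift

open BornAlg

/-! ### Linear growth bornologies -/

section Bornology

variable {V : Type u} [CommRing V] {M : Type v} [AddCommGroup M] [Module V M]

theorem VBornology.Bdd.smul {b : VBornology V M} {S : Submodule V M} (hS : b.Bdd (S : Set M))
    (c : V) : b.Bdd ((c • S : Submodule V M) : Set M) :=
  hS.subset (Submodule.smul_le_self_of_tower c S)

theorem VBornology.IsTorsionfree.bdd_div {b : VBornology V M} {π : V} (h : b.IsTorsionfree π)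
    {S : Submodule V M} (hS : b.Bdd (S : Set M)) :
    b.Bdd (S.comap (LinearMap.lsmul V M π) : Set M) :=
  h.2 _ (hS.subset (by rintro _ ⟨x, hx, rfl⟩; exact hx))

theorem mem_smul_iff {c : V} {S : Submodule V M} {x : M} :
    x ∈ c • S ↔ ∃ y ∈ S, c • y = x := Submodule.mem_smul_pointwise_iff_exists _ _ _

theorem smul_mem_smul {S : Submodule V M} (c : V) {x : M} (hx : x ∈ S) : c • x ∈ c • S :=
  Submodule.smul_mem_pointwise_smul _ _ _ hx

end Bornology

section Diamond

variable {V : Type u} [CommRing V] {R : Type v} [NonUnitalRing R] [Module V R]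
  [IsScalarTower V R R] [SMulCommClass V R R]

/-- `diamond π S` is the least submodule that contains `S` and is stable under multiplication by
`π • S` from the right. -/
theorem diamond_le {π : V} {S M : Submodule V R} (hS : S ≤ M)
    (h : ∀ x ∈ M, ∀ y ∈ S, π • (x * y) ∈ M) : diamond π S ≤ M := by
  refine iSup_le fun j => ?_
  have key : powS S j ≤ M.comap (LinearMap.lsmul V R (π ^ j)) := by
    induction j with
    | zero => intro x hx; simpa using hS hx
    | succ j ih =>
      refine mulS_le.2 fun x hx y hy => ?_
      have := h _ (ih hx) y hy
      rw [Submodule.mem_comap, LinearMap.lsmul_apply, pow_succ', mul_smul]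
      rwa [LinearMap.lsmul_apply, smul_mul_assoc] at this
  intro x hx
  obtain ⟨y, hy, rfl⟩ := mem_smul_iff.1 hx
  exact key hy

theorem smul_mem_diamond (π : V) {S : Submodule V R} {j : ℕ} {x : R} (hx : x ∈ powS S j) :
    π ^ j • x ∈ diamond π S :=
  Submodule.mem_iSup_of_mem j (smul_mem_smul _ hx)

theorem smul_mul_mem_diamond {π : V} {S : Submodule V R} {x y : R} (hx : x ∈ diamond π S)
    (hy : y ∈ diamond π S) : π • (x * y) ∈ diamond π S := by
  have : mulS (diamond π S) (diamond π S) ≤ (diamond π S).comap (LinearMap.lsmul V R π) := by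
    unfold mulS
    conv_lhs => unfold diamond
    rw [Submodule.map₂_iSup_left]
    refine iSup_le fun i => ?_
    rw [Submodule.map₂_iSup_right]
    refine iSup_le fun j => ?_
    refine Submodule.map₂_le.2 fun x hx y hy => ?_
    obtain ⟨x, hx', rfl⟩ := mem_smul_iff.1 hx
    obtain ⟨y, hy', rfl⟩ := mem_smul_iff.1 hy
    have := smul_mem_diamond π (j := i + j + 1) (mulS_powS S i j ▸ mul_mem_mulS hx' hy')
    rw [Submodule.mem_comap, LinearMap.lsmul_apply, LinearMap.mul_apply', smul_mul_smul_comm,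
      smul_smul]
    rwa [pow_succ', pow_add] at this
  exact this (mul_mem_mulS hx hy)

theorem diamond_le_sup_smul (π : V) (S : Submodule V R) :
    diamond π S ≤ S ⊔ π • diamond π (S ⊔ mulS S S) := by
  refine iSup_le fun j => ?_
  cases j with
  | zero => rw [pow_zero, one_smul]; exact le_sup_left
  | succ j =>
    refine le_trans ?_ le_sup_right
    intro x hx
    obtain ⟨y, hy, rfl⟩ := mem_smul_iff.1 hx
    rw [pow_succ', mul_smul]
    exact smul_mem_smul _ (smul_mem_diamond π (powS_mul_le S j 0 hy))

end Diamond

namespace BornAlg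

variable {V : Type u} [CommRing V]

theorem ling_isSemidagger (R : BornAlg.{u, v} V) (π : V) : (R.ling π).IsSemidagger π := by
  intro S hS
  obtain ⟨T, hT, h⟩ := bdd_ling.1 hS
  refine bdd_ling.2 ⟨T, hT, ?_⟩
  exact diamond_le (R := R) h fun x hx y hy => smul_mul_mem_diamond hx (h hy)

theorem ling_isTorsionfree {R : BornAlg.{u, v} V} {π : V} (h : R.born.IsTorsionfree π) :
    (R.ling π).born.IsTorsionfree π := by
  refine ⟨h.1, fun s hs => ?_⟩
  obtain ⟨S, hS, hs⟩ := bdd_ling.1 hs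
  have hT := hS.sup (R.bdd_mulS hS hS)
  refine bdd_ling.2 ⟨_, (h.bdd_div hS).sup hT, fun x hx => ?_⟩
  obtain ⟨a, ha, c, hc, e⟩ := Submodule.mem_sup.1 (diamond_le_sup_smul π S (hs ⟨x, hx, rfl⟩))
  obtain ⟨c, hc', rfl⟩ := mem_smul_iff.1 hc
  have hx : x = (x - c) + c := by abel
  rw [SetLike.mem_coe, hx]
  refine Submodule.add_mem _ ?_ (diamond_mono π le_sup_right hc')
  refine le_diamond π _ (le_sup_left (a := S.comap (LinearMap.lsmul V R π)) ?_)
  rw [Submodule.mem_comap, LinearMap.lsmul_apply, smul_sub]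
  have e : a + π • c = π • x := e
  rw [← e, add_sub_cancel_right]
  exact ha

theorem sub_isTorsionfree {R : BornAlg.{u, v} V} {π : V} (h : R.born.IsTorsionfree π)
    (S : NonUnitalSubalgebra V R) : (R.sub S).born.IsTorsionfree π := by
  refine ⟨fun x hx => Subtype.ext (h.1 _ (congrArg Subtype.val hx)), fun s hs => ?_⟩
  rw [bdd_sub] at hs ⊢
  refine h.2 _ ?_
  rw [Set.image_image] at hs ⊢
  exact hs

theorem frac_isTorsionfree [IsDomain V] (R : BornAlg.{u, v} V) {π : V} (hπ : π ≠ 0) :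
    R.frac.born.IsTorsionfree π := by
  refine ⟨fun x hx => ?_, fun s hs => ?_⟩
  · have h : algebraMap V (FractionRing V) π ≠ 0 := by simpa using hπ
    rw [← algebraMap_smul (FractionRing V) π x] at hx
    exact (smul_eq_zero.1 hx).resolve_left h
  · obtain ⟨e, he, S, hS, h⟩ := bdd_frac.1 hs
    refine bdd_frac.2 ⟨e * π, mul_ne_zero he hπ, S, hS, fun x hx => ?_⟩
    rw [mul_smul]
    exact h _ ⟨x, hx, rfl⟩

theorem tube_isTorsionfree [IsDomain V] (R : BornAlg.{u, v} V) (I : AlgIdeal R) {π : V}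
    (hπ : π ≠ 0) (l : ℕ+) : (tube R I π l).born.IsTorsionfree π :=
  sub_isTorsionfree (frac_isTorsionfree R hπ) _

end BornAlg

/-! ### Completions of torsionfree algebras -/

namespace BornAlg

variable {V : Type u} [CommRing V]

section Quotient

variable {R : BornAlg.{u, v} V} {I : AlgIdeal R}

theorem quotMk_surjective : Function.Surjective (R.quotMk I) := I.toSubmodule.mkQ_surjective

theorem quotMk_eq_zero {x : R} : R.quotMk I x = 0 ↔ x ∈ I.toSubmodule :=
  Submodule.Quotient.mk_eq_zero I.toSubmodule

theorem quotMk_eq {x y : R} : R.quotMk I x = R.quotMk I y ↔ x - y ∈ I.toSubmodule :=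
  Submodule.Quotient.eq I.toSubmodule

theorem bdd_quot {s : Set (R.quot I)} : (R.quot I).born.Bdd s ↔
    ∃ S : Submodule V R, R.born.Bdd (S : Set R) ∧ ∀ x ∈ s, ∃ y ∈ S, R.quotMk I y = x :=
  VBornology.bdd_quotient

/-- The homomorphism on a quotient that is induced by a bounded homomorphism vanishing on the
ideal. -/
def quotLift {A : BornAlg.{u, v₂} V} (f : BHom R A) (h : ∀ x ∈ I.toSubmodule, f x = 0) :
    BHom (R.quot I) A where
  toHom := {
    toFun := I.toSubmodule.liftQ (f.toHom : R →ₗ[V] A) h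
    map_smul' := fun c x => map_smul (I.toSubmodule.liftQ (f.toHom : R →ₗ[V] A) h) c x
    map_zero' := map_zero (I.toSubmodule.liftQ (f.toHom : R →ₗ[V] A) h)
    map_add' := fun x y => map_add (I.toSubmodule.liftQ (f.toHom : R →ₗ[V] A) h) x y
    map_mul' := by
      rintro ⟨a⟩ ⟨b⟩
      exact map_mul f.toHom a b }
  bdd := by
    intro s hs
    obtain ⟨S, hS, hs⟩ := bdd_quot.1 hs
    refine (f.bdd _ hS).subset ?_
    rintro _ ⟨x, hx, rfl⟩
    obtain ⟨y, hy, rfl⟩ := hs x hx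
    exact ⟨y, hy, rfl⟩

end Quotient

section Closure

variable {R : BornAlg.{u, v} V} {π : V}

theorem isBornClosed_closureZero : R.IsBornClosed π (R.closureZero π).toSubmodule := by
  rintro x ⟨S, hS, h⟩
  refine (Submodule.mem_sInf).2 fun Z hZ => hZ x ⟨S, hS, fun k => ?_⟩
  obtain ⟨z, hz, hxz⟩ := h k
  exact ⟨z, (Submodule.mem_sInf).1 hz Z hZ, hxz⟩

theorem closureZero_le {Z : Submodule V R} (hZ : R.IsBornClosed π Z) :
    (R.closureZero π).toSubmodule ≤ Z := sInf_le hZ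

theorem pow_smul_cancel (h : ∀ x : R, π • x = 0 → x = 0) {x : R} (k : ℕ) (hx : π ^ k • x = 0) :
    x = 0 := by
  induction k with
  | zero => simpa using hx
  | succ k ih => rw [pow_succ', mul_smul] at hx; exact ih (h _ hx)

theorem smul_mem_smul_cancel (h : ∀ x : R, π • x = 0 → x = 0) {k : ℕ} {S : Submodule V R} {x : R}
    (hx : π • x ∈ π ^ (k + 1) • S) : x ∈ π ^ k • S := by
  obtain ⟨y, hy, e⟩ := mem_smul_iff.1 hx
  rw [pow_succ', mul_smul] at e
  rw [← sub_eq_zero.1 (h _ (by rw [smul_sub, e, sub_self] : π • (π ^ k • y - x) = 0))]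
  exact smul_mem_smul _ hy

/-- In a torsionfree algebra `π • Z` is closed if `Z` is the closure of zero, so that `Z` is
divisible by `π`, by minimality. -/
theorem closureZero_le_smul (h : R.born.IsTorsionfree π) :
    (R.closureZero π).toSubmodule ≤ π • (R.closureZero π).toSubmodule := by
  refine closureZero_le ?_
  rintro x ⟨S, hS, hx⟩
  obtain ⟨_, hz, h1⟩ := hx 1
  obtain ⟨z, hz, rfl⟩ := mem_smul_iff.1 hz
  obtain ⟨s, hs, e⟩ := mem_smul_iff.1 h1
  obtain rfl : x = π • (z + s) := by rw [smul_add, ← pow_one π, e, pow_one]; abel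
  refine smul_mem_smul _ (isBornClosed_closureZero _ ⟨S, hS, fun k => ?_⟩)
  obtain ⟨_, hz', h2⟩ := hx (k + 1)
  obtain ⟨z', hz'', rfl⟩ := mem_smul_iff.1 hz'
  rw [← smul_sub] at h2
  exact ⟨z', hz'', smul_mem_smul_cancel h.1 h2⟩

theorem quot_closureZero_isTorsionfree (h : R.born.IsTorsionfree π) :
    (R.quot (R.closureZero π)).born.IsTorsionfree π := by
  constructor
  · intro x hx
    obtain ⟨y, rfl⟩ := quotMk_surjective x
    have hx : R.quotMk (R.closureZero π) (π • y) = 0 := hx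
    obtain ⟨z, hz, e⟩ := mem_smul_iff.1 (closureZero_le_smul h (quotMk_eq_zero.1 hx))
    rw [← sub_eq_zero.1 (h.1 _ (by rw [smul_sub, e, sub_self] : π • (z - y) = 0))]
    exact quotMk_eq_zero.2 hz
  · intro s hs
    obtain ⟨S, hS, hs⟩ := bdd_quot.1 hs
    refine bdd_quot.2 ⟨_, h.bdd_div hS, fun x hx => ?_⟩
    obtain ⟨y, rfl⟩ := quotMk_surjective x
    obtain ⟨t, ht, e⟩ := hs _ ⟨_, hx, rfl⟩
    have e : R.quotMk (R.closureZero π) t = R.quotMk (R.closureZero π) (π • y) := e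
    obtain ⟨z, hz, e⟩ := mem_smul_iff.1 (closureZero_le_smul h (quotMk_eq.1 e))
    refine ⟨y + z, ?_, quotMk_eq.2 (by rwa [add_sub_cancel_left])⟩
    rw [Submodule.mem_comap, LinearMap.lsmul_apply, smul_add, e, add_sub_cancel]
    exact ht

end Closure

section Sequences

variable {R : BornAlg.{u, v} V} {π : V}

theorem smul_mem_cauchySubmodule {S : Submodule V R} {c : ℕ → R} (r : V)
    (hc : c ∈ cauchySubmodule π S) : r • c ∈ cauchySubmodule π (r • S) := by
  refine ⟨fun n => smul_mem_smul r (hc.1 n), fun k => ?_⟩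
  obtain ⟨N, hN⟩ := hc.2 k
  refine ⟨N, fun m hm n hn => ?_⟩
  rw [Pi.smul_apply, Pi.smul_apply, ← smul_sub, smul_comm]
  exact smul_mem_smul r (hN m hm n hn)

/-- A Cauchy sequence whose members are eventually divisible by `π` is eventually `π` times a
Cauchy sequence. -/
theorem exists_smul_eq_of_mem_cauchySubmodule (h : R.born.IsTorsionfree π) {S : Submodule V R}
    {c : ℕ → R} (hc : c ∈ cauchySubmodule π S) {N : ℕ} (hN : ∀ n ≥ N, ∃ y, π • y = c n) :
    ∃ d ∈ cauchySubmodule π (S.comap (LinearMap.lsmul V R π)), ∀ n ≥ N, π • d n = c n := by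
  choose! y hy using hN
  refine ⟨fun n => if N ≤ n then y n else 0, ⟨fun n => ?_, fun k => ?_⟩, fun n hn => ?_⟩
  · dsimp only
    split_ifs with hn
    · rw [Submodule.mem_comap, LinearMap.lsmul_apply, hy n hn]
      exact hc.1 n
    · exact Submodule.zero_mem _
  · obtain ⟨M, hM⟩ := hc.2 (k + 1)
    refine ⟨M ⊔ N, fun m hm n hn => ?_⟩
    have hm' := le_sup_right.trans hm
    have hn' := le_sup_right.trans hn
    dsimp only
    rw [if_pos hm', if_pos hn']
    have := hM m (le_sup_left.trans hm) n (le_sup_left.trans hn)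
    rw [← hy m hm', ← hy n hn', ← smul_sub] at this
    refine Submodule.map_mono ?_ (smul_mem_smul_cancel h.1 this)
    intro x hx
    exact S.smul_mem π hx
  · dsimp only
    rw [if_pos hn, hy n hn]

theorem mem_nullIdeal_of_eventually_eq {c : cauchySub R π} {N : ℕ} (hN : ∀ n ≥ N, c.1 n = 0) :
    c ∈ (R.nullIdeal π).toSubmodule := by
  obtain ⟨S, hS, hc⟩ := c.2
  exact ⟨S, hS, hc.1, fun k => ⟨N, fun n hn => by rw [hN n hn]; exact Submodule.zero_mem _⟩⟩

theorem exists_cauchySub {c : ℕ → R} {S : Submodule V R} (hS : R.born.Bdd (S : Set R))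
    (hc : c ∈ cauchySubmodule π S) : ∃ d : cauchySub R π, d.1 = c := ⟨⟨c, S, hS, hc⟩, rfl⟩

variable (R π) in
/-- The class of a bornological Cauchy sequence in the inductive limit of the `π`-adic completions
of the bounded submodules. -/
def limMk : BHom (R.cauchyAlg π) (R.limCompl π) := (R.cauchyAlg π).quotMk (R.nullIdeal π)

theorem limMk_surjective : Function.Surjective (limMk R π) := quotMk_surjective

theorem limMk_eq_zero {c : R.cauchyAlg π} : limMk R π c = 0 ↔ c ∈ (R.nullIdeal π).toSubmodule :=
  quotMk_eq_zero

theorem limMk_eq {c d : R.cauchyAlg π} :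
    limMk R π c = limMk R π d ↔ c - d ∈ (R.nullIdeal π).toSubmodule :=
  quotMk_eq

theorem limMk_congr {c d : R.cauchyAlg π} {N : ℕ} (h : ∀ n ≥ N, c.1 n = d.1 n) :
    limMk R π c = limMk R π d :=
  limMk_eq.2 (mem_nullIdeal_of_eventually_eq (N := N) fun n hn => sub_eq_zero.2 (h n hn))

theorem bdd_limCompl {s : Set (R.limCompl π)} : (R.limCompl π).born.Bdd s ↔
    ∃ S : Submodule V R, R.born.Bdd (S : Set R) ∧
      ∀ x ∈ s, ∃ c : R.cauchyAlg π, c.1 ∈ cauchySubmodule π S ∧ limMk R π c = x := by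
  refine bdd_quot.trans ⟨?_, ?_⟩
  · rintro ⟨S, hS, h⟩
    obtain ⟨T, hT, hS⟩ := bdd_cauchyAlg.1 hS
    exact ⟨T, hT, fun x hx => (h x hx).imp fun c hc => ⟨hS c hc.1, hc.2⟩⟩
  · rintro ⟨S, hS, h⟩
    exact ⟨(cauchySubmodule π S).comap (cauchySub R π).toSubmodule.subtype,
      bdd_cauchyAlg.2 ⟨S, hS, fun _ hx => hx⟩, h⟩

theorem limCompl_isTorsionfree (h : R.born.IsTorsionfree π) :
    (R.limCompl π).born.IsTorsionfree π := by
  have h0 : ∀ x : R.limCompl π, π • x = 0 → x = 0 := by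
    intro x hx
    obtain ⟨c, rfl⟩ := limMk_surjective x
    have hx : limMk R π (π • c) = 0 := hx
    obtain ⟨T, hT, hc⟩ := limMk_eq_zero.1 hx
    obtain ⟨S, hS, hc'⟩ := c.2
    refine limMk_eq_zero.2 ⟨S ⊔ T, hS.sup hT, fun n => le_sup_left (a := S) (hc'.1 n), fun k => ?_⟩
    obtain ⟨N, hN⟩ := hc.2 (k + 1)
    exact ⟨N, fun n hn => Submodule.map_mono le_sup_right (smul_mem_smul_cancel h.1 (hN n hn))⟩
  refine ⟨h0, fun s hs => ?_⟩
  obtain ⟨S, hS, hs⟩ := bdd_limCompl.1 hs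
  refine bdd_limCompl.2 ⟨_, h.bdd_div hS, fun x hx => ?_⟩
  obtain ⟨c, rfl⟩ := limMk_surjective x
  obtain ⟨c', hc', e⟩ := hs _ ⟨_, hx, rfl⟩
  have e : limMk R π c' = limMk R π (π • c) := e
  obtain ⟨T, hT, hd⟩ := limMk_eq.1 e
  obtain ⟨N, hN⟩ := hd.2 1
  obtain ⟨d, hd, hdN⟩ := exists_smul_eq_of_mem_cauchySubmodule h hc' (N := N) fun n hn => by
    obtain ⟨y, -, hy⟩ := mem_smul_iff.1 (hN n hn)
    refine ⟨y + c.1 n, ?_⟩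
    rw [pow_one] at hy
    rw [smul_add, hy]
    exact sub_add_cancel (c'.1 n) (π • c.1 n)
  obtain ⟨d, rfl⟩ := exists_cauchySub (h.bdd_div hS) hd
  refine ⟨d, hd, sub_eq_zero.1 (h0 _ ?_)⟩
  rw [smul_sub, sub_eq_zero]
  have : limMk R π (π • d) = limMk R π c' := limMk_congr hdN
  exact this.trans e

variable (R π) in
/-- The class of a bornological Cauchy sequence in the completion. -/
def compMk : BHom (R.cauchyAlg π) (R.completion π) :=
  ((R.limCompl π).quotMk ((R.limCompl π).closureZero π)).comp (limMk R π)

theorem compMk_surjective : Function.Surjective (compMk R π) :=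
  quotMk_surjective.comp limMk_surjective

theorem compMk_of_limMk {c d : R.cauchyAlg π} (h : limMk R π c = limMk R π d) :
    compMk R π c = compMk R π d := congrArg ((R.limCompl π).quotMk _) h

theorem compMk_congr {c d : R.cauchyAlg π} {N : ℕ} (h : ∀ n ≥ N, c.1 n = d.1 n) :
    compMk R π c = compMk R π d := compMk_of_limMk (limMk_congr h)

theorem bdd_completion {s : Set (R.completion π)} : (R.completion π).born.Bdd s ↔
    ∃ S : Submodule V R, R.born.Bdd (S : Set R) ∧
      ∀ x ∈ s, ∃ c : R.cauchyAlg π, c.1 ∈ cauchySubmodule π S ∧ compMk R π c = x := by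
  refine bdd_quot.trans ⟨?_, ?_⟩
  · rintro ⟨S, hS, h⟩
    obtain ⟨T, hT, hS⟩ := bdd_limCompl.1 hS
    refine ⟨T, hT, fun x hx => ?_⟩
    obtain ⟨y, hy, rfl⟩ := h x hx
    obtain ⟨c, hc, rfl⟩ := hS y hy
    exact ⟨c, hc, rfl⟩
  · rintro ⟨S, hS, h⟩
    refine ⟨((cauchySubmodule π S).comap (cauchySub R π).toSubmodule.subtype).map
      ((limMk R π).toHom : R.cauchyAlg π →ₗ[V] R.limCompl π), ?_, fun x hx => ?_⟩
    · refine bdd_limCompl.2 ⟨S, hS, ?_⟩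
      rintro _ ⟨c, hc, rfl⟩
      exact ⟨c, hc, rfl⟩
    · obtain ⟨c, hc, rfl⟩ := h x hx
      exact ⟨_, ⟨c, hc, rfl⟩, rfl⟩

theorem completion_isTorsionfree (h : R.born.IsTorsionfree π) :
    (R.completion π).born.IsTorsionfree π :=
  quot_closureZero_isTorsionfree (limCompl_isTorsionfree h)

/-- The image in the completion of the Cauchy sequences in `S`. -/
def completedSubmodule (π : V) (S : Submodule V R) : Submodule V (R.completion π) :=
  ((cauchySubmodule π S).comap (cauchySub R π).toSubmodule.subtype).map
    ((compMk R π).toHom : R.cauchyAlg π →ₗ[V] R.completion π)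

theorem bdd_completedSubmodule {S : Submodule V R} (hS : R.born.Bdd (S : Set R)) :
    (R.completion π).born.Bdd (completedSubmodule π S : Set (R.completion π)) :=
  bdd_completion.2 ⟨S, hS, fun _ hx => hx⟩

theorem completion_isSemidagger (h : R.IsSemidagger π) : (R.completion π).IsSemidagger π := by
  intro P hP
  obtain ⟨S, hS, hP⟩ := bdd_completion.1 hP
  refine (bdd_completedSubmodule (h S hS)).subset ?_
  refine diamond_le (fun x hx => ?_) fun x hx y hy => ?_
  · obtain ⟨c, hc, rfl⟩ := hP x hx
    exact ⟨c, cauchySubmodule_mono (le_diamond π S) hc, rfl⟩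
  · obtain ⟨c, hc, rfl⟩ := hx
    obtain ⟨d, hd, rfl⟩ := hP y hy
    refine ⟨π • (c * d), ?_, ?_⟩
    · refine cauchySubmodule_mono ?_
        (smul_mem_cauchySubmodule π (mul_mem_cauchySubmodule hc hd))
      intro z hz
      obtain ⟨z, hz', rfl⟩ := mem_smul_iff.1 hz
      have : mulS (diamond π S) S ≤ (diamond π S).comap (LinearMap.lsmul V R π) :=
        mulS_le.2 fun x hx y hy => smul_mul_mem_diamond hx (le_diamond π S hy)
      exact this hz'
    · exact (map_smul (compMk R π).toHom π (c * d)).trans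
        (congrArg (π • ·) (map_mul (compMk R π).toHom c d))

/-- Every class in the completion of `S` is represented by a sequence with an explicit modulus of
convergence. -/
theorem exists_fast_cauchy {S : Submodule V R} (hS : R.born.Bdd (S : Set R)) {x : R.completion π}
    (hx : x ∈ completedSubmodule π S) :
    ∃ c : R.cauchyAlg π, (∀ n, c.1 n ∈ S) ∧ (∀ k, ∀ m ≥ k, ∀ n ≥ k, c.1 m - c.1 n ∈ π ^ k • S) ∧
      compMk R π c = x := by
  obtain ⟨c, hc, rfl⟩ := hx
  choose N hN using hc.2
  -- Pass to the subsequence at the increasing indices `∑ i ≤ k, (N i + 1)`, which exceed `N k`.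
  have hM : ∀ k, k ≤ ∑ i ∈ Finset.range (k + 1), (N i + 1) := fun k => by
    have : ∑ i ∈ Finset.range (k + 1), 1 ≤ ∑ i ∈ Finset.range (k + 1), (N i + 1) :=
      Finset.sum_le_sum fun i _ => Nat.le_add_left _ _
    simp only [Finset.sum_const, Finset.card_range, smul_eq_mul, mul_one] at this
    omega
  have hNM : ∀ k, ∀ m ≥ k, N k ≤ ∑ i ∈ Finset.range (m + 1), (N i + 1) := fun k m hm =>
    (Nat.le_succ _).trans (Finset.single_le_sum (f := fun i => N i + 1) (fun _ _ => Nat.zero_le _)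
      (Finset.mem_range.2 (Nat.lt_succ_of_le hm)))
  have hd : (∀ k, ∀ m ≥ k, ∀ n ≥ k, c.1 (∑ i ∈ Finset.range (m + 1), (N i + 1)) -
      c.1 (∑ i ∈ Finset.range (n + 1), (N i + 1)) ∈ π ^ k • S) := fun k m hm n hn =>
    hN k _ (hNM k m hm) _ (hNM k n hn)
  obtain ⟨d, hd'⟩ := exists_cauchySub (c := fun k => c.1 (∑ i ∈ Finset.range (k + 1), (N i + 1)))
    hS ⟨fun n => hc.1 _, fun k => ⟨k, hd k⟩⟩
  have hd'' : ∀ k, d.1 k = c.1 (∑ i ∈ Finset.range (k + 1), (N i + 1)) := congrFun hd'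
  refine ⟨d, fun n => hd'' n ▸ hc.1 _, fun k m hm n hn => ?_, compMk_of_limMk (limMk_eq.2
    ⟨S, hS, fun n => S.sub_mem (hd'' n ▸ hc.1 _) (hc.1 n), fun k => ⟨N k ⊔ k, fun n hn => ?_⟩⟩)⟩
  · rw [hd'', hd'']; exact hd k m hm n hn
  · show d.1 n - c.1 n ∈ _
    rw [hd'']
    exact hN k _ (hNM k n (le_sup_right.trans hn)) _ (le_sup_left.trans hn)

theorem mem_span_pow_smul_top {M : Type v} [AddCommGroup M] [Module V M] {k : ℕ} {x : M} :
    x ∈ (Ideal.span {π} ^ k • ⊤ : Submodule V M) ↔ ∃ y, π ^ k • y = x := by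
  rw [Ideal.span_singleton_pow, Submodule.ideal_span_singleton_smul, mem_smul_iff]
  simp

theorem sum_smul_sub_mem {S : Submodule V R} {c : ℕ → ℕ → R}
    (hc : ∀ n, (∀ m, c n m ∈ S) ∧ ∀ k, ∀ m ≥ k, ∀ m' ≥ k, c n m - c n m' ∈ π ^ k • S) (k : ℕ)
    {m m' : ℕ} (hm : k ≤ m) (hm' : k ≤ m') :
    ∑ n ∈ Finset.range m, π ^ n • c n m - ∑ n ∈ Finset.range m', π ^ n • c n m' ∈ π ^ k • S := by
  have key : ∀ m ≥ k, ∑ n ∈ Finset.range m, π ^ n • c n m -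
      ∑ n ∈ Finset.range k, π ^ n • c n k ∈ π ^ k • S := by
    intro m hm
    rw [← Finset.sum_range_add_sum_Ico _ hm, add_sub_right_comm, ← Finset.sum_sub_distrib]
    refine Submodule.add_mem _ (Submodule.sum_mem _ fun n _ => ?_)
      (Submodule.sum_mem _ fun n hn => ?_)
    · rw [← smul_sub]
      exact Submodule.smul_mem _ _ ((hc n).2 k m hm k le_rfl)
    · obtain ⟨j, rfl⟩ := Nat.exists_eq_add_of_le (Finset.mem_Ico.1 hn).1
      rw [pow_add, mul_smul]
      exact smul_mem_smul _ (S.smul_mem _ ((hc _).1 m))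
  have := Submodule.sub_mem _ (key m hm) (key m' hm')
  rwa [sub_sub_sub_cancel_right] at this

/-- The image of a bounded submodule in the completion is `π`-adically complete. It is Hausdorff
because elements divisible by all powers of `π` lie in the closure of zero, which has been divided
out. It is complete because the series `∑ π ^ n p n` is represented by the partial sums of Cauchy
sequences that represent the `p n` with a uniform modulus of convergence. -/
theorem isAdicComplete_completedSubmodule {S : Submodule V R} (hS : R.born.Bdd (S : Set R)) :
    IsAdicComplete (Ideal.span {π}) (completedSubmodule π S) where
  haus' := by
    rintro ⟨_, c, hc, rfl⟩ h
    refine Subtype.ext ?_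
    refine quotMk_eq_zero.2 (isBornClosed_closureZero _ ⟨
      ((cauchySubmodule π S).comap (cauchySub R π).toSubmodule.subtype).map
      ((limMk R π).toHom : R.cauchyAlg π →ₗ[V] R.limCompl π), ?_, fun k => ?_⟩)
    · refine bdd_limCompl.2 ⟨S, hS, ?_⟩
      rintro _ ⟨c, hc, rfl⟩
      exact ⟨c, hc, rfl⟩
    · obtain ⟨⟨_, d, hd, rfl⟩, e⟩ := mem_span_pow_smul_top.1 (SModEq.zero.1 (h k))
      have e : compMk R π (π ^ k • d) = compMk R π c := congrArg Subtype.val e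
      have e := quotMk_eq.1 e.symm
      refine ⟨_, e, ?_⟩
      rw [sub_sub_cancel]
      exact mem_smul_iff.2 ⟨limMk R π d, ⟨d, hd, rfl⟩, (map_smul (limMk R π).toHom (π ^ k) d).symm⟩
  prec' := by
    intro f hf
    have hp : ∀ n, ∃ p : completedSubmodule π S, π ^ n • p = f (n + 1) - f n := fun n =>
      mem_span_pow_smul_top.1 ((SModEq.sub_mem).1 (hf (Nat.le_succ n)).symm)
    choose p hp using hp
    choose c hc hc' hcp using fun n => exists_fast_cauchy hS (p n).2
    -- The sequence `d j` represents the sum of `π ^ n • p (j + n)` over all `n`.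
    have hcauchy : ∀ j, ∃ d : R.cauchyAlg π, d.1 ∈ cauchySubmodule π S ∧
        ∀ m, d.1 m = ∑ n ∈ Finset.range m, π ^ n • (c (j + n)).1 m := by
      intro j
      have : (fun m => ∑ n ∈ Finset.range m, π ^ n • (c (j + n)).1 m) ∈ cauchySubmodule π S :=
        ⟨fun m => Submodule.sum_mem _ fun n _ => S.smul_mem _ (hc _ _), fun k => ⟨k,
          fun m hm n hn => sum_smul_sub_mem (fun n => ⟨hc (j + n), hc' (j + n)⟩) k hm hn⟩⟩
      obtain ⟨d, hd⟩ := exists_cauchySub hS this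
      exact ⟨d, hd ▸ this, congrFun hd⟩
    choose d hd hd' using hcauchy
    have hstep : ∀ j, compMk R π (d j) = compMk R π (c j) + π • compMk R π (d (j + 1)) := by
      intro j
      have e : compMk R π (d j) = compMk R π (c j + π • d (j + 1)) := by
        refine compMk_of_limMk (limMk_eq.2 ⟨S, hS, fun n => ?_, fun k => ⟨k + 1, fun n hn => ?_⟩⟩)
        · exact S.sub_mem ((hd j).1 n) (S.add_mem (hc j n) (S.smul_mem _ ((hd (j + 1)).1 n)))
        · obtain ⟨n, rfl⟩ : ∃ n', n = n' + 1 := ⟨n - 1, by omega⟩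
          have e1 : (d j - (c j + π • d (j + 1))).1 (n + 1) =
              (d j).1 (n + 1) - ((c j).1 (n + 1) + π • (d (j + 1)).1 (n + 1)) := rfl
          have e2 : (d j).1 (n + 1) - ((c j).1 (n + 1) + π • (d (j + 1)).1 (n + 1)) =
              - (π ^ (n + 1) • (c (j + 1 + n)).1 (n + 1)) := by
            rw [hd' j, hd' (j + 1), Finset.sum_range_succ', Finset.sum_range_succ, smul_add,
              Finset.smul_sum, smul_smul, ← pow_succ', pow_zero, one_smul, add_zero]
            have : ∀ i, π • π ^ i • (c (j + 1 + i)).1 (n + 1) =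
                π ^ (i + 1) • (c (j + (i + 1))).1 (n + 1) := fun i => by
              rw [smul_smul, ← pow_succ', show j + 1 + i = j + (i + 1) by ring]
            simp only [this]
            abel
          rw [e1, e2]
          obtain ⟨i, hi⟩ := Nat.exists_eq_add_of_le (show k ≤ n + 1 by omega)
          rw [hi, pow_add, mul_smul]
          exact Submodule.neg_mem _ (smul_mem_smul _ (S.smul_mem _ (hc _ _)))
      rw [e]
      exact (map_add (compMk R π).toHom _ _).trans
        (congrArg (_ + ·) (map_smul (compMk R π).toHom π _))
    let q : ℕ → completedSubmodule π S := fun j => ⟨_, d j, hd j, rfl⟩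
    have hq : ∀ j, q j = p j + π • q (j + 1) := fun j => Subtype.ext ((hstep j).trans (by
      rw [hcp]; rfl))
    refine ⟨f 0 + q 0, fun n => ?_⟩
    have hn : ∀ n, f 0 + q 0 = f n + π ^ n • q n := by
      intro n
      induction n with
      | zero => simp
      | succ n ih => rw [ih, hq n, smul_add, hp, smul_smul, ← pow_succ]; abel
    rw [SModEq.sub_mem, hn n, sub_add_cancel_left]
    exact mem_span_pow_smul_top.2 ⟨-q n, by rw [smul_neg]⟩

theorem completion_isComplete (R : BornAlg.{u, v} V) (π : V) :
    (R.completion π).born.IsComplete π := by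
  intro P hP
  obtain ⟨S, hS, hP⟩ := bdd_completion.1 hP
  exact ⟨completedSubmodule π S, bdd_completedSubmodule hS, hP,
    isAdicComplete_completedSubmodule hS⟩

theorem completion_ling_isDagger (h : R.born.IsTorsionfree π) :
    ((R.ling π).completion π).IsDagger π :=
  ⟨completion_isComplete _ _, completion_isTorsionfree (ling_isTorsionfree h),
    completion_isSemidagger (ling_isSemidagger R π)⟩

end Sequences

theorem daggerTube_isProDagger [IsDomain V] (R : BornAlg.{u, v} V) (I : AlgIdeal R) {π : V}
    (hπ : π ≠ 0) : (daggerTube R I π).IsProDagger π :=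
  fun l => completion_ling_isDagger (tube_isTorsionfree R I hπ l)

end BornAlg

/-! ### Extensions with quotient killed by the uniformiser -/

section Extension

variable {V : Type u} [CommRing V] {π : V}

section Diamond

variable {R : Type v} [NonUnitalRing R] [Module V R] [IsScalarTower V R R] [SMulCommClass V R R]

/-- Modulo `T` itself, the elements of `diamond π T` lie in `diamond π B` for a submodule `B` that
is built from products and is contained in `π • R`. With `X = π T T`, the submodule
`B = X + π X T` satisfies `π B T ≤ B + π B B`, because `π X T · π T ≤ π X X`. -/
theorem diamond_le_sup_diamond (π : V) (T : Submodule V R) :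
    diamond π T ≤ T ⊔ diamond π (π • mulS T T ⊔ π • mulS (π • mulS T T) T) := by
  set X := π • mulS T T with hX
  set B := X ⊔ π • mulS X T with hB
  have hXT : ∀ x ∈ T, ∀ y ∈ T, π • (x * y) ∈ X := fun x hx y hy =>
    smul_mem_smul _ (mul_mem_mulS hx hy)
  have h1 : ∀ x ∈ B, ∀ t ∈ T, π • (x * t) ∈ B ⊔ π • mulS B B := by
    intro x hx t ht
    obtain ⟨x, hx', y, hy, rfl⟩ := Submodule.mem_sup.1 hx
    rw [add_mul, smul_add]
    refine Submodule.add_mem _ ?_ ?_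
    · exact le_sup_left (a := B) (le_sup_right (a := X) (smul_mem_smul _ (mul_mem_mulS hx' ht)))
    · obtain ⟨y, hy', rfl⟩ := mem_smul_iff.1 hy
      refine le_sup_right (a := B) ?_
      rw [smul_mul_assoc]
      have : mulS X T ≤ (mulS B B).comap
          ((LinearMap.lsmul V R π).comp (LinearMap.mulRight V t)) := by
        refine mulS_le.2 fun a ha b hb => ?_
        rw [Submodule.mem_comap, LinearMap.comp_apply, LinearMap.mulRight_apply,
          LinearMap.lsmul_apply, mul_assoc, ← mul_smul_comm]
        exact mul_mem_mulS (le_sup_left (a := X) ha) (le_sup_left (a := X) (hXT b hb t ht))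
      exact smul_mem_smul _ (this hy')
  have h2 : ∀ x ∈ diamond π B, ∀ t ∈ T, π • (x * t) ∈ diamond π B := by
    intro x hx t ht
    have : diamond π B ≤ (diamond π B).comap
        ((LinearMap.lsmul V R π).comp (LinearMap.mulRight V t)) := by
      refine iSup_le fun j => ?_
      intro x hx
      obtain ⟨x, hx', rfl⟩ := mem_smul_iff.1 hx
      have h3 : π • (x * t) ∈ powS B j ⊔ π • powS B (j + 1) := by
        cases j with
        | zero => exact h1 x hx' t ht
        | succ j =>
          have : mulS (powS B j) B ≤ (powS B (j + 1) ⊔ π • powS B (j + 2)).comap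
              ((LinearMap.lsmul V R π).comp (LinearMap.mulRight V t)) := by
            refine mulS_le.2 fun a ha b hb => ?_
            rw [Submodule.mem_comap, LinearMap.comp_apply, LinearMap.mulRight_apply,
              LinearMap.lsmul_apply, mul_assoc, ← mul_smul_comm]
            obtain ⟨c, hc, d, hd, e⟩ := Submodule.mem_sup.1 (h1 b hb t ht)
            obtain ⟨d, hd', rfl⟩ := mem_smul_iff.1 hd
            rw [← e, mul_add, mul_smul_comm]
            refine Submodule.add_mem_sup (mul_mem_mulS ha hc) (smul_mem_smul _ ?_)
            have := mul_mem_mulS ha hd'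
            rwa [show mulS B B = powS B 1 from rfl, mulS_powS] at this
          exact this hx'
      obtain ⟨c, hc, d, hd, e⟩ := Submodule.mem_sup.1 h3
      obtain ⟨d, hd', rfl⟩ := mem_smul_iff.1 hd
      rw [Submodule.mem_comap, LinearMap.comp_apply, LinearMap.mulRight_apply,
        LinearMap.lsmul_apply, smul_mul_assoc, smul_comm, ← e, smul_add, smul_smul, ← pow_succ]
      exact Submodule.add_mem _ (smul_mem_diamond π hc) (smul_mem_diamond π hd')
    exact this hx
  refine diamond_le le_sup_left fun x hx t ht => ?_
  obtain ⟨x, hx', y, hy, rfl⟩ := Submodule.mem_sup.1 hx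
  rw [add_mul, smul_add]
  exact Submodule.add_mem _
    (le_sup_right (a := T) (le_diamond π B (le_sup_left (a := X) (hXT x hx' t ht))))
    (le_sup_right (a := T) (h2 y hy t ht))

end Diamond

variable {K : BornAlg.{u, v₁} V} {G : BornAlg.{u, v₂} V} {Q : BornAlg.{u, v₃} V}
  {i : BHom K G} {p : BHom G Q}

theorem IsExtension.apply_apply (h : IsExtension i p) (y : K) : p (i y) = 0 :=
  (h.exact _).2 ⟨y, rfl⟩

theorem IsExtension.exists_smul (h : IsExtension i p) (hQ : ∀ y : Q, π • y = 0) (x : G) :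
    ∃ y : K, i y = π • x :=
  (h.exact _).1 (by rw [show p (π • x) = π • p x from map_smul p.toHom π x, hQ])

/-- The preimage of a bounded submodule under the inclusion of an extension is bounded. -/
theorem IsExtension.bdd_comap (h : IsExtension i p) {S : Submodule V G}
    (hS : G.born.Bdd (S : Set G)) :
    K.born.Bdd (S.comap (i.toHom : K →ₗ[V] G) : Set K) :=
  h.bdd_of_image _ (hS.subset (by rintro _ ⟨x, hx, rfl⟩; exact hx))

/-- The homomorphism `p`, viewed on `G` with the linear growth bornology. It stays bounded because
`Q` is killed by `π`, so that `p` maps `diamond π S` into the image of `S`. -/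
def lingLift (p : BHom G Q) (hQ : ∀ y : Q, π • y = 0) : BHom (G.ling π) Q where
  toHom := p.toHom
  bdd := by
    intro s hs
    obtain ⟨S, hS, h⟩ := bdd_ling.1 hs
    refine (p.bdd _ hS).subset ?_
    have : diamond π S ≤ (S.map (p.toHom : G →ₗ[V] Q)).comap (p.toHom : G →ₗ[V] Q) :=
      diamond_le (Submodule.le_comap_map _ _) fun x _ y _ => by
        rw [Submodule.mem_comap, map_smul, hQ]
        exact Submodule.zero_mem _
    rintro _ ⟨x, hx, rfl⟩
    exact this (h hx)

/-- The linear growth bornology on the kernel is the subspace bornology of the linear growth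
bornology on `G`: by `diamond_le_sup_diamond`, a subset of the kernel in `diamond π T` is contained
in `diamond π ((T ⊔ B) ∩ K)` for a bounded submodule `B` of `π • G`, hence of the kernel. -/
theorem isExtension_ling (h : IsExtension i p) (hQ : ∀ y : Q, π • y = 0) :
    IsExtension (lingMap π i) (lingLift p hQ) where
  injective := h.injective
  exact := h.exact
  surjective := h.surjective
  exists_bdd_lift t ht := by
    obtain ⟨s, hs, e⟩ := h.exists_bdd_lift t ht
    exact ⟨s, (toLing G π).bdd s hs |>.subset (by rintro x hx; exact ⟨x, hx, rfl⟩), e⟩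
  bdd_of_image s hs := by
    obtain ⟨T, hT, hs⟩ := bdd_ling.1 hs
    set X := π • mulS T T
    set B := X ⊔ π • mulS X T
    have hX : G.born.Bdd (X : Set G) := (G.bdd_mulS hT hT).smul π
    have hB : G.born.Bdd (B : Set G) := hX.sup ((G.bdd_mulS hX hT).smul π)
    have hBi : B ≤ LinearMap.range (i.toHom : K →ₗ[V] G) := by
      refine sup_le ?_ ?_ <;>
      · intro x hx
        obtain ⟨y, -, rfl⟩ := mem_smul_iff.1 hx
        exact h.exists_smul hQ y
    refine bdd_ling.2 ⟨(T ⊔ B).comap (i.toHom : K →ₗ[V] G), h.bdd_comap (hT.sup hB), fun y hy => ?_⟩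
    obtain ⟨t, ht, b, hb, e⟩ := Submodule.mem_sup.1 (diamond_le_sup_diamond π T (hs ⟨y, hy, rfl⟩))
    rw [show π • mulS T T ⊔ π • mulS (π • mulS T T) T =
      (B.comap (i.toHom : K →ₗ[V] G)).map (i.toHom : K →ₗ[V] G) from
      (Submodule.map_comap_eq_of_le hBi).symm, ← map_diamond] at hb
    obtain ⟨b, hb', rfl⟩ := hb
    have ht' : i (y - b) ∈ T := by
      have : t + i b = i y := e
      rw [show i (y - b) = i y - i b from map_sub i.toHom _ _, ← this, add_sub_cancel_right]
      exact ht
    rw [show y = (y - b) + b by abel]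
    refine Submodule.add_mem _ (le_diamond π _ (le_sup_left (a := T) ht'))
      (diamond_mono π (Submodule.comap_mono le_sup_right) hb')

/-- A bounded homomorphism to an algebra that is killed by `π` is eventually constant on each
Cauchy sequence. -/
theorem eventually_apply_eq (p : BHom G Q) (hQ : ∀ y : Q, π • y = 0) (c : G.cauchyAlg π) :
    ∃ y : Q, ∃ N, ∀ n ≥ N, p (c.1 n) = y := by
  obtain ⟨S, hS, hc⟩ := c.2
  obtain ⟨N, hN⟩ := hc.2 1
  refine ⟨p (c.1 N), N, fun n hn => ?_⟩
  obtain ⟨y, -, e⟩ := mem_smul_iff.1 (hN n hn N le_rfl)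
  rw [← sub_eq_zero, ← show p (c.1 n - c.1 N) = p (c.1 n) - p (c.1 N) from map_sub p.toHom _ _,
    ← e, pow_one, show p (π • y) = π • p y from map_smul p.toHom π y, hQ]

/-- The eventual value of `p` along a Cauchy sequence. -/
noncomputable def eventualValue (p : BHom G Q) (hQ : ∀ y : Q, π • y = 0) (c : G.cauchyAlg π) : Q :=
  (eventually_apply_eq p hQ c).choose

theorem eventualValue_spec (p : BHom G Q) (hQ : ∀ y : Q, π • y = 0) (c : G.cauchyAlg π) :
    ∃ N, ∀ n ≥ N, p (c.1 n) = eventualValue p hQ c :=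
  (eventually_apply_eq p hQ c).choose_spec

theorem eventualValue_eq (p : BHom G Q) (hQ : ∀ y : Q, π • y = 0) {c : G.cauchyAlg π} {y : Q}
    {N : ℕ} (h : ∀ n ≥ N, p (c.1 n) = y) : eventualValue p hQ c = y := by
  obtain ⟨M, hM⟩ := eventualValue_spec p hQ c
  rw [← hM _ le_sup_left, h _ le_sup_right]

/-- The homomorphism on Cauchy sequences that is given by the eventual value of a bounded
homomorphism to an algebra killed by `π`. -/
noncomputable def cauchyLift (p : BHom G Q) (hQ : ∀ y : Q, π • y = 0) :
    BHom (G.cauchyAlg π) Q where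
  toHom := {
    toFun := eventualValue p hQ
    map_smul' := fun r c => by
      obtain ⟨N, hN⟩ := eventualValue_spec p hQ c
      exact eventualValue_eq p hQ (N := N) fun n hn =>
        (map_smul p.toHom r (c.1 n)).trans (congrArg (r • ·) (hN n hn))
    map_zero' := eventualValue_eq p hQ (N := 0) fun n _ => map_zero p.toHom
    map_add' := fun c d => by
      obtain ⟨N, hN⟩ := eventualValue_spec p hQ c
      obtain ⟨M, hM⟩ := eventualValue_spec p hQ d
      exact eventualValue_eq p hQ (N := N ⊔ M) fun n hn =>
        (map_add p.toHom (c.1 n) (d.1 n)).trans (congrArg₂ (· + ·)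
          (hN n (le_sup_left.trans hn)) (hM n (le_sup_right.trans hn)))
    map_mul' := fun c d => by
      obtain ⟨N, hN⟩ := eventualValue_spec p hQ c
      obtain ⟨M, hM⟩ := eventualValue_spec p hQ d
      exact eventualValue_eq p hQ (N := N ⊔ M) fun n hn =>
        (map_mul p.toHom (c.1 n) (d.1 n)).trans (congrArg₂ (· * ·)
          (hN n (le_sup_left.trans hn)) (hM n (le_sup_right.trans hn))) }
  bdd := by
    intro s hs
    obtain ⟨S, hS, h⟩ := bdd_cauchyAlg.1 hs
    refine (p.bdd _ hS).subset ?_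
    rintro _ ⟨c, hc, rfl⟩
    obtain ⟨N, hN⟩ := eventualValue_spec p hQ c
    exact ⟨c.1 N, (h c hc).1 N, hN N le_rfl⟩

/-- The induced homomorphism on the inductive limit of the `π`-adic completions. -/
noncomputable def limLift (p : BHom G Q) (hQ : ∀ y : Q, π • y = 0) : BHom (G.limCompl π) Q :=
  quotLift (cauchyLift p hQ) (by
    rintro c ⟨S, hS, hc⟩
    obtain ⟨N, hN⟩ := hc.2 1
    refine eventualValue_eq p hQ (N := N) fun n hn => ?_
    obtain ⟨y, -, e⟩ := mem_smul_iff.1 (hN n hn)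
    rw [← e, pow_one, show p (π • y) = π • p y from map_smul p.toHom π y, hQ])

/-- The induced homomorphism on the completion. -/
noncomputable def completionLift (p : BHom G Q) (hQ : ∀ y : Q, π • y = 0) :
    BHom (G.completion π) Q :=
  quotLift (limLift p hQ) (by
    intro x hx
    refine closureZero_le (Z := LinearMap.ker ((limLift p hQ).toHom : G.limCompl π →ₗ[V] Q)) ?_ hx
    rintro x ⟨S, hS, h⟩
    obtain ⟨z, hz, hxz⟩ := h 1
    obtain ⟨y, -, e⟩ := mem_smul_iff.1 hxz
    rw [LinearMap.mem_ker] at hz ⊢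
    rw [← sub_add_cancel x z, ← e, map_add, hz, add_zero, pow_one, map_smul, hQ])

theorem completionLift_compMk (p : BHom G Q) (hQ : ∀ y : Q, π • y = 0) (c : G.cauchyAlg π) :
    completionLift p hQ (compMk G π c) = eventualValue p hQ c := rfl

theorem completionLift_toCompletion (p : BHom G Q) (hQ : ∀ y : Q, π • y = 0) (x : G) :
    completionLift p hQ (toCompletion G π x) = p x :=
  eventualValue_eq p hQ (N := 0) fun _ _ => rfl

theorem limComplMap_limMk (π : V) (f : BHom K G) (c : K.cauchyAlg π) :
    limComplMap π f (limMk K π c) = limMk G π (cauchyMap π f c) := rfl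

theorem completionMap_compMk (π : V) (f : BHom K G) (c : K.cauchyAlg π) :
    completionMap π f (compMk K π c) = compMk G π (cauchyMap π f c) := rfl

/-- A Cauchy sequence in `S` that is eventually contained in the kernel of the extension is, up to
finitely many terms, a Cauchy sequence in the kernel, because `π • S` is contained in the kernel. -/
theorem IsExtension.exists_cauchy_lift (h : IsExtension i p) (hQ : ∀ y : Q, π • y = 0)
    {S : Submodule V G} (hS : G.born.Bdd (S : Set G)) {c : ℕ → G}
    (hc : c ∈ cauchySubmodule π S) {N : ℕ} (hN : ∀ n ≥ N, ∃ y : K, i y = c n) :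
    ∃ d : K.cauchyAlg π, d.1 ∈ cauchySubmodule π (S.comap (i.toHom : K →ₗ[V] G)) ∧
      ∀ n ≥ N, i (d.1 n) = c n := by
  choose! y hy using hN
  have : (fun n => if N ≤ n then y n else 0) ∈
      cauchySubmodule π (S.comap (i.toHom : K →ₗ[V] G)) := by
    refine ⟨fun n => ?_, fun k => ?_⟩
    · dsimp only
      split_ifs with hn
      · rw [Submodule.mem_comap]
        exact (hy n hn ▸ hc.1 n : i (y n) ∈ S)
      · exact Submodule.zero_mem _
    · obtain ⟨M, hM⟩ := hc.2 (k + 1)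
      refine ⟨M ⊔ N, fun m hm n hn => ?_⟩
      have hm' := le_sup_right.trans hm
      have hn' := le_sup_right.trans hn
      dsimp only
      rw [if_pos hm', if_pos hn']
      obtain ⟨s, hs, e⟩ := mem_smul_iff.1 (hM m (le_sup_left.trans hm) n (le_sup_left.trans hn))
      obtain ⟨t, ht⟩ := h.exists_smul hQ s
      have : y m - y n = π ^ k • t := h.injective (by
        rw [show i (y m - y n) = i (y m) - i (y n) from map_sub i.toHom _ _,
          show i (π ^ k • t) = π ^ k • i t from map_smul i.toHom _ _, ht, hy m hm', hy n hn', ← e,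
          pow_succ, mul_smul])
      rw [this]
      refine smul_mem_smul _ ?_
      rw [Submodule.mem_comap]
      exact (ht ▸ S.smul_mem π hs : i t ∈ S)
  obtain ⟨d, hd⟩ := exists_cauchySub (h.bdd_comap hS) this
  refine ⟨d, hd ▸ this, fun n hn => ?_⟩
  rw [congrFun hd n, if_pos hn, hy n hn]

theorem IsExtension.limComplMap_injective (h : IsExtension i p) (hQ : ∀ y : Q, π • y = 0) :
    Function.Injective (limComplMap π i) := by
  refine (injective_iff_map_eq_zero (limComplMap π i).toHom).2 fun x hx => ?_
  obtain ⟨c, rfl⟩ := limMk_surjective x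
  obtain ⟨T, hT, hc⟩ := limMk_eq_zero.1 (show limMk G π (cauchyMap π i c) = 0 from hx)
  obtain ⟨S, hS, hcS⟩ := c.2
  refine limMk_eq_zero.2 ⟨S ⊔ T.comap (i.toHom : K →ₗ[V] G), hS.sup (h.bdd_comap hT),
    fun n => le_sup_left (a := S) (hcS.1 n), fun k => ?_⟩
  obtain ⟨N, hN⟩ := hc.2 (k + 1)
  refine ⟨N, fun n hn => ?_⟩
  obtain ⟨t, ht, e⟩ := mem_smul_iff.1 (hN n hn)
  obtain ⟨y, hy⟩ := h.exists_smul hQ t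
  have : c.1 n = π ^ k • y := h.injective (by
    rw [show i (π ^ k • y) = π ^ k • i y from map_smul i.toHom _ _, hy, smul_smul, ← pow_succ]
    exact e.symm)
  rw [this]
  refine smul_mem_smul _ (le_sup_right (a := S) ?_)
  rw [Submodule.mem_comap]
  exact (hy ▸ T.smul_mem π ht : i y ∈ T)

theorem IsExtension.exists_limComplMap_eq_smul (h : IsExtension i p) (hQ : ∀ y : Q, π • y = 0)
    (x : G.limCompl π) : ∃ y, limComplMap π i y = π • x := by
  obtain ⟨c, rfl⟩ := limMk_surjective x
  obtain ⟨S, hS, hc⟩ := (π • c).2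
  obtain ⟨d, -, hd⟩ := h.exists_cauchy_lift hQ hS hc (N := 0) fun n _ => h.exists_smul hQ (c.1 n)
  refine ⟨limMk K π d, ?_⟩
  rw [limComplMap_limMk]
  exact limMk_congr hd

/-- The closure of zero in the inductive limit for `G` comes from the closure of zero for the
kernel: the image of the latter is already closed. -/
theorem IsExtension.closureZero_le_map (h : IsExtension i p) (hQ : ∀ y : Q, π • y = 0) :
    ((G.limCompl π).closureZero π).toSubmodule ≤
      ((K.limCompl π).closureZero π).toSubmodule.map
        ((limComplMap π i).toHom : K.limCompl π →ₗ[V] G.limCompl π) := by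
  refine closureZero_le ?_
  rintro x ⟨S, hS, hx⟩
  obtain ⟨_, ⟨z, hz, rfl⟩, hxz⟩ := hx 1
  obtain ⟨s, hs, e⟩ := mem_smul_iff.1 hxz
  rw [pow_one] at e
  obtain ⟨y, hy⟩ := h.exists_limComplMap_eq_smul hQ s
  have hx' : limComplMap π i (y + z) = x := by
    rw [show limComplMap π i (y + z) = limComplMap π i y + limComplMap π i z from
      map_add (limComplMap π i).toHom _ _, hy, e]
    exact sub_add_cancel _ _
  refine ⟨y + z, isBornClosed_closureZero _ ⟨S.comap
    ((limComplMap π i).toHom : K.limCompl π →ₗ[V] G.limCompl π), ?_, fun k => ?_⟩, hx'⟩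
  · obtain ⟨T, hT, hS⟩ := bdd_limCompl.1 hS
    -- A class in the limit for `K` whose image is represented in `T` is represented in `T ∩ K`.
    refine bdd_limCompl.2 ⟨_, h.bdd_comap hT, fun w hw => ?_⟩
    obtain ⟨c, hc, e⟩ := hS _ hw
    obtain ⟨d, rfl⟩ := limMk_surjective w
    have e : limMk G π c = limMk G π (cauchyMap π i d) := e
    obtain ⟨T', hT', hcd⟩ := limMk_eq.1 e
    obtain ⟨N, hN⟩ := hcd.2 1
    obtain ⟨d', hd', hdN⟩ := h.exists_cauchy_lift hQ hT hc (N := N) fun n hn => by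
      obtain ⟨t, -, ht⟩ := mem_smul_iff.1 (hN n hn)
      obtain ⟨y, hy⟩ := h.exists_smul hQ t
      refine ⟨y + d.1 n, ?_⟩
      rw [pow_one] at ht
      rw [show i (y + d.1 n) = i y + i (d.1 n) from map_add i.toHom _ _, hy, ht]
      exact sub_add_cancel _ _
    refine ⟨d', hd', h.limComplMap_injective hQ ?_⟩
    rw [limComplMap_limMk, limComplMap_limMk, ← e]
    exact limMk_congr hdN
  · obtain ⟨_, ⟨z', hz', rfl⟩, hxz'⟩ := hx (k + 1)
    obtain ⟨s', hs', e'⟩ := mem_smul_iff.1 hxz'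
    obtain ⟨y', hy'⟩ := h.exists_limComplMap_eq_smul hQ s'
    refine ⟨z', hz', ?_⟩
    have : y + z - z' = π ^ k • y' := h.limComplMap_injective hQ (by
      rw [show limComplMap π i (y + z - z') = limComplMap π i (y + z) - limComplMap π i z' from
        map_sub (limComplMap π i).toHom _ _, hx',
        show limComplMap π i (π ^ k • y') = π ^ k • limComplMap π i y' from
        map_smul (limComplMap π i).toHom _ _, hy', smul_smul, ← pow_succ]
      exact e'.symm)
    rw [this]
    refine smul_mem_smul _ ?_
    rw [Submodule.mem_comap]
    exact (hy' ▸ S.smul_mem π hs' : limComplMap π i y' ∈ S)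

theorem IsExtension.completionMap_injective (h : IsExtension i p) (hQ : ∀ y : Q, π • y = 0) :
    Function.Injective (completionMap π i) := by
  refine (injective_iff_map_eq_zero (completionMap π i).toHom).2 fun x hx => ?_
  obtain ⟨y, rfl⟩ := quotMk_surjective x
  have hx : (G.limCompl π).quotMk _ (limComplMap π i y) = 0 := hx
  obtain ⟨z, hz, e⟩ := h.closureZero_le_map hQ (quotMk_eq_zero.1 hx)
  rw [← h.limComplMap_injective hQ e]
  exact quotMk_eq_zero.2 hz

theorem IsExtension.exists_completionMap_eq (h : IsExtension i p) (hQ : ∀ y : Q, π • y = 0)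
    {S : Submodule V G} (hS : G.born.Bdd (S : Set G)) {c : G.cauchyAlg π}
    (hc : c.1 ∈ cauchySubmodule π S)
    (h0 : completionLift p hQ (compMk G π c) = 0) :
    ∃ d : K.cauchyAlg π, d.1 ∈ cauchySubmodule π (S.comap (i.toHom : K →ₗ[V] G)) ∧
      completionMap π i (compMk K π d) = compMk G π c := by
  obtain ⟨N, hN⟩ := eventualValue_spec p hQ c
  rw [completionLift_compMk] at h0
  obtain ⟨d, hd, hdN⟩ := h.exists_cauchy_lift hQ hS hc (N := N) fun n hn =>
    (h.exact _).1 ((hN n hn).trans h0)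
  exact ⟨d, hd, compMk_congr hdN⟩

theorem isExtension_completion (h : IsExtension i p) (hQ : ∀ y : Q, π • y = 0) :
    IsExtension (completionMap π i) (completionLift p hQ) where
  injective := h.completionMap_injective hQ
  bdd_of_image s hs := by
    obtain ⟨S, hS, hs⟩ := bdd_completion.1 hs
    refine bdd_completion.2 ⟨_, h.bdd_comap hS, fun x hx => ?_⟩
    obtain ⟨c, hc, e⟩ := hs _ ⟨x, hx, rfl⟩
    obtain ⟨a, rfl⟩ := compMk_surjective x
    obtain ⟨d, hd, e'⟩ := h.exists_completionMap_eq hQ hS hc (by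
      rw [e]
      exact eventualValue_eq p hQ (N := 0) fun n _ => h.apply_apply (a.1 n))
    exact ⟨d, hd, h.completionMap_injective hQ (e'.trans e)⟩
  exact x := by
    constructor
    · intro hx
      obtain ⟨c, rfl⟩ := compMk_surjective x
      obtain ⟨S, hS, hc⟩ := c.2
      obtain ⟨d, -, e⟩ := h.exists_completionMap_eq hQ hS hc hx
      exact ⟨_, e⟩
    · rintro ⟨y, rfl⟩
      obtain ⟨a, rfl⟩ := compMk_surjective y
      exact eventualValue_eq p hQ (N := 0) fun n _ => h.apply_apply (a.1 n)
  surjective y := by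
    obtain ⟨x, rfl⟩ := h.surjective y
    exact ⟨_, completionLift_toCompletion p hQ x⟩
  exists_bdd_lift t ht := by
    obtain ⟨s, hs, rfl⟩ := h.exists_bdd_lift t ht
    refine ⟨toCompletion G π '' s, (toCompletion G π).bdd s hs, ?_⟩
    rw [Set.image_image]
    exact Set.image_congr fun x _ => completionLift_toCompletion p hQ x

end Extension

/-! ### The extension of tube algebras -/

theorem VBornology.bdd_fine {V : Type u} [CommRing V] {M : Type v} [AddCommGroup M] [Module V M]
    {s : Set M} : (VBornology.fine V M).Bdd s ↔ ∃ S : Submodule V M, S.FG ∧ s ⊆ (S : Set M) :=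
  VBornology.bdd_ofSubmodules

theorem VBornology.bdd_of_fg {V : Type u} [CommRing V] {M : Type v} [AddCommGroup M] [Module V M]
    (b : VBornology V M) {S : Submodule V M} (hS : S.FG) : b.Bdd (S : Set M) := by
  obtain ⟨s, hs, rfl⟩ := Submodule.fg_def.1 hS
  exact Bdd.span (@Set.Finite.isBounded M b.toBornology _ hs)

/-- A finitely generated submodule of the target of a surjective linear map is the image of a
finitely generated submodule. -/
theorem exists_fg_map_eq {V : Type u} [CommRing V] {M : Type v} [AddCommGroup M] [Module V M]
    {N : Type w} [AddCommGroup N] [Module V N] {f : M →ₗ[V] N} (hf : Function.Surjective f)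
    {S : Submodule V N} (hS : S.FG) : ∃ T : Submodule V M, T.FG ∧ T.map f = S := by
  obtain ⟨s, hs, rfl⟩ := Submodule.fg_def.1 hS
  refine ⟨Submodule.span V (Function.surjInv hf '' s), Submodule.fg_span (hs.image _), ?_⟩
  rw [Submodule.map_span, Set.image_image]
  simp [Function.surjInv_eq hf]

section Hom

variable {V : Type u} [CommRing V] {R : BornAlg.{u, v₁} V} {G : BornAlg.{u, v₂} V}
  {A : Type w} [NonUnitalRing A] [Module V A]

/-- If `G` is spanned by an ideal `J` and the image of `R`, then a homomorphism on `R` that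
vanishes exactly on the elements mapped into `J` extends to `G` with kernel `J`. -/
theorem exists_hom_of_ideal (j : R →ₙₐ[V] G) (J : Submodule V G) (f : R →ₙₐ[V] A)
    (hJl : ∀ (x : G), ∀ y ∈ J, x * y ∈ J) (hJr : ∀ (x : G), ∀ y ∈ J, y * x ∈ J)
    (hsup : ∀ x : G, ∃ r, x - j r ∈ J) (hf : ∀ r, j r ∈ J ↔ f r = 0) :
    ∃ q : G →ₙₐ[V] A, (∀ r, q (j r) = f r) ∧ ∀ x, q x = 0 ↔ x ∈ J := by
  choose g hg using hsup
  have key : ∀ x r, x - j r ∈ J → f (g x) = f r := fun x r hr => by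
    rw [← sub_eq_zero, ← map_sub, ← hf, map_sub]
    have := J.sub_mem hr (hg x)
    rwa [sub_sub_sub_cancel_left] at this
  refine ⟨{
    toFun := fun x => f (g x)
    map_smul' := fun c x => ?_
    map_zero' := ?_
    map_add' := fun x y => ?_
    map_mul' := fun x y => ?_ }, fun r => ?_, fun x => ?_⟩
  · rw [key (c • x) (c • g x) (by rw [map_smul, ← smul_sub]; exact J.smul_mem _ (hg x)), map_smul]
    rfl
  · rw [key 0 0 (by rw [map_zero, sub_zero]; exact J.zero_mem), map_zero]
  · rw [key (x + y) (g x + g y) (by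
      rw [map_add, add_sub_add_comm]; exact J.add_mem (hg x) (hg y)), map_add]
  · rw [key (x * y) (g x * g y) (by
      have : x * y - j (g x * g y) = (x - j (g x)) * y + j (g x) * (y - j (g y)) := by
        rw [map_mul, sub_mul, mul_sub]; abel
      rw [this]
      exact J.add_mem (hJr _ _ (hg x)) (hJl _ _ (hg y))), map_mul]
  · exact key _ _ (by rw [sub_self]; exact J.zero_mem)
  · show f (g x) = 0 ↔ _
    rw [← hf]
    constructor
    · intro h
      simpa using J.add_mem (hg x) h
    · intro h
      simpa using J.sub_mem h (hg x)

/-- A bornological embedding `i : K → G` onto an ideal that is complementary to the image of `R` in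
the sense of `exists_hom_of_ideal` is the kernel of an extension with quotient `A`. -/
theorem exists_isExtension_of_ideal [IsScalarTower V A A] [SMulCommClass V A A] {π : V}
    {K : BornAlg.{u, v₃} V} (i : BHom K G) (j : BHom R G) (f : R →ₙₐ[V] A)
    (hA : ∀ a : A, π • a = 0) (hf : Function.Surjective f)
    (J : Submodule V G) (hi : ∀ x, (∃ y, i y = x) ↔ x ∈ J)
    (hinj : Function.Injective i) (hbdd : ∀ s : Set K, G.born.Bdd (i '' s) → K.born.Bdd s)
    (hJl : ∀ (x : G), ∀ y ∈ J, x * y ∈ J) (hJr : ∀ (x : G), ∀ y ∈ J, y * x ∈ J)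
    (hsup : ∀ x : G, ∃ r, x - j r ∈ J) (hjf : ∀ r, j r ∈ J ↔ f r = 0)
    (hfine : ∀ S : Submodule V G, G.born.Bdd (S : Set G) →
      ∃ E : Submodule V G, E.FG ∧ S ≤ E ⊔ π • ⊤) :
    ∃ p : BHom G (fineAlg V A), (∀ r, p (j r) = f r) ∧ IsExtension i p := by
  obtain ⟨q, hq, hq'⟩ := exists_hom_of_ideal j.toHom J f hJl hJr hsup hjf
  have hsurj : Function.Surjective q := fun a => by
    obtain ⟨r, rfl⟩ := hf a
    exact ⟨_, hq r⟩
  refine ⟨⟨q, fun s hs => ?_⟩, hq, hinj, hbdd, fun x => (hq' x).trans (hi x).symm, hsurj,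
    fun t ht => ?_⟩
  · obtain ⟨E, hE, hsE⟩ := hfine _ hs.span
    refine VBornology.bdd_fine.2 ⟨E.map (q : G →ₗ[V] A), hE.map _, ?_⟩
    rintro _ ⟨x, hx, rfl⟩
    obtain ⟨a, ha, b, hb, e⟩ := Submodule.mem_sup.1 (hsE (Submodule.subset_span hx))
    obtain ⟨b, -, rfl⟩ := mem_smul_iff.1 hb
    refine ⟨a, ha, ?_⟩
    rw [← e]
    show q a = q (a + π • b)
    rw [map_add, map_smul, hA, add_zero]
  · obtain ⟨S, hS, ht⟩ := VBornology.bdd_fine.1 ht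
    obtain ⟨T, hT, rfl⟩ := exists_fg_map_eq (f := (q : G →ₗ[V] A)) hsurj hS
    refine ⟨T ∩ q ⁻¹' t, (G.born.bdd_of_fg hT).subset Set.inter_subset_left, ?_⟩
    ext a
    constructor
    · rintro ⟨x, hx, rfl⟩
      exact hx.2
    · intro ha
      obtain ⟨x, hx, rfl⟩ := ht ha
      exact ⟨x, ⟨hx, ha⟩, rfl⟩

end Hom

namespace BornAlg

theorem AlgIdeal.pow_succ_le_self {V : Type u} [CommRing V] {R : BornAlg.{u, v} V}
    (I : AlgIdeal R) (n : ℕ) : I.pow (n + 1) ≤ I.toSubmodule :=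
  I.pow_antitone (Nat.succ_le_succ (Nat.zero_le n))

theorem map_incl_top_pow {V : Type u} [CommRing V] {R : BornAlg.{u, v} V}
    (I : AlgIdeal R) (n : ℕ) :
    ((AlgIdeal.top I.toAlg).pow n).map (I.incl.toHom : I.toAlg →ₗ[V] R) =
      I.pow n ⊓ I.toSubmodule := by
  have htop : (⊤ : Submodule V I.toAlg).map (I.incl.toHom : I.toAlg →ₗ[V] R) = I.toSubmodule := by
    ext x
    exact ⟨by rintro ⟨y, -, rfl⟩; exact y.2, fun hx => ⟨⟨x, hx⟩, trivial, rfl⟩⟩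
  cases n with
  | zero => exact htop.trans (inf_eq_right.2 le_top).symm
  | succ n =>
    rw [inf_eq_left.2 (I.pow_succ_le_self n)]
    show (powS (⊤ : Submodule V I.toAlg) n).map _ = powS I.toSubmodule n
    rw [map_powS, htop]

variable {V : Type u} [CommRing V] [IsDomain V] (R : BornAlg.{u, v} V) (I : AlgIdeal R) (π : V)
  (l : ℕ+)

/-- The submodule `I + ∑ j ≥ 1, π ^ (-j) I ^ (l j)` of `F ⊗ R`. The intersection with `I` only
matters for the summand with `j = 0`, where `I ^ 0 = R`. -/
noncomputable def tubeKer : Submodule V R.frac :=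
  ⨆ j : ℕ, (I.pow ((l : ℕ) * j) ⊓ I.toSubmodule).map
    (TensorProduct.mk V (FractionRing V) R ((algebraMap V (FractionRing V) π)⁻¹ ^ j))

/-- The inclusion of the tube algebra of `I ^ l` in `I` into the tube algebra of `I ^ l` in `R`. -/
noncomputable def tubeIncl : BHom (tube I.toAlg (AlgIdeal.top I.toAlg) π l) (tube R I π l) :=
  tubeMap π I.incl (fun x _ => x.2) (le_refl l)

variable {R I π l}

theorem tubeKer_le_of {Z : Submodule V R.frac}
    (h0 : ∀ a ∈ I.toSubmodule, ((1 : FractionRing V) ⊗ₜ[V] a : FractionRing V ⊗[V] R) ∈ Z)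
    (h1 : ∀ j : ℕ, ∀ a ∈ I.pow ((l : ℕ) * (j + 1)),
      (((algebraMap V (FractionRing V) π)⁻¹ ^ (j + 1)) ⊗ₜ[V] a : FractionRing V ⊗[V] R) ∈ Z) :
    tubeKer R I π l ≤ Z := by
  refine iSup_le fun j => ?_
  rintro _ ⟨a, ha, rfl⟩
  cases j with
  | zero => rw [pow_zero]; exact h0 a ha.2
  | succ j => exact h1 j a ha.1

theorem tmul_mem_tubeKer {j : ℕ} {a : R} (ha : a ∈ I.pow ((l : ℕ) * j)) (ha' : a ∈ I.toSubmodule) :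
    (((algebraMap V (FractionRing V) π)⁻¹ ^ j) ⊗ₜ[V] a : FractionRing V ⊗[V] R) ∈
      tubeKer R I π l :=
  Submodule.mem_iSup_of_mem j ⟨a, ⟨ha, ha'⟩, rfl⟩

theorem mul_mem_tubeKer {x y : R.frac} (hx : x ∈ tubeSubmodule R I π l)
    (hy : y ∈ tubeKer R I π l) : x * y ∈ tubeKer R I π l ∧ y * x ∈ tubeKer R I π l := by
  have key : mulS (tubeSubmodule R I π l) (tubeKer R I π l) ≤ tubeKer R I π l ∧
      mulS (tubeKer R I π l) (tubeSubmodule R I π l) ≤ tubeKer R I π l := by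
    constructor <;> unfold mulS
    · nth_rewrite 1 [tubeSubmodule, tubeKer]
      rw [Submodule.map₂_iSup_left]
      refine iSup_le fun i => ?_
      rw [Submodule.map₂_iSup_right]
      refine iSup_le fun j => ?_
      refine Submodule.map₂_le.2 ?_
      rintro _ ⟨a, ha, rfl⟩ _ ⟨b, hb, rfl⟩
      rw [LinearMap.mul_apply', TensorProduct.mk_apply, TensorProduct.mk_apply,
        Algebra.TensorProduct.tmul_mul_tmul, ← pow_add]
      refine tmul_mem_tubeKer ?_ (I.mul_mem_left a hb.2)
      rw [mul_add]
      exact I.mul_mem_pow ha hb.1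
    · nth_rewrite 1 [tubeSubmodule, tubeKer]
      rw [Submodule.map₂_iSup_left]
      refine iSup_le fun i => ?_
      rw [Submodule.map₂_iSup_right]
      refine iSup_le fun j => ?_
      refine Submodule.map₂_le.2 ?_
      rintro _ ⟨a, ha, rfl⟩ _ ⟨b, hb, rfl⟩
      rw [LinearMap.mul_apply', TensorProduct.mk_apply, TensorProduct.mk_apply,
        Algebra.TensorProduct.tmul_mul_tmul, ← pow_add]
      refine tmul_mem_tubeKer ?_ (I.mul_mem_right b ha.2)
      rw [mul_add]
      exact I.mul_mem_pow ha.1 hb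
  exact ⟨key.1 (mul_mem_mulS hx hy), key.2 (mul_mem_mulS hy hx)⟩

theorem exists_sub_mem_tubeKer {x : R.frac} (hx : x ∈ tubeSubmodule R I π l) :
    ∃ r : R, x - (1 : FractionRing V) ⊗ₜ[V] r ∈ tubeKer R I π l := by
  have : tubeSubmodule R I π l ≤
      LinearMap.range (TensorProduct.mk V (FractionRing V) R 1) ⊔ tubeKer R I π l := by
    refine iSup_le fun j => ?_
    rintro _ ⟨a, ha, rfl⟩
    cases j with
    | zero => rw [pow_zero]; exact Submodule.mem_sup_left ⟨a, rfl⟩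
    | succ j =>
      exact Submodule.mem_sup_right (tmul_mem_tubeKer ha
        (I.pow_antitone (Nat.mul_pos l.pos (Nat.succ_pos j)) ha |> I.pow_succ_le_self 0))
  obtain ⟨_, ⟨r, rfl⟩, y, hy, e⟩ := Submodule.mem_sup.1 (this hx)
  exact ⟨r, by rw [← e, TensorProduct.mk_apply, add_sub_cancel_left]; exact hy⟩

theorem map_tubeSubmodule_top :
    (tubeSubmodule I.toAlg (AlgIdeal.top I.toAlg) π l).map
      ((fracMap I.incl).toHom : I.toAlg.frac →ₗ[V] R.frac) = tubeKer R I π l := by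
  unfold tubeSubmodule tubeKer
  rw [Submodule.map_iSup]
  refine iSup_congr fun j => ?_
  rw [← map_incl_top_pow, ← Submodule.map_comp, ← Submodule.map_comp]
  rfl

theorem fracMap_incl_injective : Function.Injective (fracMap I.incl) := by
  have : Module.Flat V (FractionRing V) := IsLocalization.flat _ (nonZeroDivisors V)
  exact Module.Flat.lTensor_preserves_injective_linearMap (M := FractionRing V)
    (I.incl.toHom : I.toAlg →ₗ[V] R) Subtype.val_injective

theorem tubeIncl_injective : Function.Injective (tubeIncl R I π l) := fun _ _ h =>
  Subtype.ext (fracMap_incl_injective (congrArg Subtype.val h))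

theorem mem_range_tubeIncl {x : tube R I π l} :
    (∃ y, tubeIncl R I π l y = x) ↔ x.1 ∈ tubeKer R I π l := by
  rw [← map_tubeSubmodule_top]
  constructor
  · rintro ⟨y, rfl⟩
    exact ⟨y.1, y.2, rfl⟩
  · rintro ⟨y, hy, e⟩
    exact ⟨⟨y, hy⟩, Subtype.ext e⟩

theorem tubeIncl_bdd_of_image (hπ : π ≠ 0) (hI : ∀ r : R, π • r ∈ I.toSubmodule)
    {s : Set (tube I.toAlg (AlgIdeal.top I.toAlg) π l)}
    (hs : (tube R I π l).born.Bdd (tubeIncl R I π l '' s)) :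
    (tube I.toAlg (AlgIdeal.top I.toAlg) π l).born.Bdd s := by
  rw [bdd_sub] at hs ⊢
  obtain ⟨e, he, S, hS, h⟩ := bdd_frac.1 hs
  refine bdd_frac.2 ⟨π * e, mul_ne_zero hπ he, S.comap (I.incl.toHom : I.toAlg →ₗ[V] R),
    bdd_sub.2 (hS.subset (by rintro _ ⟨x, hx, rfl⟩; exact hx)), ?_⟩
  rintro _ ⟨y, hy, rfl⟩
  obtain ⟨r, hr, e1⟩ := h _ ⟨_, ⟨y, hy, rfl⟩, rfl⟩
  refine ⟨⟨π • r, hI r⟩, S.smul_mem π hr, fracMap_incl_injective ?_⟩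
  rw [fracMap_tmul, show fracMap I.incl ((π * e) • y.1) = (π * e) • fracMap I.incl y.1 from
    map_smul (fracMap I.incl).toHom _ _, mul_smul]
  show (1 : FractionRing V) ⊗ₜ[V] (π • r) = _
  rw [TensorProduct.tmul_smul, e1]
  rfl

/-- The tube algebra of `I ^ l` in `R` is an extension of `R / I` by the tube algebra of `I ^ l`
in `I`, provided that `R / I` is killed by `π` and `R ∩ (I + ∑ j ≥ 1, π ^ (-j) I ^ (l j)) = I`. -/
theorem exists_tube_isExtension {A : Type w} [NonUnitalRing A] [Module V A] [IsScalarTower V A A]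
    [SMulCommClass V A A] (hπ : π ≠ 0) (hA : ∀ a : A, π • a = 0) (f : R →ₙₐ[V] A)
    (hf : Function.Surjective f)
    (hker : ∀ r : R, (1 : FractionRing V) ⊗ₜ[V] r ∈ tubeKer R (kerIdeal R f) π l → f r = 0)
    (hfine : ∀ S : Submodule V (tube R (kerIdeal R f) π l),
      (tube R (kerIdeal R f) π l).born.Bdd (S : Set _) →
      ∃ E : Submodule V (tube R (kerIdeal R f) π l), E.FG ∧ S ≤ E ⊔ π • ⊤) :
    ∃ p : BHom (tube R (kerIdeal R f) π l) (fineAlg V A),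
      (∀ r, p (toTube R (kerIdeal R f) π l r) = f r) ∧
        IsExtension (tubeIncl R (kerIdeal R f) π l) p := by
  have hI : ∀ r : R, π • r ∈ (kerIdeal R f).toSubmodule := fun r => by
    show f (π • r) = 0
    rw [map_smul, hA]
  exact exists_isExtension_of_ideal (tubeIncl R (kerIdeal R f) π l)
    (toTube R (kerIdeal R f) π l) f hA hf
    ((tubeKer R (kerIdeal R f) π l).comap (tubeSub R (kerIdeal R f) π l).toSubmodule.subtype)
    (fun _ => mem_range_tubeIncl) tubeIncl_injective (fun _ hs => tubeIncl_bdd_of_image hπ hI hs)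
    (fun x y hy => (mul_mem_tubeKer x.2 hy).1) (fun x y hy => (mul_mem_tubeKer x.2 hy).2)
    (fun x => exists_sub_mem_tubeKer x.2) (fun r => ⟨hker r, fun hr => by
      have := tmul_mem_tubeKer (π := π) (l := l) (j := 0) (a := r) (I := kerIdeal R f)
        (by rw [mul_zero]; trivial) hr
      rwa [pow_zero] at this⟩) hfine

end BornAlg

/-! ### Fineness modulo the uniformiser -/

namespace VBornology

variable {V : Type u} [CommRing V] {M : Type v} [AddCommGroup M] [Module V M]

theorem ext_bdd {b b' : VBornology V M} (h : ∀ s, b.Bdd s ↔ b'.Bdd s) : b = b' := by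
  cases b with | mk b hb => cases b' with | mk b' hb' =>
  congr
  exact Bornology.ext_iff_isBounded.2 h

/-- Fine mod `π` means that bounded submodules are finitely generated up to multiples of `π`. -/
theorem isFineMod_iff {b : VBornology V M} {π : V} : b.IsFineMod π ↔
    ∀ S : Submodule V M, b.Bdd (S : Set M) → ∃ E : Submodule V M, E.FG ∧ S ≤ E ⊔ π • ⊤ := by
  constructor
  · intro h S hS
    have : (b.quotient (π • (⊤ : Submodule V M))).Bdd
        (S.map (π • (⊤ : Submodule V M)).mkQ : Set _) :=
      bdd_quotient.2 ⟨S, hS, le_rfl⟩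
    rw [show b.quotient (π • (⊤ : Submodule V M)) = _ from h] at this
    obtain ⟨T, hT, hST⟩ := bdd_fine.1 this
    obtain ⟨E, hE, rfl⟩ := exists_fg_map_eq (π • (⊤ : Submodule V M)).mkQ_surjective hT
    refine ⟨E, hE, ?_⟩
    have := Submodule.map_le_iff_le_comap.1 (show S.map (π • (⊤ : Submodule V M)).mkQ ≤ _ from hST)
    rwa [Submodule.comap_map_mkQ, sup_comm] at this
  · intro h
    refine ext_bdd fun s => ?_
    constructor
    · intro hs
      obtain ⟨S, hS, hs⟩ := bdd_quotient.1 hs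
      obtain ⟨E, hE, hSE⟩ := h S hS
      refine bdd_fine.2 ⟨E.map (π • (⊤ : Submodule V M)).mkQ, hE.map _, hs.trans ?_⟩
      refine Submodule.map_le_iff_le_comap.2 ?_
      rwa [Submodule.comap_map_mkQ, sup_comm]
    · intro hs
      obtain ⟨T, hT, hs⟩ := bdd_fine.1 hs
      obtain ⟨E, hE, rfl⟩ := exists_fg_map_eq (π • (⊤ : Submodule V M)).mkQ_surjective hT
      exact bdd_quotient.2 ⟨E, b.bdd_of_fg hE, hs⟩

/-- The submodule `S` is finitely generated up to multiples of `c` in `M`. -/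
def FGUpTo (c : V) (S : Submodule V M) : Prop := ∃ E : Submodule V M, E.FG ∧ S ≤ E ⊔ c • ⊤

theorem FGUpTo.mono {c : V} {S T : Submodule V M} (hT : FGUpTo c T) (h : S ≤ T) : FGUpTo c S :=
  hT.imp fun _ hE => ⟨hE.1, h.trans hE.2⟩

theorem FGUpTo.sup {c : V} {S T : Submodule V M} (hS : FGUpTo c S) (hT : FGUpTo c T) :
    FGUpTo c (S ⊔ T) := by
  obtain ⟨E, hE, h⟩ := hS
  obtain ⟨F, hF, h'⟩ := hT
  exact ⟨E ⊔ F, hE.sup hF, sup_le (h.trans (sup_le_sup_right le_sup_left _))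
    (h'.trans (sup_le_sup_right le_sup_right _))⟩

theorem FGUpTo.map {c : V} {N : Type w} [AddCommGroup N] [Module V N] {S : Submodule V M}
    (hS : FGUpTo c S) (f : M →ₗ[V] N) : FGUpTo c (S.map f) := by
  obtain ⟨E, hE, h⟩ := hS
  refine ⟨E.map f, hE.map f, (Submodule.map_mono h).trans ?_⟩
  rw [Submodule.map_sup]
  refine sup_le_sup_left ?_ _
  rintro _ ⟨x, hx, rfl⟩
  obtain ⟨x, -, rfl⟩ := mem_smul_iff.1 hx
  rw [map_smul]
  exact smul_mem_smul _ trivial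

theorem fgUpTo_bot (c : V) : FGUpTo c (⊥ : Submodule V M) := ⟨⊥, Submodule.fg_bot, bot_le⟩

theorem fgUpTo_iSup {c : V} {n : ℕ} {S : ℕ → Submodule V M} (h : ∀ i, FGUpTo c (S i)) :
    FGUpTo c (⨆ i ∈ Finset.range n, S i) := by
  induction n with
  | zero => exact (fgUpTo_bot c).mono (by simp)
  | succ n ih =>
    rw [Finset.range_add_one, Finset.iSup_insert]
    exact (h n).sup ih

/-- If a torsionfree bornological module is fine mod `π`, then bounded submodules are finitely
generated up to multiples of `π ^ k`: the error in `π • M` lies in `π • S'` for another bounded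
submodule `S'`, to which the case of `k - 1` applies. -/
theorem IsFineMod.fgUpTo_pow {b : VBornology V M} {π : V} (h : b.IsFineMod π)
    (h' : b.IsTorsionfree π) (k : ℕ) {S : Submodule V M} (hS : b.Bdd (S : Set M)) :
    FGUpTo (π ^ k) S := by
  induction k generalizing S with
  | zero => exact ⟨⊥, Submodule.fg_bot, by rw [pow_zero, one_smul]; exact le_top.trans le_sup_right⟩
  | succ k ih =>
    obtain ⟨E, hE, hSE⟩ := isFineMod_iff.1 h S hS
    obtain ⟨F, hF, hSF⟩ := ih (h'.bdd_div (hS.sup (b.bdd_of_fg hE)))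
    refine ⟨E ⊔ π • F, hE.sup (hF.map _), fun x hx => ?_⟩
    obtain ⟨e, he, y, hy, rfl⟩ := Submodule.mem_sup.1 (hSE hx)
    obtain ⟨y, -, rfl⟩ := mem_smul_iff.1 hy
    have hy : π • y ∈ S ⊔ E := by
      rw [← add_sub_cancel_left e (π • y)]
      exact Submodule.sub_mem _ (le_sup_left (a := S) hx) (le_sup_right (a := S) he)
    obtain ⟨f, hf, z, hz, rfl⟩ := Submodule.mem_sup.1 (hSF hy)
    obtain ⟨z, -, rfl⟩ := mem_smul_iff.1 hz
    rw [smul_add, ← add_assoc, smul_smul, ← pow_succ']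
    exact Submodule.add_mem_sup (Submodule.add_mem_sup he (smul_mem_smul _ hf))
      (smul_mem_smul _ trivial)

end VBornology

open VBornology

theorem FGUpTo.mulS {V : Type u} [CommRing V] {R : Type v} [NonUnitalRing R] [Module V R]
    [IsScalarTower V R R] [SMulCommClass V R R] {c : V} {S T : Submodule V R}
    (hS : FGUpTo c S) (hT : FGUpTo c T) : FGUpTo c (mulS S T) := by
  obtain ⟨E, hE, h⟩ := hS
  obtain ⟨F, hF, h'⟩ := hT
  refine ⟨DaggerLift.mulS E F, hE.map₂ _ hF, mulS_le.2 fun x hx y hy => ?_⟩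
  obtain ⟨e, he, x', hx', rfl⟩ := Submodule.mem_sup.1 (h hx)
  obtain ⟨x', -, rfl⟩ := mem_smul_iff.1 hx'
  obtain ⟨f, hf, y', hy', rfl⟩ := Submodule.mem_sup.1 (h' hy)
  obtain ⟨y', -, rfl⟩ := mem_smul_iff.1 hy'
  have : (e + c • x') * (f + c • y') = e * f + c • (e * y' + x' * (f + c • y')) := by
    rw [add_mul, mul_add, mul_smul_comm, smul_mul_assoc, smul_add, add_assoc]
  rw [this]
  exact Submodule.add_mem_sup (mul_mem_mulS he hf) (smul_mem_smul _ trivial)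

namespace BornAlg

variable {V : Type u} [CommRing V] {R : BornAlg.{u, v} V} {π : V}

theorem ling_isFineMod (h : R.born.IsFineMod π) : (R.ling π).born.IsFineMod π := by
  rw [isFineMod_iff] at h ⊢
  intro S hS
  obtain ⟨T, hT, hS⟩ := bdd_ling.1 hS
  obtain ⟨E, hE, hTE⟩ := h T hT
  refine ⟨E, hE, le_trans (b := diamond π T) hS ((diamond_le_sup_smul π T).trans (sup_le hTE ?_))⟩
  exact (Submodule.map_mono le_top).trans le_sup_right

theorem completion_isFineMod (h : R.born.IsFineMod π) (h' : R.born.IsTorsionfree π) :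
    (R.completion π).born.IsFineMod π := by
  rw [isFineMod_iff] at h ⊢
  intro P hP
  obtain ⟨S, hS, hP⟩ := bdd_completion.1 hP
  obtain ⟨E, hE, hSE⟩ := h S hS
  refine ⟨E.map ((toCompletion R π).toHom : R →ₗ[V] R.completion π), hE.map _, fun x hx => ?_⟩
  obtain ⟨c, hc, rfl⟩ := hP x hx
  obtain ⟨N, hN⟩ := hc.2 1
  obtain ⟨e, he, r, hr, eq⟩ := Submodule.mem_sup.1 (hSE (hc.1 N))
  obtain ⟨r, -, rfl⟩ := mem_smul_iff.1 hr
  -- The sequence `c` differs from a constant sequence by `π` times a Cauchy sequence.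
  obtain ⟨d, hd, hdN⟩ := exists_smul_eq_of_mem_cauchySubmodule h' (N := N)
    (Submodule.sub_mem _ hc (const_mem_cauchySubmodule (hc.1 N))) fun n hn => by
      obtain ⟨y, -, hy⟩ := mem_smul_iff.1 (hN n hn N le_rfl)
      rw [pow_one] at hy
      exact ⟨y, hy⟩
  obtain ⟨d, rfl⟩ := exists_cauchySub (h'.bdd_div hS) hd
  have e1 : compMk R π c = toCompletion R π (c.1 N) + π • compMk R π d := by
    obtain ⟨a, ha⟩ : ∃ a : R.cauchyAlg π, a.1 = fun _ => c.1 N :=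
      exists_cauchySub hS (const_mem_cauchySubmodule (hc.1 N))
    have e2 : compMk R π c = compMk R π (a + π • d) := compMk_congr (N := N) fun n hn => by
      have e3 := hdN n hn
      have e4 : (a + π • d).1 n = a.1 n + π • d.1 n := rfl
      rw [e4, e3, ha]
      exact (add_sub_cancel _ _).symm
    have e5 : toCompletion R π (c.1 N) = compMk R π a :=
      compMk_congr (c := ⟨fun _ => c.1 N, _⟩) (N := 0) fun n _ => (congrFun ha n).symm
    rw [e2, e5]
    exact (map_add (compMk R π).toHom _ _).trans
      (congrArg (_ + ·) (map_smul (compMk R π).toHom π _))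
  have e6 : toCompletion R π (c.1 N) = toCompletion R π e + π • toCompletion R π r := by
    rw [← eq]
    exact (map_add (toCompletion R π).toHom _ _).trans
      (congrArg (_ + ·) (map_smul (toCompletion R π).toHom π _))
  rw [e1, e6, add_assoc, ← smul_add]
  exact Submodule.add_mem_sup ⟨e, he, rfl⟩ (smul_mem_smul _ trivial)

variable [IsDomain V] [IsDiscreteValuationRing V]

/-- Tube algebras inherit fineness modulo `π` from `R`: only `R ⊆ U ⊆ F ⊗ R` matters. A bounded
subset of `U` is contained in `π ^ (-a) ⊗ S`, where `S` is finitely generated up to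
`π ^ (a + 1) • R`. -/
theorem tube_isFineMod (hπ : Irreducible π) (I : AlgIdeal R) (l : ℕ+)
    (h : ∀ S : Submodule V R, R.born.Bdd (S : Set R) → ∀ k, FGUpTo (π ^ k) S) :
    (tube R I π l).born.IsFineMod π := by
  refine isFineMod_iff.2 fun T hT => ?_
  obtain ⟨e, he, S, hS, hTS⟩ := bdd_frac.1 (bdd_sub.1 hT)
  obtain ⟨a, ha⟩ := IsDiscreteValuationRing.associated_pow_irreducible he hπ
  obtain ⟨u, hu⟩ := ha.dvd
  obtain ⟨E, hE, hSE⟩ := h S hS (a + 1)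
  let g : tube R I π l →ₗ[V] R.frac :=
    (LinearMap.lsmul V R.frac (π ^ a)).comp (tubeSub R I π l).toSubmodule.subtype
  have hg : Function.Injective g := fun x y hxy => Subtype.ext (sub_eq_zero.1
    (pow_smul_cancel (frac_isTorsionfree R hπ.ne_zero).1 a
      (by rw [smul_sub]; exact sub_eq_zero.2 hxy)))
  let F := (E.map (TensorProduct.mk V (FractionRing V) R 1)).comap g
  have hF : F.FG := by
    refine Submodule.fg_of_fg_map_injective g hg ?_
    have : IsNoetherian V (E.map (TensorProduct.mk V (FractionRing V) R 1)) :=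
      isNoetherian_of_fg_of_noetherian _ (hE.map _)
    exact isNoetherian_submodule.1 this _ (Submodule.map_comap_le _ _)
  refine ⟨F, hF, fun x hx => ?_⟩
  obtain ⟨s, hs, hsx⟩ := hTS _ ⟨x, hx, rfl⟩
  obtain ⟨ε, hε, r, hr, e1⟩ := Submodule.mem_sup.1 (hSE (S.smul_mem u hs))
  obtain ⟨r, -, rfl⟩ := mem_smul_iff.1 hr
  have : x - π • toTube R I π l r ∈ F := by
    refine ⟨ε, hε, ?_⟩
    show (1 : FractionRing V) ⊗ₜ[V] ε = π ^ a • (x.1 - π • ((1 : FractionRing V) ⊗ₜ[V] r))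
    rw [eq_sub_of_add_eq e1, TensorProduct.tmul_sub, TensorProduct.tmul_smul, hsx,
      TensorProduct.tmul_smul, smul_sub, smul_smul, smul_smul, mul_comm u, ← hu, ← pow_succ]
  rw [← sub_add_cancel x (π • toTube R I π l r)]
  exact Submodule.add_mem_sup this (smul_mem_smul _ trivial)

theorem daggerTube_isFineMod (hπ : Irreducible π) (I : AlgIdeal R)
    (h : ∀ S : Submodule V R, R.born.Bdd (S : Set R) → ∀ k, FGUpTo (π ^ k) S) :
    (daggerTube R I π).IsFineMod π := fun l =>
  completion_isFineMod (ling_isFineMod (tube_isFineMod hπ I l h))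
    (ling_isTorsionfree (tube_isTorsionfree R I hπ.ne_zero l))

end BornAlg

section Tensor

variable {V : Type u} [CommRing V] {W : Type w} [AddCommGroup W] [Module V W]

/-- The inclusion of `W` into its tensor algebra as a linear map. -/
def tensorInclLinear (b : VBornology V W) : W →ₗ[V] tensorAlg b :=
  (TensorAlgebra.ι V).codRestrict (tensorSub V W).toSubmodule
    fun x => NonUnitalAlgebra.subset_adjoin V ⟨x, rfl⟩

/-- The inclusion of the non-unital into the unital tensor algebra. -/
def tensorVal (b : VBornology V W) : tensorAlg b →ₗ[V] TensorAlgebra V W :=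
  (tensorSub V W).toSubmodule.subtype

theorem bdd_tensorAlg {b : VBornology V W} {s : Set (tensorAlg b)} :
    (tensorAlg b).born.Bdd s ↔ ∃ (a : ℕ) (B : Submodule V W), b.Bdd (B : Set W) ∧
      ∀ x ∈ s, tensorVal b x ∈ tensorPart B a := by
  unfold tensorAlg
  rw [VBornology.bdd_ofSubmodules]
  constructor
  · rintro ⟨_, ⟨a, B, hB, rfl⟩, h⟩; exact ⟨a, B, hB, h⟩
  · rintro ⟨a, B, hB, h⟩; exact ⟨_, ⟨a, B, hB, rfl⟩, h⟩

theorem map_val_mulS (b : VBornology V W) (P Q : Submodule V (tensorAlg b)) :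
    (mulS P Q).map (tensorVal b) =
      P.map (tensorVal b) * Q.map (tensorVal b) := by
  apply le_antisymm
  · refine Submodule.map_le_iff_le_comap.2 (mulS_le.2 fun x hx y hy => ?_)
    exact Submodule.mul_mem_mul ⟨x, hx, rfl⟩ ⟨y, hy, rfl⟩
  · refine Submodule.mul_le.2 ?_
    rintro _ ⟨x, hx, rfl⟩ _ ⟨y, hy, rfl⟩
    exact ⟨x * y, mul_mem_mulS hx hy, rfl⟩

theorem map_val_powS (b : VBornology V W) (B : Submodule V W) (n : ℕ) :
    (powS (B.map (tensorInclLinear b)) n).map (tensorVal b) =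
      (B.map (TensorAlgebra.ι V)) ^ (n + 1) := by
  induction n with
  | zero =>
    rw [zero_add, pow_one]
    show (B.map (tensorInclLinear b)).map _ = _
    rw [← Submodule.map_comp]
    rfl
  | succ n ih =>
    show (mulS _ _).map _ = _
    rw [map_val_mulS, ih, pow_succ _ (n + 1), ← Submodule.map_comp]
    rfl

theorem fgUpTo_tensorAlg {b : VBornology V W} {c : V}
    (h : ∀ B : Submodule V W, b.Bdd (B : Set W) → FGUpTo c B) {S : Submodule V (tensorAlg b)}
    (hS : (tensorAlg b).born.Bdd (S : Set (tensorAlg b))) : FGUpTo c S := by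
  obtain ⟨a, B, hB, hS⟩ := bdd_tensorAlg.1 hS
  have hpow : ∀ n, FGUpTo c (powS (B.map (tensorInclLinear b)) n) := fun n => by
    induction n with
    | zero => exact (h B hB).map _
    | succ n ih => exact FGUpTo.mulS ih ((h B hB).map _)
  refine (fgUpTo_iSup (n := a) hpow).mono ?_
  intro x hx
  have : tensorPart B a ≤ (⨆ n ∈ Finset.range a, powS (B.map (tensorInclLinear b)) n).map
      (tensorVal b) := by
    refine iSup₂_le fun n hn => ?_
    obtain ⟨n, rfl⟩ : ∃ n', n = n' + 1 := ⟨n - 1, by have := (Finset.mem_Icc.1 hn).1; omega⟩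
    rw [← map_val_powS b]
    refine Submodule.map_mono (le_iSup₂_of_le n (Finset.mem_range.2 ?_) le_rfl)
    have := (Finset.mem_Icc.1 hn).2
    omega
  obtain ⟨y, hy, e⟩ := this (hS x hx)
  rwa [← show y = x from Subtype.ext e]

end Tensor

/-! ### Nilpotence modulo the uniformiser -/

namespace BornAlg

variable {V : Type u} [CommRing V]

/-- Sums of products in the completion are represented termwise by sums of products. -/
theorem powS_top_completion_le (R : BornAlg.{u, v} V) (π : V) (k : ℕ) {x : R.completion π}
    (hx : x ∈ powS (⊤ : Submodule V (R.completion π)) k) :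
    ∃ c : R.cauchyAlg π, (∀ n, c.1 n ∈ powS (⊤ : Submodule V R) k) ∧ compMk R π c = x := by
  let C : ℕ → Submodule V (R.cauchyAlg π) := fun k =>
    (Submodule.pi Set.univ fun _ : ℕ => powS (⊤ : Submodule V R) k).comap
      (cauchySub R π).toSubmodule.subtype
  have hC : ∀ k (c : R.cauchyAlg π), c ∈ C k ↔ ∀ n, c.1 n ∈ powS (⊤ : Submodule V R) k :=
    fun k c => ⟨fun h n => h n trivial, fun h n _ => h n⟩
  have key : ∀ k, powS (⊤ : Submodule V (R.completion π)) k ≤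
      (C k).map ((compMk R π).toHom : R.cauchyAlg π →ₗ[V] R.completion π) := by
    intro k
    induction k with
    | zero =>
      intro x _
      obtain ⟨c, rfl⟩ := compMk_surjective x
      exact ⟨c, (hC 0 c).2 fun _ => trivial, rfl⟩
    | succ k ih =>
      refine mulS_le.2 fun x hx y _ => ?_
      obtain ⟨c, hc, rfl⟩ := ih hx
      obtain ⟨d, rfl⟩ := compMk_surjective y
      exact ⟨c * d, (hC _ _).2 fun n => mul_mem_mulS ((hC _ _).1 hc n) trivial,
        map_mul (compMk R π).toHom c d⟩
  obtain ⟨c, hc, rfl⟩ := key k hx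
  exact ⟨c, (hC _ _).1 hc, rfl⟩

section Tube

variable [IsDomain V]

/-- The span of the submodules `π ^ (-J) R ^ (m J + z)` of `F ⊗ R` with `k < J + z`. -/
noncomputable def tubePow (R : BornAlg.{u, v} V) (π : V) (m : ℕ+) (k : ℕ) : Submodule V R.frac :=
  ⨆ q : {q : ℕ × ℕ // k < q.1 + q.2}, ((AlgIdeal.top R).pow ((m : ℕ) * q.1.1 + q.1.2)).map
    (TensorProduct.mk V (FractionRing V) R ((algebraMap V (FractionRing V) π)⁻¹ ^ q.1.1))

theorem mulS_tubePow_le (R : BornAlg.{u, v} V) (π : V) (m : ℕ+) (k : ℕ) :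
    mulS (tubePow R π m k) (tubePow R π m 0) ≤ tubePow R π m (k + 1) := by
  unfold mulS
  nth_rewrite 1 [tubePow]
  nth_rewrite 1 [tubePow]
  rw [Submodule.map₂_iSup_left]
  refine iSup_le fun i => ?_
  rw [Submodule.map₂_iSup_right]
  refine iSup_le fun j => ?_
  refine Submodule.map₂_le.2 ?_
  rintro _ ⟨a, ha, rfl⟩ _ ⟨b, hb, rfl⟩
  have hij := i.2
  have hj := j.2
  refine Submodule.mem_iSup_of_mem ⟨(i.1.1 + j.1.1, i.1.2 + j.1.2), by dsimp only; omega⟩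
    ⟨a * b, ?_, ?_⟩
  · have := (AlgIdeal.top R).mul_mem_pow ha hb
    rwa [show (m : ℕ) * i.1.1 + i.1.2 + (m * j.1.1 + j.1.2) =
      m * (i.1.1 + j.1.1) + (i.1.2 + j.1.2) by ring] at this
  · rw [LinearMap.mul_apply', TensorProduct.mk_apply, TensorProduct.mk_apply,
      TensorProduct.mk_apply, Algebra.TensorProduct.tmul_mul_tmul, pow_add]

/-- A product of `k + 1` elements of the tube algebra of `R ^ m` in `R` is a sum of elements of
`π ^ (-J) R ^ (m J + z)` with `k < J + z`: each factor from `π ^ (-j) R ^ (m j)` contributes `j` to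
`J` if `j ≥ 1`, and contributes `1` to `z` if `j = 0`. -/
theorem powS_top_tube_le (R : BornAlg.{u, v} V) (π : V) (m : ℕ+) (k : ℕ) :
    (powS (⊤ : Submodule V (tube R (AlgIdeal.top R) π m)) k).map
      (tubeSub R (AlgIdeal.top R) π m).toSubmodule.subtype ≤ tubePow R π m k := by
  have h0 : tubeSubmodule R (AlgIdeal.top R) π m ≤ tubePow R π m 0 := by
    refine iSup_le fun j => ?_
    cases j with
    | zero => exact le_iSup_of_le ⟨(0, 1), Nat.one_pos⟩ le_rfl
    | succ j => exact le_iSup_of_le ⟨(j + 1, 0), Nat.succ_pos j⟩ le_rfl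
  induction k with
  | zero => exact (Submodule.map_le_iff_le_comap.2 fun x _ => x.2).trans h0
  | succ k ih =>
    refine Submodule.map_le_iff_le_comap.2 (mulS_le.2 fun x hx y _ => ?_)
    exact mulS_tubePow_le R π m k (mul_mem_mulS (ih ⟨x, hx, rfl⟩) (h0 y.2))

/-- The structure map from level `2 n` to level `n` maps products of `n + 1` factors to multiples
of `π`, since `2 n J + z ≥ n (J + 1)` if `n < J + z`. -/
theorem exists_smul_eq_tubeMap (R : BornAlg.{u, v} V) {π : V} (hπ : π ≠ 0) (n : ℕ+)
    (h : n ≤ 2 * n) {x : tube R (AlgIdeal.top R) π (2 * n)}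
    (hx : x ∈ powS (⊤ : Submodule V (tube R (AlgIdeal.top R) π (2 * n))) n) :
    ∃ y : tube R (AlgIdeal.top R) π n,
      π • y = tubeMap π (BHom.id R) (I := AlgIdeal.top R) (fun _ hx => hx) h x := by
  have hπ' : algebraMap V (FractionRing V) π ≠ 0 := by simpa using hπ
  have key : x.1 ∈ π • tubeSubmodule R (AlgIdeal.top R) π n := by
    refine (?_ : _ ≤ π • tubeSubmodule R (AlgIdeal.top R) π n)
      (powS_top_tube_le R π (2 * n) n ⟨x, hx, rfl⟩)
    refine iSup_le ?_
    rintro ⟨⟨J, z⟩, hJ⟩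
    rintro _ ⟨a, ha, rfl⟩
    refine mem_smul_iff.2 ⟨((algebraMap V (FractionRing V) π)⁻¹ ^ (J + 1)) ⊗ₜ[V] a,
      Submodule.mem_iSup_of_mem (J + 1) ⟨a, (AlgIdeal.top R).pow_antitone ?_ ha, rfl⟩, ?_⟩
    · dsimp only at hJ ⊢
      rw [PNat.mul_coe, show ((2 : ℕ+) : ℕ) = 2 from rfl]
      have := n.pos
      cases J with
      | zero => omega
      | succ J => nlinarith
    · rw [TensorProduct.smul_tmul', TensorProduct.mk_apply, pow_succ', Algebra.smul_def,
        ← mul_assoc, mul_inv_cancel₀ hπ', one_mul]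
  obtain ⟨y, hy, e⟩ := mem_smul_iff.1 key
  refine ⟨⟨y, hy⟩, Subtype.ext (e.trans ?_)⟩
  exact (LinearMap.congr_fun (LinearMap.lTensor_id (FractionRing V) R) x.1).symm

theorem daggerTube_top_isNilpotentMod (R : BornAlg.{u, v} V) {π : V} (hπ : π ≠ 0) :
    (daggerTube R (AlgIdeal.top R) π).IsNilpotentMod π := by
  intro n
  have hn : n ≤ 2 * n := PNat.coe_le_coe _ _ |>.1 (by
    rw [PNat.mul_coe, show ((2 : ℕ+) : ℕ) = 2 from rfl]; omega)
  refine ⟨2 * n, hn, n, fun x hx => ?_⟩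
  obtain ⟨c, hc, rfl⟩ := powS_top_completion_le _ π _ hx
  set f := lingMap π (tubeMap π (BHom.id R) (I := AlgIdeal.top R) (I' := AlgIdeal.top R)
    (fun _ hx => hx) hn)
  obtain ⟨S, hS, hcS⟩ := (cauchyMap π f c).2
  have htf := ling_isTorsionfree (tube_isTorsionfree R (AlgIdeal.top R) hπ n)
  obtain ⟨d, hd, e⟩ := exists_smul_eq_of_mem_cauchySubmodule htf hcS (N := 0) fun i _ =>
    exists_smul_eq_tubeMap R hπ n hn (hc i)
  obtain ⟨d, rfl⟩ := exists_cauchySub (htf.bdd_div hS) hd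
  refine ⟨compMk _ π d, ?_⟩
  show completionMap π f (compMk _ π c) = _
  rw [completionMap_compMk]
  refine (compMk_congr (d := π • d) (N := 0) fun i hi => (e i hi).symm).trans ?_
  exact map_smul (compMk _ π).toHom π d

theorem daggerTubeIdeal_isAnalyticallyNilpotent (R : BornAlg.{u, v} V) (I : AlgIdeal R) {π : V}
    (hπ : π ≠ 0) : (daggerTubeIdeal R I π).IsAnalyticallyNilpotent π :=
  ⟨daggerTube_top_isNilpotentMod I.toAlg hπ, daggerTubeIdeal R I π,
    daggerTube_isProDagger I.toAlg _ hπ,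
    ⟨⟨ProHom.id _, ProHom.id _, fun n => ⟨n, le_rfl, le_rfl, rfl⟩,
      fun n => ⟨n, le_rfl, le_rfl, rfl⟩⟩⟩⟩

end Tube

end BornAlg

/-! ### Lifting from torsionfree modules -/

section Lifting

theorem mem_smul_top_of_dvd {V : Type u} [CommRing V] {π : V} {κ : Type w} {c : κ →₀ V}
    (h : ∀ i, π ∣ c i) :
    c ∈ π • (⊤ : Submodule V (κ →₀ V)) := by
  rw [← c.sum_single]
  refine Submodule.sum_mem _ fun i _ => ?_
  obtain ⟨x, hx⟩ := h i
  rw [hx, ← smul_eq_mul, ← Finsupp.smul_single]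
  exact smul_mem_smul _ trivial

variable {V : Type u} [CommRing V] [IsDomain V] [IsDiscreteValuationRing V] {π : V}

theorem mk_residue_eq_zero_iff (hπ : Irreducible π) {x : V} :
    Ideal.Quotient.mk (IsLocalRing.maximalIdeal V) x = 0 ↔ π ∣ x := by
  rw [Ideal.Quotient.eq_zero_iff_mem, hπ.maximalIdeal_eq, Ideal.mem_span_singleton]

/-- A module over a discrete valuation ring has a family of elements that is a basis modulo `π`. -/
theorem exists_family_basis_mod (hπ : Irreducible π) (W : Type w) [AddCommGroup W] [Module V W] :
    ∃ (κ : Type w) (Λ : (κ →₀ V) →ₗ[V] W), (∀ x, ∃ c y, x = Λ c + π • y) ∧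
      ∀ c y, Λ c = π • y → c ∈ π • (⊤ : Submodule V (κ →₀ V)) := by
  let m := IsLocalRing.maximalIdeal V
  let : Field (V ⧸ m) := Ideal.Quotient.field m
  let b := Module.Basis.ofVectorSpace (V ⧸ m) (W ⧸ (m • ⊤ : Submodule V W))
  have hm : ∀ x : W, (Submodule.Quotient.mk x : W ⧸ (m • ⊤ : Submodule V W)) = 0 ↔
      ∃ y, π • y = x := fun x => by
    rw [Submodule.Quotient.mk_eq_zero, show m = Ideal.span {π} from hπ.maximalIdeal_eq,
      Submodule.ideal_span_singleton_smul, mem_smul_iff]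
    simp
  choose w hw using fun i => Submodule.Quotient.mk_surjective _ (b i)
  have hΛ : ∀ c : _ →₀ V, (Submodule.Quotient.mk (Finsupp.linearCombination V w c) :
      W ⧸ (m • ⊤ : Submodule V W)) =
        Finsupp.linearCombination (V ⧸ m) b (c.mapRange (Ideal.Quotient.mk m) (map_zero _)) := by
    intro c
    rw [Finsupp.linearCombination_apply, Finsupp.linearCombination_apply,
      Finsupp.sum_mapRange_index (by simp), Finsupp.sum, Finsupp.sum,
      ← Submodule.mkQ_apply, map_sum]
    refine Finset.sum_congr rfl fun i _ => ?_
    rw [map_smul, Submodule.mkQ_apply, hw]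
    rfl
  refine ⟨_, Finsupp.linearCombination V w, fun x => ?_, fun c y h => ?_⟩
  · let r := b.repr (Submodule.Quotient.mk x)
    obtain ⟨c, hc⟩ := Finsupp.mapRange_surjective (Ideal.Quotient.mk m) (map_zero _)
      Ideal.Quotient.mk_surjective r
    obtain ⟨y, hy⟩ := (hm (x - Finsupp.linearCombination V w c)).1 (by
      rw [Submodule.Quotient.mk_sub, hΛ, hc, b.linearCombination_repr, sub_self])
    exact ⟨c, y, by rw [hy]; abel⟩
  · refine mem_smul_top_of_dvd fun i => (mk_residue_eq_zero_iff hπ).1 ?_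
    have := (hm _).2 ⟨y, h.symm⟩
    rw [hΛ, ← b.linearCombination_repr (Finsupp.linearCombination _ _ _),
      b.repr_linearCombination] at this
    have := (linearIndependent_iff.1 b.linearIndependent) _ this
    exact DFunLike.congr_fun this i

/-- Linear maps on a torsionfree module lift along surjections onto modules of bounded torsion:
`W / π ^ n W` is free over `V / π ^ n V`. -/
theorem exists_lift_of_torsionfree (hπ : Irreducible π) {W : Type w} [AddCommGroup W] [Module V W]
    (hW : ∀ x : W, π • x = 0 → x = 0) {M : Type v} [AddCommGroup M] [Module V M]
    {N : Type t} [AddCommGroup N] [Module V N] {q : M →ₗ[V] N} (hq : Function.Surjective q)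
    (n : ℕ) (hM : ∀ x : M, π ^ n • x = 0) (g : W →ₗ[V] N) :
    ∃ G : W →ₗ[V] M, ∀ x, q (G x) = g x := by
  obtain ⟨κ, Λ, h1, h2⟩ := exists_family_basis_mod hπ W
  have h1' : ∀ k x, ∃ c y, x = Λ c + π ^ k • y := by
    intro k x
    induction k with
    | zero => exact ⟨0, x, by simp⟩
    | succ k ih =>
      obtain ⟨c, y, rfl⟩ := ih
      obtain ⟨d, z, rfl⟩ := h1 y
      exact ⟨c + π ^ k • d, z, by
        rw [map_add, map_smul, smul_add, smul_smul, ← pow_succ]; abel⟩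
  have h2' : ∀ k c y, Λ c = π ^ k • y → c ∈ π ^ k • (⊤ : Submodule V (κ →₀ V)) := by
    intro k
    induction k with
    | zero => intro c y _; rw [pow_zero, one_smul]; trivial
    | succ k ih =>
      intro c y h
      rw [pow_succ', mul_smul] at h
      obtain ⟨d, -, rfl⟩ := mem_smul_iff.1 (h2 c _ h)
      rw [map_smul, ← sub_eq_zero, ← smul_sub] at h
      rw [pow_succ', mul_smul]
      exact smul_mem_smul _ (ih d y (sub_eq_zero.1 (hW _ h)))
  obtain ⟨f, hf⟩ := Module.projective_lifting_property q (g.comp Λ) hq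
  have hf : ∀ c, q (f c) = g (Λ c) := LinearMap.congr_fun hf
  -- `F` is surjective, and `f` factors through it because `f` kills multiples of `π ^ n`.
  let F : (κ →₀ V) × W →ₗ[V] W := Λ.coprod (LinearMap.lsmul V W (π ^ n))
  have hF : Function.Surjective F := fun x => by
    obtain ⟨c, y, rfl⟩ := h1' n x
    exact ⟨(c, y), rfl⟩
  have hker : LinearMap.ker F ≤ LinearMap.ker (f.comp (LinearMap.fst V _ W)) := by
    rintro ⟨c, y⟩ h
    have h : Λ c + π ^ n • y = 0 := h
    obtain ⟨d, -, rfl⟩ := mem_smul_iff.1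
      (h2' n c (-y) (by rw [smul_neg]; exact eq_neg_of_add_eq_zero_left h))
    show f (π ^ n • d) = 0
    rw [map_smul, hM]
  let G := ((LinearMap.ker F).liftQ (f.comp (LinearMap.fst V _ W)) hker).comp
    (F.quotKerEquivOfSurjective hF).symm.toLinearMap
  have hG : ∀ z, G (F z) = f z.1 := fun z => by
    have : (F.quotKerEquivOfSurjective hF).symm (F z) = (LinearMap.ker F).mkQ z := by
      rw [LinearEquiv.symm_apply_eq]; rfl
    show (LinearMap.ker F).liftQ _ hker ((F.quotKerEquivOfSurjective hF).symm (F z)) = _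
    rw [this]
    rfl
  refine ⟨G, fun x => ?_⟩
  obtain ⟨⟨c, y⟩, rfl⟩ := hF x
  obtain ⟨z, hz⟩ := hq (g y)
  have : F (c, y) = Λ c + π ^ n • y := rfl
  rw [hG, hf, this, map_add, map_smul, ← hz, ← map_smul, hM, map_zero, add_zero]

end Lifting

/-! ### Intersecting the tube with the algebra -/

section Detect

theorem map_pow_of_map_le {V : Type u} [CommRing V] {π : V} {R : BornAlg.{u, v} V}
    {I : AlgIdeal R} {E : Type t} [Ring E] [Algebra V E]
    (φ : R →ₙₐ[V] E) (hI : ∀ r ∈ I.toSubmodule, ∃ e, π • e = φ r) (k : ℕ) {r : R}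
    (hr : r ∈ I.pow k) : ∃ e, π ^ k • e = φ r := by
  cases k with
  | zero => exact ⟨φ r, by simp⟩
  | succ k =>
    have key : powS I.toSubmodule k ≤
        (π ^ (k + 1) • (⊤ : Submodule V E)).comap (φ : R →ₗ[V] E) := by
      clear hr
      induction k with
      | zero =>
        intro r hr
        obtain ⟨e, he⟩ := hI r hr
        exact mem_smul_iff.2 ⟨e, trivial, by rw [zero_add, pow_one]; exact he⟩
      | succ k ih =>
        refine mulS_le.2 fun x hx y hy => ?_
        obtain ⟨e, -, he⟩ := mem_smul_iff.1 (ih hx)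
        obtain ⟨e', he'⟩ := hI y hy
        refine mem_smul_iff.2 ⟨e * e', trivial, ?_⟩
        show _ = φ (x * y)
        have he : π ^ (k + 1) • e = φ x := he
        rw [map_mul, ← he, ← he', smul_mul_smul_comm, ← pow_succ]
    obtain ⟨e, -, he⟩ := mem_smul_iff.1 (key hr)
    exact ⟨e, he⟩

variable {V : Type u} [CommRing V] [IsDomain V] [IsDiscreteValuationRing V] {π : V}

/-- If `f` is detected by homomorphisms `φ n` to algebras killed by `π ^ (n + 1)` that map `I` to
multiples of `π`, then `R ∩ (I + ∑ j ≥ 1, π ^ (-j) I ^ (l j))` is contained in the kernel of `f`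
for `l ≥ 2`: after multiplication with `π ^ N` for `N ≥ j`, the map `φ n` sends the summand
`π ^ (-j) I ^ (l j)` to multiples of `π ^ (N + 1)`, because `l j > j`. -/
theorem eq_zero_of_mem_tubeKer (hπ : Irreducible π) {R : BornAlg.{u, v} V} {I : AlgIdeal R}
    {l : ℕ+} (hl : 2 ≤ (l : ℕ)) {A : Type w} [Zero A] (f : R → A) (E : ℕ → Type t)
    [∀ n, Ring (E n)] [∀ n, Algebra V (E n)] (φ : ∀ n, R →ₙₐ[V] E n)
    (hE : ∀ n (x : E n), π ^ (n + 1) • x = 0)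
    (hI : ∀ n, ∀ r ∈ I.toSubmodule, ∃ e, π • e = φ n r)
    (hφ : ∀ n r, π ^ n • φ n r = 0 → f r = 0) {r : R}
    (hr : (1 : FractionRing V) ⊗ₜ[V] r ∈ tubeKer R I π l) : f r = 0 := by
  have hπ' : algebraMap V (FractionRing V) π ≠ 0 := by simpa using hπ.ne_zero
  let Z : Submodule V (FractionRing V ⊗[V] R) := {
    carrier := {x | ∃ (N : ℕ) (y : R), π ^ N • x = (1 : FractionRing V) ⊗ₜ[V] y ∧
      ∀ n, ∃ e, π ^ (N + 1) • e = φ n y}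
    zero_mem' := ⟨0, 0, by simp, fun n => ⟨0, by simp⟩⟩
    add_mem' := by
      rintro x x' ⟨N, y, h, h'⟩ ⟨M, z, k, k'⟩
      refine ⟨N + M, π ^ M • y + π ^ N • z, ?_, fun n => ?_⟩
      · rw [TensorProduct.tmul_add, TensorProduct.tmul_smul, TensorProduct.tmul_smul, ← h, ← k,
          smul_smul, smul_smul, ← pow_add, ← pow_add, smul_add, add_comm M N]
      · obtain ⟨e, he⟩ := h' n
        obtain ⟨e', he'⟩ := k' n
        refine ⟨e + e', ?_⟩
        rw [map_add, map_smul, map_smul, ← he, ← he', smul_smul, smul_smul, ← pow_add, ← pow_add,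
          smul_add]
        congr 3
        ring
    smul_mem' := by
      rintro c x ⟨N, y, h, h'⟩
      refine ⟨N, c • y, by rw [smul_comm, h, TensorProduct.tmul_smul], fun n => ?_⟩
      obtain ⟨e, he⟩ := h' n
      exact ⟨c • e, by rw [map_smul, ← he, smul_comm]⟩ }
  have hZ : tubeKer R I π l ≤ Z := by
    refine tubeKer_le_of (fun a ha => ⟨0, a, by simp, fun n => ?_⟩) fun j a ha =>
      ⟨j + 1, a, ?_, fun n => ?_⟩
    · rw [zero_add, pow_one]
      exact hI n a ha
    · rw [TensorProduct.smul_tmul', Algebra.smul_def, map_pow, ← mul_pow, mul_inv_cancel₀ hπ',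
        one_pow]
    · refine map_pow_of_map_le (φ n) (hI n) _ (I.pow_antitone ?_ ha)
      nlinarith
  obtain ⟨N, y, h, h'⟩ := hZ hr
  rw [← TensorProduct.tmul_smul] at h
  obtain ⟨e, he⟩ := (IsLocalizedModule.eq_iff_exists (nonZeroDivisors V)
    (TensorProduct.mk V (FractionRing V) R 1)).1 h
  obtain ⟨M, hM⟩ := IsDiscreteValuationRing.associated_pow_irreducible
    (nonZeroDivisors.ne_zero e.2) hπ
  obtain ⟨u, hu⟩ := hM.dvd
  have he : π ^ M • π ^ N • r = π ^ M • y := by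
    rw [hu, mul_comm, mul_smul, mul_smul]
    exact congrArg (u • ·) he
  refine hφ (M + N) r ?_
  obtain ⟨e', he'⟩ := h' (M + N)
  rw [← map_smul, pow_add, mul_smul, he, map_smul, ← he', smul_smul, ← pow_add, ← add_assoc, hE]

end Detect

/-! ### Representations of the tensor algebra modulo powers of the uniformiser -/

section Representation

variable {V : Type u} [CommRing V]

/-- The free module `ι →₀ V` modulo `c`. -/
abbrev FreeMod (V : Type u) [CommRing V] (ι : Type t) (c : V) : Type (max u t) :=
  (ι →₀ V) ⧸ (c • (⊤ : Submodule V (ι →₀ V)))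

theorem FreeMod.smul_eq_zero {ι : Type t} {c : V} (x : FreeMod V ι c) : c • x = 0 := by
  obtain ⟨y, rfl⟩ := Submodule.Quotient.mk_surjective _ x
  rw [← Submodule.Quotient.mk_smul, Submodule.Quotient.mk_eq_zero]
  exact smul_mem_smul _ trivial

/-- A linear map on `FreeMod V ι c` factors through a linear map from a module killed by `c` if its
range does. -/
theorem FreeMod.exists_lift {ι : Type t} {c : V} {M : Type v₁} [AddCommGroup M] [Module V M]
    {N : Type v₂} [AddCommGroup N] [Module V N] (hM : ∀ x : M, c • x = 0) (q : M →ₗ[V] N)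
    (h : FreeMod V ι c →ₗ[V] N) (hq : ∀ x, ∃ y, q y = h x) :
    ∃ e : FreeMod V ι c →ₗ[V] M, ∀ x, q (e x) = h x := by
  let mk := (c • (⊤ : Submodule V (ι →₀ V))).mkQ
  obtain ⟨f, hf⟩ := Module.projective_lifting_property q.rangeRestrict
    ((h.comp mk).codRestrict (LinearMap.range q) fun x => hq _) q.surjective_rangeRestrict
  have hf : ∀ x, q (f x) = h (mk x) := fun x => congrArg Subtype.val (LinearMap.congr_fun hf x)
  refine ⟨(c • (⊤ : Submodule V (ι →₀ V))).liftQ f fun x hx => ?_, fun x => ?_⟩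
  · obtain ⟨y, -, rfl⟩ := mem_smul_iff.1 hx
    rw [LinearMap.mem_ker, map_smul, hM]
  · obtain ⟨y, rfl⟩ := Submodule.Quotient.mk_surjective _ x
    exact hf y

theorem FreeMod.exists_smul_eq [IsDomain V] {π : V} (hπ : π ≠ 0) {ι : Type t} {n : ℕ}
    {x : FreeMod V ι (π ^ (n + 1))} (hx : π ^ n • x = 0) : ∃ y, π • y = x := by
  obtain ⟨c, rfl⟩ := Submodule.Quotient.mk_surjective _ x
  rw [← Submodule.Quotient.mk_smul, Submodule.Quotient.mk_eq_zero] at hx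
  obtain ⟨d, -, hd⟩ := mem_smul_iff.1 hx
  refine ⟨Submodule.Quotient.mk d, ?_⟩
  rw [← Submodule.Quotient.mk_smul]
  congr 1
  refine smul_right_injective _ (pow_ne_zero n hπ) ?_
  dsimp only
  rw [smul_smul, ← pow_succ, hd]

variable [IsDomain V] [IsDiscreteValuationRing V] {π : V}

open IsLocalRing in
theorem residue_smul_eq_zero {M : Type w} [AddCommGroup M] [Module (ResidueField V) M] [Module V M]
    [IsScalarTower V (ResidueField V) M] (hπ : Irreducible π) (x : M) : π • x = 0 := by
  rw [← algebraMap_smul (ResidueField V) π x, ResidueField.algebraMap_eq,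
    (residue_eq_zero_iff π).2 (hπ.maximalIdeal_eq ▸ Ideal.mem_span_singleton_self π), zero_smul]

open IsLocalRing in
/-- A vector space `U` over the residue field is the reduction mod `π` of a free module over
`V / π ^ (n + 1) V`. -/
theorem exists_freeMod_cover (hπ : Irreducible π) (U : Type w) [AddCommGroup U]
    [Module (ResidueField V) U] [Module V U] [IsScalarTower V (ResidueField V) U] :
    ∃ ι : Type w, ∀ n : ℕ, ∃ q : FreeMod V ι (π ^ (n + 1)) →ₗ[V] U,
      Function.Surjective q ∧ ∀ x, q x = 0 → ∃ y, π • y = x := by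
  let b := Module.Basis.ofVectorSpace (ResidueField V) U
  let f := Finsupp.linearCombination V b
  have hf : ∀ c, f c = Finsupp.linearCombination (ResidueField V) b
      (c.mapRange (residue V) (map_zero _)) := by
    intro c
    rw [Finsupp.linearCombination_apply, Finsupp.linearCombination_apply,
      Finsupp.sum_mapRange_index (by simp)]
    exact Finsupp.sum_congr fun i _ => (algebraMap_smul (ResidueField V) _ _).symm
  refine ⟨_, fun n => ⟨(π ^ (n + 1) • ⊤ : Submodule V (_ →₀ V)).liftQ f fun x hx => ?_,
    fun x => ?_, fun x hx => ?_⟩⟩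
  · obtain ⟨y, -, rfl⟩ := mem_smul_iff.1 hx
    rw [LinearMap.mem_ker, map_smul, pow_succ', mul_smul, residue_smul_eq_zero hπ]
  · obtain ⟨c, hc⟩ := Finsupp.mapRange_surjective (residue V) (map_zero _) residue_surjective
      (b.repr x)
    refine ⟨Submodule.Quotient.mk c, ?_⟩
    rw [Submodule.liftQ_apply, hf, hc, b.linearCombination_repr]
  · obtain ⟨c, rfl⟩ := Submodule.Quotient.mk_surjective _ x
    rw [Submodule.liftQ_apply, hf] at hx
    have hx := (linearIndependent_iff.1 b.linearIndependent) _ hx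
    obtain ⟨d, -, rfl⟩ := mem_smul_iff.1 (mem_smul_top_of_dvd (π := π) fun i => by
      have : residue V (c i) = 0 := DFunLike.congr_fun hx i
      rw [residue_eq_zero_iff, hπ.maximalIdeal_eq, Ideal.mem_span_singleton] at this
      exact this)
    exact ⟨Submodule.Quotient.mk d, rfl⟩

open IsLocalRing

variable {A : Type v} [NonUnitalRing A] [Module (ResidueField V) A]
  [IsScalarTower (ResidueField V) A A] [SMulCommClass (ResidueField V) A A]
  [Module V A] [IsScalarTower V (ResidueField V) A]
  {W : Type w} [AddCommGroup W] [Module V W]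

/-- The tensor algebra of a torsionfree module `W` acts on a free module over `V / π ^ (n + 1) V`
whose reduction mod `π` is the unitization of `A`, in a way that lifts the left multiplication by
the values of the extension of `ρ : W → A`. The algebra `A` itself need not lift. -/
theorem exists_representation (hπ : Irreducible π) (b : VBornology V W)
    (hW : ∀ x : W, π • x = 0 → x = 0) (ρ : W →ₗ[V] A) {ι : Type t} {n : ℕ}
    {q : FreeMod V ι (π ^ (n + 1)) →ₗ[V] Unitization (ResidueField V) A}
    (hq : Function.Surjective q) :
    ∃ φ : tensorAlg b →ₙₐ[V] Module.End V (FreeMod V ι (π ^ (n + 1))),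
      ∀ r x, q (φ r x) = (tensorLift b ρ r : Unitization (ResidueField V) A) * q x := by
  let C := FreeMod V ι (π ^ (n + 1))
  let U := Unitization (ResidueField V) A
  let inrLinear : A →ₗ[V] U := {
    toFun := Unitization.inr
    map_add' := Unitization.inr_add _
    map_smul' := fun c a => Unitization.inr_smul _ c a }
  let L : W →ₗ[V] (C →ₗ[V] U) :=
    (LinearMap.lcomp V U q).comp ((LinearMap.mul V U).comp (inrLinear.comp ρ))
  have hL : ∀ w x, L w x = (ρ w : U) * q x := fun _ _ => rfl
  have hpost : Function.Surjective (LinearMap.compRight V q : (C →ₗ[V] C) →ₗ[V] (C →ₗ[V] U)) := by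
    intro h
    obtain ⟨e, he⟩ := FreeMod.exists_lift FreeMod.smul_eq_zero q h fun x => hq _
    exact ⟨e, LinearMap.ext he⟩
  obtain ⟨G, hG⟩ := exists_lift_of_torsionfree hπ hW hpost (n + 1)
    (fun e => LinearMap.ext fun x => FreeMod.smul_eq_zero (e x)) L
  have hG : ∀ w x, q (G w x) = (ρ w : U) * q x := fun w x => LinearMap.congr_fun (hG w) x
  let Φ : TensorAlgebra V W →ₐ[V] Module.End V C := TensorAlgebra.lift V G
  let φ : tensorAlg b →ₙₐ[V] Module.End V C := {
    toFun := fun r => Φ r.1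
    map_smul' := fun c r => map_smul Φ c r.1
    map_zero' := map_zero Φ
    map_add' := fun r s => map_add Φ r.1 s.1
    map_mul' := fun r s => map_mul Φ r.1 s.1 }
  refine ⟨φ, ?_⟩
  rintro ⟨r, hr⟩
  induction hr using NonUnitalAlgebra.adjoin_induction with
  | mem r hr =>
    obtain ⟨w, rfl⟩ := hr
    intro x
    show q (TensorAlgebra.lift V G (TensorAlgebra.ι V w) x) =
      (tensorLift b ρ (tensorIncl b w) : U) * _
    rw [TensorAlgebra.lift_ι_apply, hG, tensorLift_incl]
  | add r s hr hs ihr ihs =>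
    intro x
    show q (φ (⟨r, hr⟩ + ⟨s, hs⟩) x) = ((tensorLift b ρ (⟨r, hr⟩ + ⟨s, hs⟩) : A) : U) * q x
    rw [map_add, map_add, LinearMap.add_apply, map_add, ihr, ihs, Unitization.inr_add, add_mul]
  | zero =>
    intro x
    show q (φ 0 x) = ((tensorLift b ρ 0 : A) : U) * q x
    rw [map_zero, map_zero, LinearMap.zero_apply, map_zero, Unitization.inr_zero, zero_mul]
  | mul r s hr hs ihr ihs =>
    intro x
    show q (φ (⟨r, hr⟩ * ⟨s, hs⟩) x) = ((tensorLift b ρ (⟨r, hr⟩ * ⟨s, hs⟩) : A) : U) * q x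
    rw [map_mul, map_mul, Module.End.mul_apply, ihr, ihs, Unitization.inr_mul, mul_assoc]
  | smul c r hr ih =>
    intro x
    show q (φ (c • ⟨r, hr⟩) x) = ((tensorLift b ρ (c • ⟨r, hr⟩) : A) : U) * q x
    rw [map_smul, map_smul, LinearMap.smul_apply, map_smul, ih, Unitization.inr_smul,
      smul_mul_assoc]

/-- The intersection of the tensor algebra with `I + ∑ j ≥ 1, π ^ (-j) I ^ (l j)` is contained in
the kernel `I` of `tensorLift b ρ`, for `l ≥ 2`. The representations of `exists_representation` map
`I` to multiples of `π` and detect elements outside `I` by their action on a lift of the unit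
element. -/
theorem tensorLift_eq_zero_of_mem_tubeKer (hπ : Irreducible π) (b : VBornology V W)
    (hW : ∀ x : W, π • x = 0 → x = 0) (ρ : W →ₗ[V] A) {l : ℕ+} (hl : 2 ≤ (l : ℕ))
    {r : tensorAlg b} (hr : (1 : FractionRing V) ⊗ₜ[V] r ∈
      tubeKer (tensorAlg b) (kerIdeal (tensorAlg b) (tensorLift b ρ)) π l) :
    tensorLift b ρ r = 0 := by
  obtain ⟨ι, h⟩ := exists_freeMod_cover hπ (Unitization (ResidueField V) A)
  choose q hq hker using h
  choose φ hφ using fun n => exists_representation hπ b hW ρ (hq n)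
  let _ : ∀ n, Ring (Module.End V (FreeMod V ι (π ^ (n + 1)))) := fun n => inferInstance
  refine eq_zero_of_mem_tubeKer hπ hl (tensorLift b ρ)
    (fun n => Module.End V (FreeMod V ι (π ^ (n + 1)))) φ
    (fun n e => LinearMap.ext fun x => FreeMod.smul_eq_zero (e x)) (fun n r hr => ?_)
    (fun n r hr => ?_) hr
  · have hr : tensorLift b ρ r = 0 := hr
    obtain ⟨e, he⟩ := FreeMod.exists_lift FreeMod.smul_eq_zero (LinearMap.lsmul V _ π) (φ n r)
      fun x => hker n _ (by rw [hφ, hr, Unitization.inr_zero, zero_mul])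
    exact ⟨e, LinearMap.ext he⟩
  · -- Evaluate at a lift of the unit element.
    obtain ⟨x, hx⟩ := hq n 1
    obtain ⟨z, hz⟩ := FreeMod.exists_smul_eq hπ.ne_zero (x := φ n r x) (LinearMap.congr_fun hr x)
    have := hφ n r x
    rw [← hz, map_smul, residue_smul_eq_zero hπ, hx, mul_one] at this
    exact Unitization.inr_injective (this.symm.trans (Unitization.inr_zero _).symm)

end Representation

/-! ### Shifting projective systems -/

section Shift

variable {V : Type u} [CommRing V]

/-- The projective system without its first entry. -/
def ProSys.shift (B : ProSys.{u, v} V) : ProSys.{u, v} V where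
  obj n := B.obj (n + 1)
  map h := B.map (add_le_add_left h 1)
  map_id n := B.map_id (n + 1)
  map_comp h h' := B.map_comp (add_le_add_left h 1) (add_le_add_left h' 1)

/-- A projective system is isomorphic to its shift. -/
def ProIso.shift (B : ProSys.{u, v} V) : ProIso B B.shift where
  hom := {
    idx := fun n => n + 1
    hom := fun n => BHom.id _
    compat := fun {m n} h => ⟨m + 1, add_le_add_left h 1, le_rfl, by rw [B.map_id]; rfl⟩ }
  inv := {
    idx := fun n => n
    hom := fun n => B.map (PNat.lt_add_right n 1).le
    compat := fun {m n} h => ⟨m, h, le_rfl, by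
      rw [B.shift.map_id]
      exact (B.map_comp _ _).trans (B.map_comp _ _).symm⟩ }
  hom_inv n := ⟨n + 1, le_rfl, (PNat.lt_add_right n 1).le, BHom.ext fun x => B.map_map_apply _ _ x⟩
  inv_hom n := ⟨n + 1, le_rfl, (PNat.lt_add_right n 1).le, BHom.ext fun x => B.map_map_apply _ _ x⟩

/-- A system of bounded homomorphisms on the shift of a projective system to a constant system
represents a pro-homomorphism. -/
def ProHom.ofShift {B : ProSys.{u, v} V} {A : BornAlg.{u, w} V}
    (p : SysHom B.shift (ProSys.const A)) : ProHom B (ProSys.const A) where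
  idx n := n + 1
  hom := p.app
  compat {m n} h := ⟨m + 1, add_le_add_left h 1, le_rfl, by
    rw [B.map_id]; exact p.naturality h⟩

/-- A diagram that becomes a system of extensions after a shift is an extension of pro-algebras. -/
theorem isProExtension_of_shift {K : ProSys.{u, v₁} V} {E : ProSys.{u, v₂} V}
    {A : BornAlg.{u, w} V} (i : SysHom K E) (p : SysHom E.shift (ProSys.const A))
    (h : ∀ n, IsExtension (i.app (n + 1)) (p.app n)) :
    IsProExtension i.toProHom (ProHom.ofShift p) :=
  ⟨K.shift, E.shift, ProSys.const A,
    { app := fun n => i.app (n + 1), naturality := fun h => i.naturality (add_le_add_left h 1) }, p,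
    ProIso.shift K, ProIso.shift E,
    { hom := ProHom.id _
      inv := ProHom.id _
      hom_inv := fun n => ⟨n, le_rfl, le_rfl, rfl⟩
      inv_hom := fun n => ⟨n, le_rfl, le_rfl, rfl⟩ },
    h, fun n => ⟨n + 1, le_rfl, le_rfl, rfl⟩, fun n => ⟨n + 1, le_rfl, le_rfl, rfl⟩⟩

end Shift

/-! ### The lifting from the tensor algebra -/

theorem tubeKer_antitone {V : Type u} [CommRing V] [IsDomain V] {π : V}
    (R : BornAlg.{u, v} V) (I : AlgIdeal R) {l l' : ℕ+} (h : l' ≤ l) :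
    tubeKer R I π l ≤ tubeKer R I π l' :=
  iSup_mono fun j => Submodule.map_mono (inf_le_inf_right _ (I.pow_antitone
    (Nat.mul_le_mul_right j h)))

section Residue

open IsLocalRing

variable {V : Type u} [CommRing V] [IsDomain V] [IsDiscreteValuationRing V] {π : V}
  {A : Type v} [NonUnitalRing A] [Module (ResidueField V) A]
  [IsScalarTower (ResidueField V) A A] [SMulCommClass (ResidueField V) A A]
  [Module V A] [IsScalarTower V (ResidueField V) A]

/-- The dagger completed tubes of the tensor algebra of a torsionfree module `W` that is fine mod
`π` form a pro-dagger lifting of any algebra over the residue field that is a quotient of `W`. The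
homomorphism to `A` exists on the tube of `I ^ l` for `l ≥ 2` only, so that the system of extensions
begins there. -/
theorem isProDaggerLifting_tensorAlg (hπ : Irreducible π) {W : Type w} [AddCommGroup W] [Module V W]
    (b : VBornology V W) (ρ : W →ₗ[V] A) (htf : b.IsTorsionfree π) (hfine : b.IsFineMod π)
    (hρ : Function.Surjective ρ) :
    ∃ p : ProHom (daggerTube (tensorAlg b) (kerIdeal (tensorAlg b) (tensorLift b ρ)) π)
        (ProSys.const (fineAlg V A)),
      (∀ (n : ℕ+) (x : tensorAlg b),
        p.hom n (toDaggerTube (tensorAlg b) (kerIdeal (tensorAlg b) (tensorLift b ρ)) π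
          (p.idx n) x) = tensorLift b ρ x) ∧
      IsProDaggerLifting π
        (daggerTubeIncl (tensorAlg b) (kerIdeal (tensorAlg b) (tensorLift b ρ)) π).toProHom p := by
  set I := kerIdeal (tensorAlg b) (tensorLift b ρ) with hI
  have hA : ∀ a : A, π • a = 0 := residue_smul_eq_zero hπ
  have hfg : ∀ S : Submodule V (tensorAlg b), (tensorAlg b).born.Bdd (S : Set (tensorAlg b)) →
      ∀ k, VBornology.FGUpTo (π ^ k) S := fun S hS k =>
    fgUpTo_tensorAlg (fun B hB => hfine.fgUpTo_pow htf k hB) hS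
  have hsurj : Function.Surjective (tensorLift b ρ) := fun a => by
    obtain ⟨x, rfl⟩ := hρ a
    exact ⟨_, tensorLift_incl b ρ x⟩
  have hl : ∀ n : ℕ+, 2 ≤ ((n + 1 : ℕ+) : ℕ) := fun n => by
    rw [PNat.add_coe, PNat.one_coe]; have := n.pos; omega
  choose p hp hext using fun n : ℕ+ => exists_tube_isExtension (l := n + 1) hπ.ne_zero hA
    (tensorLift b ρ) hsurj (fun r => tensorLift_eq_zero_of_mem_tubeKer hπ b htf.1 ρ (hl n))
    (fun S hS => VBornology.isFineMod_iff.1 (tube_isFineMod hπ I (n + 1) hfg) S hS)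
  -- The value of `p n` is read off a decomposition into an element of the tensor
  -- algebra and an element of `tubeKer`.
  have hpr : ∀ n (x : tube (tensorAlg b) I π (n + 1)) r,
      x.1 - (1 : FractionRing V) ⊗ₜ[V] r ∈ tubeKer (tensorAlg b) I π (n + 1) →
        p n x = tensorLift b ρ r := fun n x r h => by
    have := ((hext n).exact (x - toTube (tensorAlg b) I π (n + 1) r)).2 (mem_range_tubeIncl.2 h)
    rw [← hp n r]
    exact sub_eq_zero.1 ((map_sub (p n).toHom _ _).symm.trans this)
  have hmap : ∀ {m n : ℕ+} (h : n ≤ m) (x : tube (tensorAlg b) I π (m + 1)),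
      p n (tubeMap π (BHom.id _) (fun _ hx => hx) (add_le_add_left h 1) x) = p m x := by
    intro m n h x
    obtain ⟨r, hr⟩ := exists_sub_mem_tubeKer x.2
    rw [hpr m x r hr]
    refine hpr n _ r (tubeKer_antitone _ I (add_le_add_left h 1) ?_)
    have : (tubeMap π (BHom.id (tensorAlg b)) (I := I) (I' := I) (fun _ hx => hx)
      (add_le_add_left h 1) x).1 = x.1 :=
      LinearMap.congr_fun (LinearMap.lTensor_id (FractionRing V) (tensorAlg b)) x.1
    rw [this]
    exact hr
  let P : SysHom (daggerTube (tensorAlg b) I π).shift (ProSys.const (fineAlg V A)) := {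
    app := fun n => completionLift (lingLift (p n) hA) hA
    naturality := fun {m n} h => by
      ext x
      obtain ⟨c, rfl⟩ := compMk_surjective x
      obtain ⟨N, hN⟩ := eventualValue_spec (lingLift (p m) hA) hA c
      exact eventualValue_eq (lingLift (p n) hA) hA (N := N) fun i hi =>
        (hmap h (c.1 i)).trans (hN i hi) }
  refine ⟨ProHom.ofShift P, fun n x => ?_, isProExtension_of_shift _ P fun n =>
    isExtension_completion (isExtension_ling (hext n) hA) hA,
    daggerTube_isProDagger _ I hπ.ne_zero, daggerTube_isFineMod hπ I hfg,
    daggerTubeIdeal_isAnalyticallyNilpotent _ I hπ.ne_zero⟩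
  exact (completionLift_toCompletion (lingLift (p n) hA) hA _).trans (hp n x)

end Residue

/-! ### Free modules with the fine bornology -/

section Free

variable {V : Type u} [CommRing V] {π : V}

theorem fine_isFineMod (M : Type w) [AddCommGroup M] [Module V M] :
    (VBornology.fine V M).IsFineMod π :=
  VBornology.isFineMod_iff.2 fun S hS => by
    obtain ⟨T, hT, hST⟩ := VBornology.bdd_fine.1 hS
    exact ⟨T, hT, le_trans (b := T) hST le_sup_left⟩

variable [IsDomain V] [IsDiscreteValuationRing V]

theorem fine_isTorsionfree (hπ : π ≠ 0) (M : Type w) [AddCommGroup M] [Module V M]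
    [Module.IsTorsionFree V M] : (VBornology.fine V M).IsTorsionfree π := by
  have hinj : Function.Injective (LinearMap.lsmul V M π) := smul_right_injective M hπ
  refine ⟨fun x hx => hinj (by simpa using hx), fun s hs => ?_⟩
  obtain ⟨S, hS, hs⟩ := VBornology.bdd_fine.1 hs
  refine VBornology.bdd_fine.2 ⟨S.comap (LinearMap.lsmul V M π), ?_, fun x hx => hs ⟨x, hx, rfl⟩⟩
  refine Submodule.fg_of_fg_map_injective _ hinj ?_
  have : IsNoetherian V S := isNoetherian_of_fg_of_noetherian _ hS
  exact isNoetherian_submodule.1 this _ (Submodule.map_comap_le _ _)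

end Free

end DaggerLift

open DaggerLift DaggerLift.BornAlg

theorem mainTheorem3
    {V : Type u} [CommRing V] [IsDomain V] [IsDiscreteValuationRing V]
    [IsAdicComplete (IsLocalRing.maximalIdeal V) V] [CharZero V]
    {π : V} (hπ : Irreducible π)
    {A : Type v} [NonUnitalRing A] [Module (IsLocalRing.ResidueField V) A]
    [IsScalarTower (IsLocalRing.ResidueField V) A A]
    [SMulCommClass (IsLocalRing.ResidueField V) A A]
    [Module V A] [IsScalarTower V (IsLocalRing.ResidueField V) A] :
    (∀ {W : Type w} [AddCommGroup W] [Module V W] (b : VBornology V W) (ρ : W →ₗ[V] A),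
      b.IsTorsionfree π → b.IsComplete π → b.IsFineMod π → Function.Surjective ρ →
      ∃ p : ProHom (daggerTube (tensorAlg b) (kerIdeal (tensorAlg b) (tensorLift b ρ)) π)
          (ProSys.const (fineAlg V A)),
        (∀ (n : ℕ+) (x : tensorAlg b),
          p.hom n (toDaggerTube (tensorAlg b) (kerIdeal (tensorAlg b) (tensorLift b ρ)) π
            (p.idx n) x) = tensorLift b ρ x) ∧
        IsProDaggerLifting π
          (daggerTubeIncl (tensorAlg b) (kerIdeal (tensorAlg b) (tensorLift b ρ)) π).toProHom p) ∧
    (∃ (N D : ProSys.{u, max u v} V) (i : ProHom N D) (p : ProHom D (ProSys.const (fineAlg V A))),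
      IsProDaggerLifting π i p) := by
  refine ⟨fun b ρ htf _ hfine hρ => isProDaggerLifting_tensorAlg hπ b ρ htf hfine hρ, ?_⟩
  obtain ⟨p, -, hp⟩ := isProDaggerLifting_tensorAlg hπ (VBornology.fine V (A →₀ V))
    (Finsupp.linearCombination V (id : A → A)) (fine_isTorsionfree hπ.ne_zero _)
    (fine_isFineMod _) (Finsupp.linearCombination_id_surjective V A)
  exact ⟨_, _, _, p, hp⟩
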